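/- Setting. Let $G$ be a compact semisimple Lie group with Lie algebra $\mathfrak g$ and (negative definite) Killing form $c=\langle\cdot,\cdot\rangle_{\mathfrak g}$, let $\pi:P\to M$ be a smooth principal $G$-bundle (right action), $A\in\Omega^1(P,\mathfrak g)$ a principal connection, and $H_0\in\Omega^3(M)$. For $x\in\mathfrak g$ let $\#x$ be its fundamental vector field. Sections of the adjoint bundle $\mathfrak g_P$ are smooth maps $\Phi:P\to\mathfrak g$ with $\Phi(p\cdot g)=\mathrm{Ad}_{g^{-1}}\Phi(p)$; put $j(\Phi)(p)=\#(\Phi(p))(p)$. Let $X^h$ be the $A$-horizontal lift of $X\in\mathfrak X(M)$, $D_X\Phi=X^h.\Phi$, and $F(X,Y)=\Omega(X^h,Y^h)$ with $\Omega=dA+\tfrac12[A\wedge A]$. On $E=\mathbb TP=TP\oplus T^*P$ take the anchor $\rho(X,\xi)=X$, the pairing $\langle (X,\xi),(Y,\eta)\rangle_E=\eta(X)+\xi(Y)$ and the bracket $[(X,\xi),(Y,\eta)]_E=([X,Y],\mathcal L_X\eta-i_Yd\xi-H(X,Y,\cdot))$ with $H=\pi^*H_0+\tfrac12 CS_3(A)$,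 $CS_3(A)=\langle dA\wedge A\rangle_{\mathfrak g}+\tfrac13\langle[A\wedge A]_{\mathfrak g}\wedge A\rangle_{\mathfrak g}$. On $E'=TM\oplus\mathfrak g_P\oplus T^*M$ take the anchor $\rho'(X,\Phi,\xi)=X$, the pairing $\langle (X,\Phi,\xi),(Y,\Phi',\eta)\rangle_{E'}=\eta(X)+\xi(Y)+\langle\Phi,\Phi'\rangle_{\mathfrak g}$ and the bracket $$[(X,\Phi,\xi),(Y,\Phi',\eta)]_{E'}=\big([X,Y],\ D_X\Phi'-D_Y\Phi-F(X,Y)-[\Phi,\Phi']_{\mathfrak g},\ \mathcal L_X\eta-i_Yd\xi-H_0(X,Y,\cdot)+\langle F(X,\cdot),\Phi'\rangle_{\mathfrak g}-\langle F(Y,\cdot),\Phi\rangle_{\mathfrak g}+\langle D\Phi,\Phi'\rangle_{\mathfrak g}\big).$$ These are Courant algebroids, possibly without the Leibniz identity (pre-Courant algebroids), since $H$ is not required to be closed. Let $\iota(X,\Phi,\xi)=(X^h+j(\Phi),\pi^*\xi+\tfrac12\langle A,\Phi\rangle_{\mathfrak g})$ for $(X,\Phi,\xi)\in\Gamma(E')$,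 and $\Re(\Phi)=(j(\Phi),-\tfrac12\langle A,\Phi\rangle_{\mathfrak g})$ for $\Phi:P\to\mathfrak g$ (in particular for constants $x\in\mathfrak g$). Let $K\subset E$ be the subbundle spanned by the $\Re(x)$, $x\in\mathfrak g$. The $G$-invariant sections of $E$ are $\Gamma_G(E)=\Gamma_G(K^\perp)\oplus\Gamma_G(K)=\iota(\Gamma(E'))\oplus\Re(\Gamma(\mathfrak g_P))$; write $(\psi,\Phi)=\iota(\psi)+\Re(\Phi)$. For a connection $\nabla$ on such an algebroid (i.e. $\nabla:\Gamma(E)\times\Gamma(E)\to\Gamma(E)$ is $\mathbb R$-bilinear, $C^\infty$-linear in the first argument, satisfies $\nabla_\psi(f\psi')=f\nabla_\psi\psi'+(\rho(\psi).f)\psi'$, and preserves the pairing) put $R^{(0)}(\phi',\phi,\psi,\psi')=\langle\phi',([\nabla_\psi,\nabla_{\psi'}]-\nabla_{[\psi,\psi']})\phi\rangle$, $$R(\phi',\phi,\psi,\psi')=\tfrac12\{R^{(0)}(\phi',\phi,\psi,\psi')+R^{(0)}(\psi',\psi,\phi,\phi')+\textstyle\sum_\lambda\langle\nabla_{\psi_\lambda}\psi,\psi'\rangle\langle\nabla_{\psi^\lambda}\phi,\phi'\rangle\},\quad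 \mathrm{Ric}(\psi,\psi')=\sum_\lambda R(\psi^\lambda,\psi',\psi_\lambda,\psi),$$ where $(\psi_\lambda)$ is any local frame and $(\psi^\lambda)$ the dual frame, $\langle\psi_\lambda,\psi^\kappa\rangle=\delta_\lambda^\kappa$. A generalized Riemannian metric is a positive definite fibre metric $\mathbf G(\psi,\psi')=\langle\psi,\tau\psi'\rangle$ with $\tau$ an orthogonal symmetric involution; $V_\pm=\ker(\tau\mp1)$. The connection $\nabla$ is Levi-Civita with respect to $\mathbf G$ if $\nabla\mathbf G=0$ and the torsion $\langle\nabla_\psi\psi'-\nabla_{\psi'}\psi-[\psi,\psi'],\psi''\rangle+\langle\nabla_{\psi''}\psi,\psi'\rangle$ vanishes; it is Ricci compatible with $\mathbf G$ if $\mathrm{Ric}(V_+,V_-)=0$; and $\mathcal R_{\mathbf G}$ is the trace of $\mathrm{Ric}$ with respect to $\mathbf G$. Let $\mathbf G$ be a generalized Riemannian metric on $E$ whose involution $\tau$ satisfies $\tau[\Re(x),\cdot]_E=[\Re(x),\tau(\cdot)]_E$ for all $x\in\mathfrak g$ and $\tau(K^\perp)\subseteq K^\perp$, and which induces the generalized Riemannian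 metric $\mathbf G'$ on $E'$, i.e. $\tau\circ\iota=\iota\circ\tau'$ for the involution $\tau'$ of $\mathbf G'$. Let $\nabla$ be a Levi-Civita connection on $E$ with respect to $\mathbf G$ which is relevant for reduction and induces the Levi-Civita connection $\nabla'$ on $E'$ with respect to $\mathbf G'$. This means that for all $\psi=(X,\Psi,\xi)\in\Gamma(E')$, $\psi'\in\Gamma(E')$ and $\Phi,\Phi'\in\Gamma(\mathfrak g_P)$, $$\nabla_{(\psi,\Phi)}(\psi',\Phi')=\big(\nabla'_\psi\psi',\ D_X\Phi'-[\Psi,\Phi']_{\mathfrak g}-\tfrac23[\Phi,\Phi']_{\mathfrak g}\big).$$ Then the following holds. $\nabla$ is Ricci compatible with $\mathbf G$ if and only if $\nabla'$ is Ricci compatible with $\mathbf G'$. Moreover, for all $\psi,\psi'\in\Gamma(E')$ and $\Phi,\Phi'\in\Gamma(\mathfrak g_P)$, $$\mathrm{Ric}((\psi,0),(\psi',0))=\mathrm{Ric}'(\psi,\psi')\circ\pi,\quad \mathrm{Ric}((0,\Phi),(0,\Phi'))=-\tfrac16\langle\Phi,\Phi'\rangle_{\mathfrak g},\quad \mathrm{Ric}((\psi,0),(0,\Phi))=\mathrm{Ric}((0,\Phi),(\psi,0))=0,$$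 and $\mathcal R_{\mathbf G}=\mathcal R'_{\mathbf G'}\circ\pi+\tfrac16\dim\mathfrak g$. -/

import Mathlib

open scoped Manifold ContDiff Topology

noncomputable section

namespace CourantReduction

/-! ### Brackets, connections and curvature on modules of sections

The data of a (pre-)Courant algebroid `E → X` at the level of sections: `S` is the space of all
(set-theoretic) sections, with the predicate singling out the smooth ones.  Two concrete instances
are built below, and the notions of this part are only used for these.  Operators on `S` are only
constrained on smooth sections. -/

/-- Section-level data of a vector bundle with fibrewise pairing, anchor and bracket. -/
structure BracketData (X S : Type*) where
  /-- the rank of the vector bundle -/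
  rank : ℕ
  /-- smooth functions on the base -/
  SmoothFun : (X → ℝ) → Prop
  /-- smooth sections -/
  Smooth : S → Prop
  /-- multiplication of a section by a function -/
  fsmul : (X → ℝ) → S → S
  /-- the fibrewise pairing -/
  pairing : S → S → X → ℝ
  /-- the derivative of a function along the anchor of a section -/
  anchor : S → (X → ℝ) → X → ℝ
  /-- the bracket of sections -/
  bracket : S → S → S

section Abstract

variable {X S : Type*} [AddCommGroup S] (𝒞 : BracketData X S)

/-- Courant algebroid connections. -/
structure IsConnection (nab : S → S → S) : Prop where
  smooth : ∀ ψ ψ', 𝒞.Smooth ψ → 𝒞.Smooth ψ' → 𝒞.Smooth (nab ψ ψ')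
  add_left : ∀ ψ₁ ψ₂ ψ', 𝒞.Smooth ψ₁ → 𝒞.Smooth ψ₂ → 𝒞.Smooth ψ' →
    nab (ψ₁ + ψ₂) ψ' = nab ψ₁ ψ' + nab ψ₂ ψ'
  add_right : ∀ ψ ψ₁ ψ₂, 𝒞.Smooth ψ → 𝒞.Smooth ψ₁ → 𝒞.Smooth ψ₂ →
    nab ψ (ψ₁ + ψ₂) = nab ψ ψ₁ + nab ψ ψ₂
  fsmul_left : ∀ f ψ ψ', 𝒞.SmoothFun f → 𝒞.Smooth ψ → 𝒞.Smooth ψ' →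
    nab (𝒞.fsmul f ψ) ψ' = 𝒞.fsmul f (nab ψ ψ')
  leibniz : ∀ f ψ ψ', 𝒞.SmoothFun f → 𝒞.Smooth ψ → 𝒞.Smooth ψ' →
    nab ψ (𝒞.fsmul f ψ') = 𝒞.fsmul f (nab ψ ψ') + 𝒞.fsmul (𝒞.anchor ψ f) ψ'
  metric : ∀ ψ ψ' ψ'', 𝒞.Smooth ψ → 𝒞.Smooth ψ' → 𝒞.Smooth ψ'' →
    𝒞.anchor ψ (𝒞.pairing ψ' ψ'') = 𝒞.pairing (nab ψ ψ') ψ'' + 𝒞.pairing ψ' (nab ψ ψ'')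

/-- The torsion 3-form of a connection. -/
def torsion (nab : S → S → S) (ψ ψ' ψ'' : S) : X → ℝ :=
  𝒞.pairing (nab ψ ψ' - nab ψ' ψ - 𝒞.bracket ψ ψ') ψ'' + 𝒞.pairing (nab ψ'' ψ) ψ'

/-- The generalized Riemannian metric `G` is encoded by the involution `τ`:
`G(ψ, ψ') = ⟨ψ, τ ψ'⟩`. -/
def genMetric (τ : S → S) (ψ ψ' : S) : X → ℝ := 𝒞.pairing ψ (τ ψ')

/-- `τ` is the involution of a generalized Riemannian metric: a smooth bundle endomorphism which is
an orthogonal and symmetric involution such that `G(ψ, ψ') = ⟨ψ, τ ψ'⟩` is positive definite.  As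
the pairing is nondegenerate, `ψ` is nonzero at `x` iff it pairs nontrivially at `x` with some
section. -/
structure IsGeneralizedMetric (τ : S → S) : Prop where
  smooth : ∀ ψ, 𝒞.Smooth ψ → 𝒞.Smooth (τ ψ)
  add : ∀ ψ ψ', 𝒞.Smooth ψ → 𝒞.Smooth ψ' → τ (ψ + ψ') = τ ψ + τ ψ'
  fsmul : ∀ f ψ, 𝒞.SmoothFun f → 𝒞.Smooth ψ → τ (𝒞.fsmul f ψ) = 𝒞.fsmul f (τ ψ)
  involutive : ∀ ψ, 𝒞.Smooth ψ → τ (τ ψ) = ψ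
  orthogonal : ∀ ψ ψ', 𝒞.Smooth ψ → 𝒞.Smooth ψ' →
    𝒞.pairing (τ ψ) (τ ψ') = 𝒞.pairing ψ ψ'
  symm : ∀ ψ ψ', 𝒞.Smooth ψ → 𝒞.Smooth ψ' → genMetric 𝒞 τ ψ ψ' = genMetric 𝒞 τ ψ' ψ
  pos : ∀ ψ x, 𝒞.Smooth ψ → (∃ χ, 𝒞.Smooth χ ∧ 𝒞.pairing ψ χ x ≠ 0) →
    0 < genMetric 𝒞 τ ψ ψ x

/-- Levi-Civita connections with respect to a generalized metric. -/
structure IsLeviCivita (τ : S → S) (nab : S → S → S) : Prop where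
  isConnection : IsConnection 𝒞 nab
  genMetric : ∀ ψ ψ' ψ'', 𝒞.Smooth ψ → 𝒞.Smooth ψ' → 𝒞.Smooth ψ'' →
    𝒞.anchor ψ (genMetric 𝒞 τ ψ' ψ'') =
      genMetric 𝒞 τ (nab ψ ψ') ψ'' + genMetric 𝒞 τ ψ' (nab ψ ψ'')
  torsionFree : ∀ ψ ψ' ψ'', 𝒞.Smooth ψ → 𝒞.Smooth ψ' → 𝒞.Smooth ψ'' →
    torsion 𝒞 nab ψ ψ' ψ'' = 0

/-- The naive curvature `⟨φ', ([∇_ψ, ∇_ψ'] - ∇_[ψ, ψ']) φ⟩`. -/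
def naiveCurvature (nab : S → S → S) (φ' φ ψ ψ' : S) : X → ℝ :=
  𝒞.pairing φ' (nab ψ (nab ψ' φ) - nab ψ' (nab ψ φ) - nab (𝒞.bracket ψ ψ') φ)

variable [TopologicalSpace X]

/-- A local frame of the bundle near `x`, together with its dual frame with respect to the pairing:
`⟨ψ_i, ψ^j⟩ = δ_i^j` near `x`, the number of sections being the rank.  The members of the frame are
global sections; every local frame agrees with such a family near `x`. -/
def IsLocalFrame (x : X) (q : (Fin 𝒞.rank → S) × (Fin 𝒞.rank → S)) : Prop :=
  (∀ i, 𝒞.Smooth (q.1 i)) ∧ (∀ i, 𝒞.Smooth (q.2 i)) ∧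
    ∀ᶠ y in 𝓝 x, ∀ i j, 𝒞.pairing (q.1 i) (q.2 j) y = if i = j then 1 else 0

/-- An arbitrary local frame near `x` and its dual frame. -/
def localFrame (x : X) : (Fin 𝒞.rank → S) × (Fin 𝒞.rank → S) :=
  Classical.epsilon (IsLocalFrame 𝒞 x)

/-- The Riemann tensor of a connection. -/
def riemann (nab : S → S → S) (φ' φ ψ ψ' : S) (x : X) : ℝ :=
  (1 / 2) * (naiveCurvature 𝒞 nab φ' φ ψ ψ' x + naiveCurvature 𝒞 nab ψ' ψ φ φ' x +
    ∑ i, 𝒞.pairing (nab ((localFrame 𝒞 x).1 i) ψ) ψ' x *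
      𝒞.pairing (nab ((localFrame 𝒞 x).2 i) φ) φ' x)

/-- The Ricci tensor of a connection. -/
def ricci (nab : S → S → S) (ψ ψ' : S) (x : X) : ℝ :=
  ∑ i, riemann 𝒞 nab ((localFrame 𝒞 x).2 i) ψ' ((localFrame 𝒞 x).1 i) ψ x

/-- The Ricci scalar `Ric(G⁻¹(ψ^i), ψ_i)` with respect to a generalized metric; if `e^i` is the frame
dual to `e_i` for the pairing, then `G⁻¹(ψ^i) = τ(e^i)`. -/
def ricciScalar (τ : S → S) (nab : S → S → S) (x : X) : ℝ :=
  ∑ i, ricci 𝒞 nab (τ ((localFrame 𝒞 x).2 i)) ((localFrame 𝒞 x).1 i) x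

/-- Ricci compatibility `Ric(V₊, V₋) = 0`, where `V₊` and `V₋` are the eigenbundles of `τ`. -/
def RicciCompatible (τ : S → S) (nab : S → S → S) : Prop :=
  ∀ ψ ψ', 𝒞.Smooth ψ → 𝒞.Smooth ψ' → τ ψ = ψ → τ ψ' = -ψ' → ∀ x, ricci 𝒞 nab ψ ψ' x = 0

end Abstract

/-! ### Vector fields and forms on a manifold -/

section Manifold

variable {E : Type*} [NormedAddCommGroup E] [NormedSpace ℝ E]
  {N : Type*} [TopologicalSpace N] [ChartedSpace E N]

/-- Smoothness of a vector field. -/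
def SmoothVF [IsManifold 𝓘(ℝ, E) ∞ N] (X : Π p : N, TangentSpace 𝓘(ℝ, E) p) : Prop :=
  ContMDiff 𝓘(ℝ, E) 𝓘(ℝ, E).tangent ∞ (fun p => (⟨p, X p⟩ : TangentBundle 𝓘(ℝ, E) N))

/-- Smoothness of a vector valued 1-form, tested on smooth vector fields. -/
def SmoothForm [IsManifold 𝓘(ℝ, E) ∞ N] {V : Type*} [NormedAddCommGroup V] [NormedSpace ℝ V]
    (η : Π p : N, TangentSpace 𝓘(ℝ, E) p →L[ℝ] V) : Prop :=
  ∀ X : Π p : N, TangentSpace 𝓘(ℝ, E) p, SmoothVF X →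
    ContMDiff 𝓘(ℝ, E) 𝓘(ℝ, V) ∞ (fun p => η p (X p))

/-- The differential of a vector valued function, as a 1-form. -/
def diff {V : Type*} [NormedAddCommGroup V] [NormedSpace ℝ V] (f : N → V) (p : N) :
    TangentSpace 𝓘(ℝ, E) p →L[ℝ] V :=
  mfderiv 𝓘(ℝ, E) 𝓘(ℝ, V) f p

/-- The exterior derivative `dη(u, v) = D_u η(v) - D_v η(u)` of a vector valued 1-form at `p`,
computed in the coordinate frame of the preferred chart at `p` (at `p` itself this frame is the
standard basis of `TangentSpace 𝓘(ℝ, E) p`). -/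
def extDerivOne [IsManifold 𝓘(ℝ, E) ∞ N] {V : Type*} [NormedAddCommGroup V] [NormedSpace ℝ V]
    (η : Π p : N, TangentSpace 𝓘(ℝ, E) p →L[ℝ] V) (p : N) :
    TangentSpace 𝓘(ℝ, E) p →L[ℝ] TangentSpace 𝓘(ℝ, E) p →L[ℝ] V :=
  let B : E →L[ℝ] E →L[ℝ] V := mfderiv 𝓘(ℝ, E) 𝓘(ℝ, E →L[ℝ] V)
    (fun q => (η q).comp
      ((trivializationAt E (TangentSpace 𝓘(ℝ, E) : N → Type _) p).symmL ℝ q)) p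
  B - B.flip

/-- The Lie derivative `L_X η = i_X dη + d(η(X))` of a 1-form. -/
def lieDerivOne [IsManifold 𝓘(ℝ, E) ∞ N] (X : Π p : N, TangentSpace 𝓘(ℝ, E) p)
    (η : Π p : N, TangentSpace 𝓘(ℝ, E) p →L[ℝ] ℝ) (p : N) : TangentSpace 𝓘(ℝ, E) p →L[ℝ] ℝ :=
  extDerivOne η p (X p) + diff (fun q => η q (X q)) p

/-- Smooth 3-forms on a manifold. -/
structure ThreeForm (E : Type*) [NormedAddCommGroup E] [NormedSpace ℝ E]
    (N : Type*) [TopologicalSpace N] [ChartedSpace E N] [IsManifold 𝓘(ℝ, E) ∞ N] where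
  /-- the value at a point -/
  val : Π p : N, TangentSpace 𝓘(ℝ, E) p →L[ℝ] TangentSpace 𝓘(ℝ, E) p →L[ℝ]
    TangentSpace 𝓘(ℝ, E) p →L[ℝ] ℝ
  alt_left : ∀ p u v, val p u u v = 0
  alt_right : ∀ p u v, val p u v v = 0
  smooth : ∀ X Y Z : Π p : N, TangentSpace 𝓘(ℝ, E) p, SmoothVF X → SmoothVF Y → SmoothVF Z →
    ContMDiff 𝓘(ℝ, E) 𝓘(ℝ, ℝ) ∞ (fun p => val p (X p) (Y p) (Z p))

/-- Sections of the generalized tangent bundle `TN ⊕ T*N`. -/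
abbrev GenSec (E : Type*) [NormedAddCommGroup E] [NormedSpace ℝ E]
    (N : Type*) [TopologicalSpace N] [ChartedSpace E N] : Type _ :=
  (Π p : N, TangentSpace 𝓘(ℝ, E) p) × (Π p : N, TangentSpace 𝓘(ℝ, E) p →L[ℝ] ℝ)

/-- The generalized tangent bundle `TN ⊕ T*N` with the canonical pairing and the `H`-twisted Dorfman
bracket `([X, Y], L_X η - i_Y dξ - H(X, Y, ·))`, where the 3-form `H` is given through the covectors
`H(u, v, ·)`. -/
def dorfman [IsManifold 𝓘(ℝ, E) ∞ N]
    (H : Π p : N, TangentSpace 𝓘(ℝ, E) p → TangentSpace 𝓘(ℝ, E) p →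
      TangentSpace 𝓘(ℝ, E) p →L[ℝ] ℝ) :
    BracketData N (GenSec E N) where
  rank := 2 * Module.finrank ℝ E
  SmoothFun f := ContMDiff 𝓘(ℝ, E) 𝓘(ℝ, ℝ) ∞ f
  Smooth ψ := SmoothVF ψ.1 ∧ SmoothForm ψ.2
  fsmul f ψ := (fun p => f p • ψ.1 p, fun p => f p • ψ.2 p)
  pairing ψ ψ' := fun p => ψ'.2 p (ψ.1 p) + ψ.2 p (ψ'.1 p)
  anchor ψ f := fun p => diff f p (ψ.1 p)
  bracket ψ ψ' := (VectorField.mlieBracket 𝓘(ℝ, E) ψ.1 ψ'.1,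
    fun p => lieDerivOne ψ.1 ψ'.2 p - extDerivOne ψ.2 p (ψ'.1 p) - H p (ψ.1 p) (ψ'.1 p))

end Manifold

/-! ### The Lie algebra of the structure group

The Lie algebra `T_1 G` has the model space `EG` as underlying vector space; its elements are
written as elements of `EG`, which carries a norm. -/

section LieAlg

variable {EG : Type*} [NormedAddCommGroup EG] [NormedSpace ℝ EG]
  (G : Type*) [TopologicalSpace G] [ChartedSpace EG G] [Group G]

instance instLieGroupMinSmoothness [LieGroup 𝓘(ℝ, EG) ∞ G] :
    LieGroup 𝓘(ℝ, EG) (minSmoothness ℝ 3) G :=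
  LieGroup.of_le (n := ∞) (by
    rw [minSmoothness_of_isRCLikeNormedField]
    exact WithTop.coe_le_coe.2 (le_top : (3 : ℕ∞) ≤ ⊤))

/-- The adjoint action of a Lie group on its Lie algebra. -/
def Ad {G : Type*} [TopologicalSpace G] [ChartedSpace EG G] [Group G] (g : G) (x : EG) : EG :=
  mfderiv 𝓘(ℝ, EG) 𝓘(ℝ, EG) (fun h : G => g * h * g⁻¹) 1 x

variable [LieGroup 𝓘(ℝ, EG) ∞ G] [FiniteDimensional ℝ EG] [CompleteSpace EG]

/-- `ad x = [x, ·]` on the Lie algebra of `G`. -/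
def adj (x : EG) : EG →L[ℝ] EG :=
  LinearMap.toContinuousLinearMap
    (LieAlgebra.ad ℝ (GroupLieAlgebra 𝓘(ℝ, EG) G) x : EG →ₗ[ℝ] EG)

/-- The Killing form `c` of the Lie algebra of `G`. -/
def killing (x : EG) : EG →L[ℝ] ℝ :=
  LinearMap.toContinuousLinearMap
    (killingForm ℝ (GroupLieAlgebra 𝓘(ℝ, EG) G) x : EG →ₗ[ℝ] ℝ)

end LieAlg

/-! ### Principal bundles and their connections -/

/-- A smooth principal `G`-bundle `π : P → M` with right action of `G` on `P`. -/
structure PrincipalBundle (EM EG EP : Type*)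
    [NormedAddCommGroup EM] [NormedSpace ℝ EM] [NormedAddCommGroup EG] [NormedSpace ℝ EG]
    [NormedAddCommGroup EP] [NormedSpace ℝ EP]
    (M G P : Type*) [TopologicalSpace M] [ChartedSpace EM M]
    [TopologicalSpace G] [ChartedSpace EG G] [Group G]
    [TopologicalSpace P] [ChartedSpace EP P] where
  /-- the projection -/
  proj : P → M
  /-- the right action -/
  act : P → G → P
  smooth_proj : ContMDiff 𝓘(ℝ, EP) 𝓘(ℝ, EM) ∞ proj
  smooth_act : ContMDiff (𝓘(ℝ, EP).prod 𝓘(ℝ, EG)) 𝓘(ℝ, EP) ∞ (fun q : P × G => act q.1 q.2)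
  act_one : ∀ p, act p 1 = p
  act_mul : ∀ p g h, act p (g * h) = act (act p g) h
  proj_act : ∀ p g, proj (act p g) = proj p
  /-- local triviality: `π⁻¹(U) ≅ U × G`, equivariantly and over `U` -/
  locallyTrivial : ∀ m : M, ∃ (U : Set M) (e : OpenPartialHomeomorph P (M × G)),
    IsOpen U ∧ m ∈ U ∧ e.source = proj ⁻¹' U ∧ e.target = U ×ˢ Set.univ ∧
    ContMDiffOn 𝓘(ℝ, EP) (𝓘(ℝ, EM).prod 𝓘(ℝ, EG)) ∞ e e.source ∧
    ContMDiffOn (𝓘(ℝ, EM).prod 𝓘(ℝ, EG)) 𝓘(ℝ, EP) ∞ e.symm e.target ∧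
    ∀ p ∈ e.source, (e p).1 = proj p ∧ ∀ g, e (act p g) = ((e p).1, (e p).2 * g)

section Principal

variable {EM EG EP : Type*}
  [NormedAddCommGroup EM] [NormedSpace ℝ EM] [NormedAddCommGroup EG] [NormedSpace ℝ EG]
  [NormedAddCommGroup EP] [NormedSpace ℝ EP]
  {M G P : Type*} [TopologicalSpace M] [ChartedSpace EM M]
  [TopologicalSpace G] [ChartedSpace EG G] [Group G]
  [TopologicalSpace P] [ChartedSpace EP P]

/-- The infinitesimal action `#x` of the Lie algebra on `P`:
the velocity at `1` of `g ↦ p · g` in the direction `x`. -/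
def PrincipalBundle.sharp (𝓟 : PrincipalBundle EM EG EP M G P) (x : EG) (p : P) :
    TangentSpace 𝓘(ℝ, EP) p :=
  (mfderiv 𝓘(ℝ, EG) 𝓘(ℝ, EP) (fun g : G => 𝓟.act p g) 1 : EG →L[ℝ] EP) x

/-- The differential of the projection. -/
def PrincipalBundle.dproj (𝓟 : PrincipalBundle EM EG EP M G P) (p : P) :
    TangentSpace 𝓘(ℝ, EP) p →L[ℝ] TangentSpace 𝓘(ℝ, EM) (𝓟.proj p) :=
  mfderiv 𝓘(ℝ, EP) 𝓘(ℝ, EM) 𝓟.proj p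

/-- `Φ` is a smooth section of the adjoint bundle `𝔤_P`, i.e. a smooth function `P → 𝔤` with
`Φ(p · g) = Ad_{g⁻¹} Φ(p)`. -/
def PrincipalBundle.AdSection (𝓟 : PrincipalBundle EM EG EP M G P) (Φ : P → EG) : Prop :=
  ContMDiff 𝓘(ℝ, EP) 𝓘(ℝ, EG) ∞ Φ ∧ ∀ p g, Φ (𝓟.act p g) = Ad g⁻¹ (Φ p)

/-- A function on `P` which is constant on the fibres, viewed as a function on `M`. -/
def PrincipalBundle.descend (𝓟 : PrincipalBundle EM EG EP M G P) {V : Type*} [Zero V]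
    (f : P → V) : M → V :=
  Function.extend 𝓟.proj f 0

/-- Principal bundle connections `A ∈ Ω¹(P, 𝔤)`. -/
structure PrincipalConnection [IsManifold 𝓘(ℝ, EP) ∞ P]
    (𝓟 : PrincipalBundle EM EG EP M G P) where
  /-- the connection form -/
  form : Π p : P, TangentSpace 𝓘(ℝ, EP) p →L[ℝ] EG
  smooth : SmoothForm form
  form_sharp : ∀ x p, form p (𝓟.sharp x p) = x
  equivariant : ∀ p g (v : TangentSpace 𝓘(ℝ, EP) p),
    form (𝓟.act p g) (mfderiv 𝓘(ℝ, EP) 𝓘(ℝ, EP) (fun q => 𝓟.act q g) p v) = Ad g⁻¹ (form p v)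

namespace PrincipalConnection

variable [IsManifold 𝓘(ℝ, EP) ∞ P] {𝓟 : PrincipalBundle EM EG EP M G P}
  (A : PrincipalConnection 𝓟)

/-- The horizontal lift `T_{π(p)} M → T_p P`: the inverse of the isomorphism
`v ↦ (dπ(v), A(v))`, restricted to `T_{π(p)} M × 0`. -/
def hlift (p : P) : TangentSpace 𝓘(ℝ, EM) (𝓟.proj p) →L[ℝ] TangentSpace 𝓘(ℝ, EP) p :=
  (ContinuousLinearMap.inverse ((𝓟.dproj p).prod (A.form p))).comp
    (ContinuousLinearMap.inl ℝ (TangentSpace 𝓘(ℝ, EM) (𝓟.proj p)) EG)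

/-- The covariant differential of a section of `𝔤_P`: at `p` over `m` this is the map
`v ↦ (D_v Φ)(p) = (v^h Φ)(p)` on `T_m M`. -/
def covD (Φ : P → EG) (p : P) : TangentSpace 𝓘(ℝ, EM) (𝓟.proj p) →L[ℝ] EG :=
  (diff Φ p).comp (A.hlift p)

variable [LieGroup 𝓘(ℝ, EG) ∞ G] [FiniteDimensional ℝ EG] [CompleteSpace EG]

/-- The curvature form `Ω = dA + ½ [A ∧ A]`, i.e. `Ω(u, v) = dA(u, v) + [A u, A v]`, through
`Ω(u, ·)`. -/
def curvatureForm (p : P) (u : TangentSpace 𝓘(ℝ, EP) p) : TangentSpace 𝓘(ℝ, EP) p →L[ℝ] EG :=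
  extDerivOne A.form p u + (adj G (A.form p u)).comp (A.form p)

/-- The curvature `F ∈ Ω²(M, 𝔤_P)`, at `p` over `m`, through `F(u, ·)`. -/
def curvature (p : P) (u : TangentSpace 𝓘(ℝ, EM) (𝓟.proj p)) :
    TangentSpace 𝓘(ℝ, EM) (𝓟.proj p) →L[ℝ] EG :=
  (A.curvatureForm p (A.hlift p u)).comp (A.hlift p)

/-- The Chern-Simons 3-form `⟨dA ∧ A⟩ + ⅓ ⟨[A ∧ A] ∧ A⟩` of `A`, through the covectors
`w ↦ ⟨dA(u,v), A w⟩ + ⟨dA(v,w), A u⟩ + ⟨dA(w,u), A v⟩ + 2 ⟨[A u, A v], A w⟩`. -/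
def chernSimons (p : P) (u v : TangentSpace 𝓘(ℝ, EP) p) : TangentSpace 𝓘(ℝ, EP) p →L[ℝ] ℝ :=
  (killing G (extDerivOne A.form p u v)).comp (A.form p)
    + (killing G (A.form p u)).comp (extDerivOne A.form p v)
    - (killing G (A.form p v)).comp (extDerivOne A.form p u)
    + (2 : ℝ) • (killing G (adj G (A.form p u) (A.form p v))).comp (A.form p)

variable [IsManifold 𝓘(ℝ, EM) ∞ M]

/-- The twisting 3-form `H = π*(H₀) + ½ CS₃(A)` on `P`. -/
def twist (H₀ : ThreeForm EM M) (p : P) (u v : TangentSpace 𝓘(ℝ, EP) p) :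
    TangentSpace 𝓘(ℝ, EP) p →L[ℝ] ℝ :=
  (H₀.val (𝓟.proj p) (𝓟.dproj p u) (𝓟.dproj p v)).comp (𝓟.dproj p)
    + (1 / 2 : ℝ) • A.chernSimons p u v

/-- The (pre-)Courant algebroid `TP ⊕ T*P`, with the `H`-twisted Dorfman bracket. -/
def total (H₀ : ThreeForm EM M) : BracketData P (GenSec EP P) :=
  dorfman (A.twist H₀)

end PrincipalConnection

/-- Sections of `E' = TM ⊕ 𝔤_P ⊕ T*M`; a section of `𝔤_P` is viewed as a function `P → 𝔤`. -/
abbrev RedSec (EM EG : Type*) [NormedAddCommGroup EM] [NormedSpace ℝ EM] [NormedAddCommGroup EG]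
    [NormedSpace ℝ EG] (M P : Type*) [TopologicalSpace M] [ChartedSpace EM M] : Type _ :=
  (Π m : M, TangentSpace 𝓘(ℝ, EM) m) × (P → EG) × (Π m : M, TangentSpace 𝓘(ℝ, EM) m →L[ℝ] ℝ)

namespace PrincipalConnection

variable [IsManifold 𝓘(ℝ, EP) ∞ P] [IsManifold 𝓘(ℝ, EM) ∞ M]
  {𝓟 : PrincipalBundle EM EG EP M G P} (A : PrincipalConnection 𝓟)
  [LieGroup 𝓘(ℝ, EG) ∞ G] [FiniteDimensional ℝ EG] [CompleteSpace EG]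

/-- The 1-form `F(X, ·)Φ' - F(Y, ·)Φ + (DΦ)Φ'` on `M`, contracted by the Killing form. -/
def mixedForm (X Y : Π m : M, TangentSpace 𝓘(ℝ, EM) m) (Φ Φ' : P → EG) (m : M) :
    TangentSpace 𝓘(ℝ, EM) m →L[ℝ] ℝ :=
  𝓟.descend (V := EM →L[ℝ] ℝ) (fun p =>
    (killing G (Φ' p)).comp (A.curvature p (X (𝓟.proj p)))
      - (killing G (Φ p)).comp (A.curvature p (Y (𝓟.proj p)))
      + (killing G (Φ' p)).comp (A.covD Φ p)) m

/-- The reduced (pre-)Courant algebroid `E' = TM ⊕ 𝔤_P ⊕ T*M` over `M`. -/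
def reduced (H₀ : ThreeForm EM M) : BracketData M (RedSec EM EG M P) where
  rank := 2 * Module.finrank ℝ EM + Module.finrank ℝ EG
  SmoothFun f := ContMDiff 𝓘(ℝ, EM) 𝓘(ℝ, ℝ) ∞ f
  Smooth ψ := SmoothVF ψ.1 ∧ 𝓟.AdSection ψ.2.1 ∧ SmoothForm ψ.2.2
  fsmul f ψ := (fun m => f m • ψ.1 m, fun p => f (𝓟.proj p) • ψ.2.1 p, fun m => f m • ψ.2.2 m)
  pairing ψ ψ' := fun m => ψ'.2.2 m (ψ.1 m) + ψ.2.2 m (ψ'.1 m)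
    + 𝓟.descend (fun p => killing G (ψ.2.1 p) (ψ'.2.1 p)) m
  anchor ψ f := fun m => diff f m (ψ.1 m)
  bracket ψ ψ' :=
    (VectorField.mlieBracket 𝓘(ℝ, EM) ψ.1 ψ'.1,
      fun p => A.covD ψ'.2.1 p (ψ.1 (𝓟.proj p)) - A.covD ψ.2.1 p (ψ'.1 (𝓟.proj p))
        - A.curvature p (ψ.1 (𝓟.proj p)) (ψ'.1 (𝓟.proj p)) - adj G (ψ.2.1 p) (ψ'.2.1 p),
      fun m => lieDerivOne ψ.1 ψ'.2.2 m - extDerivOne ψ.2.2 m (ψ'.1 m)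
        - H₀.val m (ψ.1 m) (ψ'.1 m) + A.mixedForm ψ.1 ψ'.1 ψ.2.1 ψ'.2.1 m)

/-- The embedding `Γ(E') → Γ_G(K^⊥) ⊆ Γ_G(TP ⊕ T*P)`,
`(X, Φ, ξ) ↦ (X^h + j(Φ), π*(ξ) + ½ ⟨A, Φ⟩)`. -/
def incl (ψ : RedSec EM EG M P) : GenSec EP P :=
  (fun p => A.hlift p (ψ.1 (𝓟.proj p)) + 𝓟.sharp (ψ.2.1 p) p,
    fun p => (ψ.2.2 (𝓟.proj p)).comp (𝓟.dproj p)
      + (1 / 2 : ℝ) • (killing G (ψ.2.1 p)).comp (A.form p))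

/-- The map `Φ ↦ (j(Φ), -½ ⟨A, Φ⟩)`.  On constant functions it is the map `𝔤 → Γ(TP ⊕ T*P)` lifting
the infinitesimal action, and on `Γ(𝔤_P)` it is the isomorphism onto `Γ_G(K)`. -/
def lift (Φ : P → EG) : GenSec EP P :=
  (fun p => 𝓟.sharp (Φ p) p, fun p => -((1 / 2 : ℝ) • (killing G (Φ p)).comp (A.form p)))

/-- Sections of the orthogonal complement `K^⊥`. -/
def MemPerp (H₀ : ThreeForm EM M) (ψ : GenSec EP P) : Prop :=
  (A.total H₀).Smooth ψ ∧ ∀ x : EG, (A.total H₀).pairing ψ (A.lift fun _ => x) = 0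

/-- The generalized metric on `TP ⊕ T*P` with involution `τ` is reducible (its involution is invariant
and preserves `K^⊥`) and the induced generalized metric on `E'` is the one with involution `τ'`. -/
structure MetricReduces (H₀ : ThreeForm EM M) (τ : GenSec EP P → GenSec EP P)
    (τ' : RedSec EM EG M P → RedSec EM EG M P) : Prop where
  invariant : ∀ (x : EG) (ψ : GenSec EP P), (A.total H₀).Smooth ψ →
    τ ((A.total H₀).bracket (A.lift fun _ => x) ψ) =
      (A.total H₀).bracket (A.lift fun _ => x) (τ ψ)
  perp : ∀ ψ, A.MemPerp H₀ ψ → A.MemPerp H₀ (τ ψ)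
  induces : ∀ ψ, (A.reduced H₀).Smooth ψ → τ (A.incl ψ) = A.incl (τ' ψ)

/-- `∇` is relevant for reduction and induces `∇'`: on the invariant sections
`Γ(E') ⊕ Γ(𝔤_P)` it is block diagonal,
`∇_{(ψ,Φ)} (ψ', Φ') = (∇'_ψ ψ', D_{ρ'(ψ)} Φ' - [p(ψ), Φ'] - ⅔ [Φ, Φ'])`. -/
def RelevantForReduction (H₀ : ThreeForm EM M) (nab : GenSec EP P → GenSec EP P → GenSec EP P)
    (nab' : RedSec EM EG M P → RedSec EM EG M P → RedSec EM EG M P) : Prop :=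
  ∀ (ψ ψ' : RedSec EM EG M P) (Φ Φ' : P → EG), (A.reduced H₀).Smooth ψ →
    (A.reduced H₀).Smooth ψ' → 𝓟.AdSection Φ → 𝓟.AdSection Φ' →
    nab (A.incl ψ + A.lift Φ) (A.incl ψ' + A.lift Φ') =
      A.incl (nab' ψ ψ') + A.lift (fun p => A.covD Φ' p (ψ.1 (𝓟.proj p))
        - adj G (ψ.2.1 p) (Φ' p) - (2 / 3 : ℝ) • adj G (Φ p) (Φ' p))

end PrincipalConnection

end Principal

end CourantReduction

end

/-!
The theorem is an algebraic computation once two analytic facts are available: that the curvature of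
a torsion free connection can be computed in any frame, and that the total space `P` has local frames
consisting of sections `ι(ψ)` and `ℜ(Φ)` on which the connection is known.

*Frames.*  `SectionCalculus` lists the properties of the module of sections that are needed to
manipulate tensors without mentioning fibres; it is verified for both algebroids
(`PrincipalConnection.total_calculus`, `PrincipalConnection.reduced_calculus`).  For a metric
connection without torsion the bracket can be expressed through the connection, so the Riemann tensor
is a tensor: the failure of the naive curvature to be tensorial in its third argument is cancelled by
the quadratic term (`IsTorsionFree.riemannIn_tensorial_three`).  Hence the Ricci tensor and the Ricci
scalar can be computed in any pair of dual frames (`IsTorsionFree.ricci_eq`,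
`IsTorsionFree.ricciScalar_eq`).  Existence of orthonormal frames of the adjoint bundle uses local
sections of `P` and the definiteness of the Killing form, `killing_self_neg`: `G` is compact, so an
average over Haar measure gives an inner product for which all `ad x` are skew.

*The blocks.*  In the decomposition of invariant sections into `ι(Γ(E'))` and `ℜ(Γ(𝔤_P))` the summands
are orthogonal and preserved by the connection.  The brackets of such sections follow from the
connection, since it is torsion free (`IsReduction.bracket_incl_incl` and the lemmas after it).  Only
the bracket of two sections of the second kind has components in both summands:
`[ℜΦ, ℜΦ'] = -ι(β(Φ, Φ')) - 2 ℜ[Φ, Φ']`, where `β(Φ, Φ')` is the bracket in `E'`.  The latter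
satisfies `⟨β(Φ, Φ'), ψ⟩ = ⟨ψ · Φ, Φ'⟩` for the action `ψ · Φ = D_X Φ - [Ψ, Φ]` of `ψ = (X, Ψ, ξ)` on
sections of the adjoint bundle.

*The Ricci tensor.*  On `ι(Γ(E'))` all contributions of the frame of `ℜ(Γ(𝔤_P))` vanish
(`IsReduction.ricci_incl`), and so do the mixed components because the action is by derivations of the
bracket (`IsReduction.naiveCurvature_lift_mixed`).  On `ℜ(Γ(𝔤_P))` a member `Φ_a` of an orthonormal
frame contributes a multiple of `Q_a = ⟨[Φ_a, Φ], [Φ', Φ_a]⟩`: each of the two naive curvatures gives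
`-1/9`, the quadratic term gives `-4/9` from the adjoint bundle and `⟨β, β⟩ = 1` from the reduced
bundle, in total `(-2/9 - 4/9 + 1) / 2 = 1/6`.  The sum of the `Q_a` is a trace and equals `-⟨Φ, Φ'⟩`
(`IsReduction.ricci_lift`).

*The generalized metric.*  The pairing is positive definite on the span of the `ℜ(Φ)`, hence `τ` is
the identity there (`MetricReduces.map_lift`).  This determines the Ricci scalar, and it shows that
the sections of `V₋` are orthogonal to the `ℜ(Φ)`, so that Ricci compatibility only concerns
`ι(Γ(E'))`.
-/

set_option linter.unusedSectionVars false

noncomputable section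

namespace CourantReduction

/-! ### Tensor calculus on modules of sections -/

section Calculus

variable {X S : Type*} [AddCommGroup S] [TopologicalSpace X]

/-- The properties of the module of sections of a pre-Courant algebroid on which the tensor calculus
of connections rests.  Smooth sections are compared through their pairings with smooth sections, so
that no reference to the fibres is needed. -/
structure SectionCalculus (𝒞 : BracketData X S) : Prop where
  fun_const : ∀ c : ℝ, 𝒞.SmoothFun fun _ => c
  fun_add : ∀ f g, 𝒞.SmoothFun f → 𝒞.SmoothFun g → 𝒞.SmoothFun (f + g)
  fun_mul : ∀ f g, 𝒞.SmoothFun f → 𝒞.SmoothFun g → 𝒞.SmoothFun (f * g)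
  smooth_zero : 𝒞.Smooth 0
  smooth_add : ∀ s t, 𝒞.Smooth s → 𝒞.Smooth t → 𝒞.Smooth (s + t)
  smooth_fsmul : ∀ f s, 𝒞.SmoothFun f → 𝒞.Smooth s → 𝒞.Smooth (𝒞.fsmul f s)
  pairing_add : ∀ s t χ, 𝒞.pairing (s + t) χ = 𝒞.pairing s χ + 𝒞.pairing t χ
  pairing_fsmul : ∀ f s χ, 𝒞.pairing (𝒞.fsmul f s) χ = f * 𝒞.pairing s χ
  pairing_comm : ∀ s t, 𝒞.pairing s t = 𝒞.pairing t s
  pairing_smooth : ∀ s t, 𝒞.Smooth s → 𝒞.Smooth t → 𝒞.SmoothFun (𝒞.pairing s t)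
  anchor_smooth : ∀ s f, 𝒞.Smooth s → 𝒞.SmoothFun f → 𝒞.SmoothFun (𝒞.anchor s f)
  anchor_bracket : ∀ s t f, 𝒞.Smooth s → 𝒞.Smooth t → 𝒞.SmoothFun f →
    𝒞.anchor (𝒞.bracket s t) f = 𝒞.anchor s (𝒞.anchor t f) - 𝒞.anchor t (𝒞.anchor s f)
  fsmul_const_neg : ∀ s, 𝒞.fsmul (fun _ => -1) s = -s
  ext : ∀ s t, 𝒞.Smooth s → 𝒞.Smooth t →
    (∀ χ, 𝒞.Smooth χ → 𝒞.pairing s χ = 𝒞.pairing t χ) → s = t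
  smooth_bracket : ∀ s t, 𝒞.Smooth s → 𝒞.Smooth t →
    (∀ χ, 𝒞.Smooth χ → 𝒞.SmoothFun (𝒞.pairing (𝒞.bracket s t) χ)) → 𝒞.Smooth (𝒞.bracket s t)
  bump : ∀ x, ∀ U ∈ 𝓝 x, ∃ f, 𝒞.SmoothFun f ∧ f x = 1 ∧ ∀ y ∉ U, f y = 0

/-- A pair of families of smooth sections which are dual frames near `x`, expressed by the
resolution of the identity `⟨s, χ⟩ = ∑ ⟨s, ε i⟩ ⟨e i, χ⟩`. -/
structure IsDualFrame (𝒞 : BracketData X S) {ι : Type*} [Fintype ι] (x : X) (e ε : ι → S) :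
    Prop where
  smooth_left : ∀ i, 𝒞.Smooth (e i)
  smooth_right : ∀ i, 𝒞.Smooth (ε i)
  complete : ∀ᶠ y in 𝓝 x, ∀ s χ, 𝒞.Smooth s → 𝒞.Smooth χ →
    𝒞.pairing s χ y = ∑ i, 𝒞.pairing s (ε i) y * 𝒞.pairing (e i) χ y

/-- Linearity over the smooth functions of a functional on smooth sections; functions act on its
values through evaluation at `x`. -/
structure IsTensorialAt (𝒞 : BracketData X S) (x : X) (T : S → ℝ) : Prop where
  add : ∀ s t, 𝒞.Smooth s → 𝒞.Smooth t → T (s + t) = T s + T t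
  fsmul : ∀ f s, 𝒞.SmoothFun f → 𝒞.Smooth s → T (𝒞.fsmul f s) = f x * T s

variable {𝒞 : BracketData X S}

namespace SectionCalculus

variable (c : SectionCalculus 𝒞)
include c

lemma pairing_add_right (s t χ : S) : 𝒞.pairing χ (s + t) = 𝒞.pairing χ s + 𝒞.pairing χ t := by
  rw [c.pairing_comm, c.pairing_add, c.pairing_comm s, c.pairing_comm t]

lemma pairing_fsmul_right (f : X → ℝ) (s χ : S) :
    𝒞.pairing χ (𝒞.fsmul f s) = f * 𝒞.pairing χ s := by
  rw [c.pairing_comm, c.pairing_fsmul, c.pairing_comm s]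

lemma pairing_zero (χ : S) : 𝒞.pairing 0 χ = 0 := by
  have h := c.pairing_add 0 0 χ
  rw [add_zero] at h
  simpa using h

lemma pairing_neg (s χ : S) : 𝒞.pairing (-s) χ = -𝒞.pairing s χ := by
  have h := c.pairing_add s (-s) χ
  rw [add_neg_cancel, c.pairing_zero] at h
  exact (neg_eq_of_add_eq_zero_right h.symm).symm

lemma pairing_sub (s t χ : S) : 𝒞.pairing (s - t) χ = 𝒞.pairing s χ - 𝒞.pairing t χ := by
  rw [sub_eq_add_neg, c.pairing_add, c.pairing_neg, sub_eq_add_neg]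

lemma pairing_neg_right (s χ : S) : 𝒞.pairing χ (-s) = -𝒞.pairing χ s := by
  rw [c.pairing_comm, c.pairing_neg, c.pairing_comm]

lemma pairing_sum {ι : Type*} (u : Finset ι) (s : ι → S) (χ : S) :
    𝒞.pairing (∑ i ∈ u, s i) χ = ∑ i ∈ u, 𝒞.pairing (s i) χ := by
  classical
  induction u using Finset.induction_on with
  | empty => simp [c.pairing_zero]
  | insert a u ha ih => rw [Finset.sum_insert ha, Finset.sum_insert ha, c.pairing_add, ih]

lemma smooth_sum {ι : Type*} (u : Finset ι) (s : ι → S) (h : ∀ i, 𝒞.Smooth (s i)) :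
    𝒞.Smooth (∑ i ∈ u, s i) := by
  classical
  induction u using Finset.induction_on with
  | empty => simpa using c.smooth_zero
  | insert a u ha ih => rw [Finset.sum_insert ha]; exact c.smooth_add _ _ (h a) ih

lemma smooth_neg (s : S) (h : 𝒞.Smooth s) : 𝒞.Smooth (-s) := by
  rw [← c.fsmul_const_neg]
  exact c.smooth_fsmul _ _ (c.fun_const _) h

lemma fun_sub (f g : X → ℝ) (hf : 𝒞.SmoothFun f) (hg : 𝒞.SmoothFun g) : 𝒞.SmoothFun (f - g) := by
  have : f - g = f + (fun _ => -1) * g := by ext y; simp [sub_eq_add_neg]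
  rw [this]
  exact c.fun_add _ _ hf (c.fun_mul _ _ (c.fun_const _) hg)

end SectionCalculus

namespace IsDualFrame

lemma symm (c : SectionCalculus 𝒞) {ι : Type*} [Fintype ι] {x : X} {e ε : ι → S}
    (h : IsDualFrame 𝒞 x e ε) : IsDualFrame 𝒞 x ε e where
  smooth_left := h.smooth_right
  smooth_right := h.smooth_left
  complete := by
    filter_upwards [h.complete] with y hy s χ hs hχ
    rw [c.pairing_comm, hy χ s hχ hs]
    refine Finset.sum_congr rfl fun i _ => ?_
    rw [c.pairing_comm χ, c.pairing_comm (e i), mul_comm]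

end IsDualFrame

namespace IsTensorialAt

variable {x : X} {T : S → ℝ}

lemma zero (c : SectionCalculus 𝒞) (hT : IsTensorialAt 𝒞 x T) : T 0 = 0 := by
  have h := hT.add 0 0 c.smooth_zero c.smooth_zero
  rw [add_zero] at h
  linarith

lemma sum (c : SectionCalculus 𝒞) (hT : IsTensorialAt 𝒞 x T) {ι : Type*} (u : Finset ι)
    (s : ι → S) (h : ∀ i, 𝒞.Smooth (s i)) : T (∑ i ∈ u, s i) = ∑ i ∈ u, T (s i) := by
  classical
  induction u using Finset.induction_on with
  | empty => simpa using hT.zero c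
  | insert a u ha ih =>
    rw [Finset.sum_insert ha, Finset.sum_insert ha, hT.add _ _ (h a) (c.smooth_sum _ _ h), ih]

/-- A tensorial functional is determined by its values on a local frame. -/
lemma expand (c : SectionCalculus 𝒞) (hT : IsTensorialAt 𝒞 x T) {ι : Type*} [Fintype ι]
    {e ε : ι → S} (h : IsDualFrame 𝒞 x e ε) {s : S} (hs : 𝒞.Smooth s) :
    T s = ∑ i, 𝒞.pairing s (ε i) x * T (e i) := by
  obtain ⟨f, hf, hfx, hf0⟩ := c.bump x _ h.complete
  have hp : ∀ i, 𝒞.SmoothFun (𝒞.pairing s (ε i)) :=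
    fun i => c.pairing_smooth _ _ hs (h.smooth_right i)
  have hsm : ∀ i, 𝒞.Smooth (𝒞.fsmul (𝒞.pairing s (ε i)) (e i)) :=
    fun i => c.smooth_fsmul _ _ (hp i) (h.smooth_left i)
  -- Multiplication by the bump function `f` turns the resolution of the identity near `x` into a
  -- global equation of sections.
  have key : 𝒞.fsmul f s = 𝒞.fsmul f (∑ i, 𝒞.fsmul (𝒞.pairing s (ε i)) (e i)) := by
    refine c.ext _ _ (c.smooth_fsmul _ _ hf hs) (c.smooth_fsmul _ _ hf (c.smooth_sum _ _ hsm))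
      fun χ hχ => ?_
    rw [c.pairing_fsmul, c.pairing_fsmul, c.pairing_sum]
    ext y
    by_cases hy : y ∈ {y | ∀ s χ, 𝒞.Smooth s → 𝒞.Smooth χ →
      𝒞.pairing s χ y = ∑ i, 𝒞.pairing s (ε i) y * 𝒞.pairing (e i) χ y}
    · simp [hy s χ hs hχ, c.pairing_fsmul]
    · simp [hf0 y hy]
  have h1 := hT.fsmul f s hf hs
  rw [key, hT.fsmul f _ hf (c.smooth_sum _ _ hsm), hfx, one_mul, one_mul, hT.sum c _ _ hsm] at h1
  rw [← h1]
  exact Finset.sum_congr rfl fun i _ => hT.fsmul _ _ (hp i) (h.smooth_left i)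

/-- Tensorial functionals only depend on the value of a section at the point. -/
lemma congr_of_pairing (c : SectionCalculus 𝒞) (hT : IsTensorialAt 𝒞 x T) {ι : Type*} [Fintype ι]
    {e ε : ι → S} (h : IsDualFrame 𝒞 x e ε) {s t : S} (hs : 𝒞.Smooth s) (ht : 𝒞.Smooth t)
    (hst : ∀ χ, 𝒞.Smooth χ → 𝒞.pairing s χ x = 𝒞.pairing t χ x) : T s = T t := by
  rw [hT.expand c h hs, hT.expand c h ht]
  exact Finset.sum_congr rfl fun i _ => by rw [hst _ (h.smooth_right i)]

end IsTensorialAt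

/-- The contraction of a bilinear tensor over a pair of dual frames does not depend on the frame. -/
lemma sum_eq_of_isDualFrame (c : SectionCalculus 𝒞) {x : X} {T : S → S → ℝ}
    (hl : ∀ t, 𝒞.Smooth t → IsTensorialAt 𝒞 x fun s => T s t)
    (hr : ∀ s, 𝒞.Smooth s → IsTensorialAt 𝒞 x fun t => T s t)
    {ι κ : Type*} [Fintype ι] [Fintype κ] {e ε : ι → S} {b β : κ → S}
    (h : IsDualFrame 𝒞 x e ε) (h' : IsDualFrame 𝒞 x b β) :
    ∑ i, T (e i) (ε i) = ∑ j, T (b j) (β j) := by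
  have h1 : ∀ i, T (e i) (ε i) = ∑ j, 𝒞.pairing (e i) (β j) x * T (b j) (ε i) := fun i =>
    (hl _ (h.smooth_right i)).expand c h' (h.smooth_left i)
  have h2 : ∀ j, T (b j) (β j) = ∑ i, 𝒞.pairing (β j) (e i) x * T (b j) (ε i) := fun j =>
    (hr _ (h'.smooth_left j)).expand c (h.symm c) (h'.smooth_right j)
  simp only [h1, h2]
  rw [Finset.sum_comm]
  exact Finset.sum_congr rfl fun j _ => Finset.sum_congr rfl fun i _ => by
    rw [c.pairing_comm]

/-! ### The curvature of a torsion free connection is a tensor -/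

namespace IsConnection

variable {nab : S → S → S} (hn : IsConnection 𝒞 nab) (c : SectionCalculus 𝒞)
include hn c

lemma tensorial_left {φ φ' : S} (hφ : 𝒞.Smooth φ) (x : X) :
    IsTensorialAt 𝒞 x fun s => 𝒞.pairing (nab s φ) φ' x where
  add s t hs ht := by rw [hn.add_left _ _ _ hs ht hφ, c.pairing_add]; rfl
  fsmul f s hf hs := by rw [hn.fsmul_left _ _ _ hf hs hφ, c.pairing_fsmul]; rfl

lemma zero_right {ψ : S} (hψ : 𝒞.Smooth ψ) : nab ψ 0 = 0 := by
  have h := hn.add_right ψ 0 0 hψ c.smooth_zero c.smooth_zero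
  rw [add_zero] at h
  simpa using h

lemma zero_left {ψ : S} (hψ : 𝒞.Smooth ψ) : nab 0 ψ = 0 := by
  have h := hn.add_left 0 0 ψ c.smooth_zero c.smooth_zero hψ
  rw [add_zero] at h
  simpa using h

lemma neg_left {ψ φ : S} (hψ : 𝒞.Smooth ψ) (hφ : 𝒞.Smooth φ) : nab (-ψ) φ = -nab ψ φ := by
  have h := hn.add_left ψ (-ψ) φ hψ (c.smooth_neg _ hψ) hφ
  rw [add_neg_cancel, hn.zero_left c hφ] at h
  exact (neg_eq_of_add_eq_zero_right h.symm).symm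

end IsConnection

/-- A metric connection without torsion, not necessarily compatible with a generalized metric. -/
structure IsTorsionFree (𝒞 : BracketData X S) (nab : S → S → S) : Prop where
  isConnection : IsConnection 𝒞 nab
  torsion_eq_zero : ∀ ψ ψ' ψ'', 𝒞.Smooth ψ → 𝒞.Smooth ψ' → 𝒞.Smooth ψ'' →
    torsion 𝒞 nab ψ ψ' ψ'' = 0

lemma IsLeviCivita.isTorsionFree {τ : S → S} {nab : S → S → S} (h : IsLeviCivita 𝒞 τ nab) :
    IsTorsionFree 𝒞 nab := ⟨h.isConnection, h.torsionFree⟩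

/-- The Riemann tensor of a connection, contracted with a given pair of dual frames. -/
def riemannIn (𝒞 : BracketData X S) {ι : Type*} [Fintype ι] (e ε : ι → S) (nab : S → S → S)
    (φ' φ ψ ψ' : S) (x : X) : ℝ :=
  (1 / 2) * (naiveCurvature 𝒞 nab φ' φ ψ ψ' x + naiveCurvature 𝒞 nab ψ' ψ φ φ' x +
    ∑ i, 𝒞.pairing (nab (e i) ψ) ψ' x * 𝒞.pairing (nab (ε i) φ) φ' x)

namespace IsTorsionFree

variable {nab : S → S → S} (hn : IsTorsionFree 𝒞 nab) (c : SectionCalculus 𝒞)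
include hn c

/-- For a torsion free connection the bracket is determined by the connection. -/
lemma pairing_bracket {ψ ψ' χ : S} (hψ : 𝒞.Smooth ψ) (hψ' : 𝒞.Smooth ψ') (hχ : 𝒞.Smooth χ) :
    𝒞.pairing (𝒞.bracket ψ ψ') χ =
      𝒞.pairing (nab ψ ψ') χ - 𝒞.pairing (nab ψ' ψ) χ + 𝒞.pairing (nab χ ψ) ψ' := by
  have h := hn.torsion_eq_zero ψ ψ' χ hψ hψ' hχ
  rw [torsion, c.pairing_sub, c.pairing_sub] at h
  ext y
  have := congrFun h y
  simp only [Pi.add_apply, Pi.sub_apply, Pi.zero_apply] at this ⊢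
  linarith

/-- Smoothness of brackets follows from the existence of a torsion free connection. -/
lemma bracket_smooth {ψ ψ' : S} (hψ : 𝒞.Smooth ψ) (hψ' : 𝒞.Smooth ψ') :
    𝒞.Smooth (𝒞.bracket ψ ψ') := by
  refine c.smooth_bracket _ _ hψ hψ' fun χ hχ => ?_
  have hs := hn.isConnection.smooth
  rw [hn.pairing_bracket c hψ hψ' hχ]
  exact c.fun_add _ _ (c.fun_sub _ _ (c.pairing_smooth _ _ (hs _ _ hψ hψ') hχ)
    (c.pairing_smooth _ _ (hs _ _ hψ' hψ) hχ)) (c.pairing_smooth _ _ (hs _ _ hχ hψ) hψ')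

lemma bracket_add_right {ψ s t : S} (hψ : 𝒞.Smooth ψ) (hs : 𝒞.Smooth s) (ht : 𝒞.Smooth t) :
    𝒞.bracket ψ (s + t) = 𝒞.bracket ψ s + 𝒞.bracket ψ t := by
  refine c.ext _ _ (hn.bracket_smooth c hψ (c.smooth_add _ _ hs ht))
    (c.smooth_add _ _ (hn.bracket_smooth c hψ hs) (hn.bracket_smooth c hψ ht)) fun χ hχ => ?_
  have h := hn.isConnection
  rw [c.pairing_add, hn.pairing_bracket c hψ (c.smooth_add _ _ hs ht) hχ,
    hn.pairing_bracket c hψ hs hχ, hn.pairing_bracket c hψ ht hχ, h.add_right _ _ _ hψ hs ht,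
    h.add_left _ _ _ hs ht hψ, c.pairing_add, c.pairing_add, c.pairing_add_right]
  abel

lemma bracket_add_left {ψ s t : S} (hψ : 𝒞.Smooth ψ) (hs : 𝒞.Smooth s) (ht : 𝒞.Smooth t) :
    𝒞.bracket (s + t) ψ = 𝒞.bracket s ψ + 𝒞.bracket t ψ := by
  refine c.ext _ _ (hn.bracket_smooth c (c.smooth_add _ _ hs ht) hψ)
    (c.smooth_add _ _ (hn.bracket_smooth c hs hψ) (hn.bracket_smooth c ht hψ)) fun χ hχ => ?_
  have h := hn.isConnection
  rw [c.pairing_add, hn.pairing_bracket c (c.smooth_add _ _ hs ht) hψ hχ,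
    hn.pairing_bracket c hs hψ hχ, hn.pairing_bracket c ht hψ hχ, h.add_right _ _ _ hψ hs ht,
    h.add_left _ _ _ hs ht hψ, h.add_right _ _ _ hχ hs ht, c.pairing_add, c.pairing_add,
    c.pairing_add]
  abel

lemma bracket_fsmul_right {f : X → ℝ} {ψ s : S} (hf : 𝒞.SmoothFun f) (hψ : 𝒞.Smooth ψ)
    (hs : 𝒞.Smooth s) :
    𝒞.bracket ψ (𝒞.fsmul f s) = 𝒞.fsmul f (𝒞.bracket ψ s) + 𝒞.fsmul (𝒞.anchor ψ f) s := by
  refine c.ext _ _ (hn.bracket_smooth c hψ (c.smooth_fsmul _ _ hf hs))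
    (c.smooth_add _ _ (c.smooth_fsmul _ _ hf (hn.bracket_smooth c hψ hs))
      (c.smooth_fsmul _ _ (c.anchor_smooth _ _ hψ hf) hs)) fun χ hχ => ?_
  have h := hn.isConnection
  rw [c.pairing_add, hn.pairing_bracket c hψ (c.smooth_fsmul _ _ hf hs) hχ, c.pairing_fsmul,
    c.pairing_fsmul, hn.pairing_bracket c hψ hs hχ, h.leibniz _ _ _ hf hψ hs,
    h.fsmul_left _ _ _ hf hs hψ, c.pairing_add, c.pairing_fsmul, c.pairing_fsmul, c.pairing_fsmul,
    c.pairing_fsmul_right]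
  ring

/-- The bracket is not a derivation in its first argument: the defect is `⟨s, ψ⟩ df`. -/
lemma pairing_bracket_fsmul_left {f : X → ℝ} {ψ s χ : S} (hf : 𝒞.SmoothFun f)
    (hψ : 𝒞.Smooth ψ) (hs : 𝒞.Smooth s) (hχ : 𝒞.Smooth χ) :
    𝒞.pairing (𝒞.bracket (𝒞.fsmul f s) ψ) χ = f * 𝒞.pairing (𝒞.bracket s ψ) χ
      - 𝒞.anchor ψ f * 𝒞.pairing s χ + 𝒞.anchor χ f * 𝒞.pairing s ψ := by
  have h := hn.isConnection
  rw [hn.pairing_bracket c (c.smooth_fsmul _ _ hf hs) hψ hχ, hn.pairing_bracket c hs hψ hχ,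
    h.leibniz _ _ _ hf hψ hs, h.leibniz _ _ _ hf hχ hs, h.fsmul_left _ _ _ hf hs hψ,
    c.pairing_add, c.pairing_add, c.pairing_fsmul, c.pairing_fsmul, c.pairing_fsmul,
    c.pairing_fsmul, c.pairing_fsmul]
  ring

variable {φ' φ ψ ψ' : S}

lemma naiveCurvature_apply (x : X) : naiveCurvature 𝒞 nab φ' φ ψ ψ' x =
    𝒞.pairing (nab ψ (nab ψ' φ)) φ' x - 𝒞.pairing (nab ψ' (nab ψ φ)) φ' x
      - 𝒞.pairing (nab (𝒞.bracket ψ ψ') φ) φ' x := by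
  rw [naiveCurvature, c.pairing_comm, c.pairing_sub, c.pairing_sub]
  rfl

lemma naiveCurvature_tensorial_one (x : X) :
    IsTensorialAt 𝒞 x fun s => naiveCurvature 𝒞 nab s φ ψ ψ' x where
  add s t _ _ := by simp only [naiveCurvature, c.pairing_add, Pi.add_apply]
  fsmul f s _ _ := by simp only [naiveCurvature, c.pairing_fsmul, Pi.mul_apply]

lemma naiveCurvature_tensorial_two (hψ : 𝒞.Smooth ψ) (hψ' : 𝒞.Smooth ψ')
    (x : X) : IsTensorialAt 𝒞 x fun s => naiveCurvature 𝒞 nab φ' s ψ ψ' x where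
  add s t hs ht := by
    have h := hn.isConnection
    have hB := hn.bracket_smooth c hψ hψ'
    simp only [hn.naiveCurvature_apply c, h.add_right _ _ _ hψ' hs ht, h.add_right _ _ _ hψ hs ht,
      h.add_right _ _ _ hB hs ht, h.add_right _ _ _ hψ (h.smooth _ _ hψ' hs) (h.smooth _ _ hψ' ht),
      h.add_right _ _ _ hψ' (h.smooth _ _ hψ hs) (h.smooth _ _ hψ ht), c.pairing_add, Pi.add_apply]
    ring
  fsmul f s hf hs := by
    have h := hn.isConnection
    have hB := hn.bracket_smooth c hψ hψ'
    have ha := c.anchor_smooth _ _ hψ hf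
    have ha' := c.anchor_smooth _ _ hψ' hf
    simp only [hn.naiveCurvature_apply c, h.leibniz _ _ _ hf hψ' hs, h.leibniz _ _ _ hf hψ hs,
      h.leibniz _ _ _ hf hB hs,
      h.add_right _ _ _ hψ (c.smooth_fsmul _ _ hf (h.smooth _ _ hψ' hs))
        (c.smooth_fsmul _ _ ha' hs),
      h.add_right _ _ _ hψ' (c.smooth_fsmul _ _ hf (h.smooth _ _ hψ hs))
        (c.smooth_fsmul _ _ ha hs),
      h.leibniz _ _ _ hf hψ (h.smooth _ _ hψ' hs), h.leibniz _ _ _ hf hψ' (h.smooth _ _ hψ hs),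
      h.leibniz _ _ _ ha hψ' hs, h.leibniz _ _ _ ha' hψ hs, c.anchor_bracket _ _ _ hψ hψ' hf,
      c.pairing_add, c.pairing_fsmul, Pi.add_apply, Pi.mul_apply, Pi.sub_apply]
    ring

lemma naiveCurvature_add_three (hφ : 𝒞.Smooth φ) (hψ' : 𝒞.Smooth ψ') {s t : S}
    (hs : 𝒞.Smooth s) (ht : 𝒞.Smooth t) (x : X) :
    naiveCurvature 𝒞 nab φ' φ (s + t) ψ' x =
      naiveCurvature 𝒞 nab φ' φ s ψ' x + naiveCurvature 𝒞 nab φ' φ t ψ' x := by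
  have h := hn.isConnection
  simp only [hn.naiveCurvature_apply c, h.add_left _ _ _ hs ht hφ,
    h.add_left _ _ _ hs ht (h.smooth _ _ hψ' hφ),
    h.add_right _ _ _ hψ' (h.smooth _ _ hs hφ) (h.smooth _ _ ht hφ),
    hn.bracket_add_left c hψ' hs ht,
    h.add_left _ _ _ (hn.bracket_smooth c hs hψ') (hn.bracket_smooth c ht hψ') hφ,
    c.pairing_add, Pi.add_apply]
  ring

lemma naiveCurvature_tensorial_four (hφ : 𝒞.Smooth φ) (hψ : 𝒞.Smooth ψ) (x : X) :
    IsTensorialAt 𝒞 x fun s => naiveCurvature 𝒞 nab φ' φ ψ s x where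
  add s t hs ht := by
    have h := hn.isConnection
    simp only [hn.naiveCurvature_apply c, h.add_left _ _ _ hs ht hφ,
      h.add_left _ _ _ hs ht (h.smooth _ _ hψ hφ),
      h.add_right _ _ _ hψ (h.smooth _ _ hs hφ) (h.smooth _ _ ht hφ),
      hn.bracket_add_right c hψ hs ht,
      h.add_left _ _ _ (hn.bracket_smooth c hψ hs) (hn.bracket_smooth c hψ ht) hφ,
      c.pairing_add, Pi.add_apply]
    ring
  fsmul f s hf hs := by
    have h := hn.isConnection
    have hB := hn.bracket_smooth c hψ hs
    have ha := c.anchor_smooth _ _ hψ hf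
    simp only [hn.naiveCurvature_apply c, h.fsmul_left _ _ _ hf hs hφ,
      h.fsmul_left _ _ _ hf hs (h.smooth _ _ hψ hφ), h.leibniz _ _ _ hf hψ (h.smooth _ _ hs hφ),
      hn.bracket_fsmul_right c hf hψ hs,
      h.add_left _ _ _ (c.smooth_fsmul _ _ hf hB) (c.smooth_fsmul _ _ ha hs) hφ,
      h.fsmul_left _ _ _ hf hB hφ, h.fsmul_left _ _ _ ha hs hφ,
      c.pairing_add, c.pairing_fsmul, Pi.add_apply, Pi.mul_apply]
    ring

/-- The naive curvature is not a tensor in its third argument, because of the symmetric part of the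
bracket. -/
lemma naiveCurvature_fsmul_three {ι : Type*} [Fintype ι] {x : X} {e ε : ι → S}
    (hF : IsDualFrame 𝒞 x e ε) {f : X → ℝ} {s : S} (hf : 𝒞.SmoothFun f) (hφ : 𝒞.Smooth φ)
    (hψ' : 𝒞.Smooth ψ') (hs : 𝒞.Smooth s) :
    naiveCurvature 𝒞 nab φ' φ (𝒞.fsmul f s) ψ' x = f x * naiveCurvature 𝒞 nab φ' φ s ψ' x
      - 𝒞.pairing s ψ' x * ∑ i, 𝒞.anchor (e i) f x * 𝒞.pairing (nab (ε i) φ) φ' x := by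
  have h := hn.isConnection
  have hfs := c.smooth_fsmul _ _ hf hs
  have ht := h.tensorial_left c (φ' := φ') hφ x
  have e1 := ht.expand c (hF.symm c) (hn.bracket_smooth c hfs hψ')
  have e2 := ht.expand c (hF.symm c) (hn.bracket_smooth c hs hψ')
  have e3 := ht.expand c (hF.symm c) hs
  have e4 : ∀ i, 𝒞.pairing (𝒞.bracket (𝒞.fsmul f s) ψ') (e i) x =
      f x * 𝒞.pairing (𝒞.bracket s ψ') (e i) x - 𝒞.anchor ψ' f x * 𝒞.pairing s (e i) x
        + 𝒞.anchor (e i) f x * 𝒞.pairing s ψ' x := fun i =>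
    congrFun (hn.pairing_bracket_fsmul_left c hf hψ' hs (hF.smooth_left i)) x
  have e5 : 𝒞.pairing (nab (𝒞.bracket (𝒞.fsmul f s) ψ') φ) φ' x =
      f x * 𝒞.pairing (nab (𝒞.bracket s ψ') φ) φ' x
        - 𝒞.anchor ψ' f x * 𝒞.pairing (nab s φ) φ' x
        + 𝒞.pairing s ψ' x * ∑ i, 𝒞.anchor (e i) f x * 𝒞.pairing (nab (ε i) φ) φ' x := by
    rw [e1, e2, e3, Finset.mul_sum, Finset.mul_sum, Finset.mul_sum, ← Finset.sum_sub_distrib,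
      ← Finset.sum_add_distrib]
    refine Finset.sum_congr rfl fun i _ => ?_
    rw [e4]
    ring
  rw [hn.naiveCurvature_apply c, hn.naiveCurvature_apply c, e5, h.fsmul_left _ _ _ hf hs hφ,
    h.fsmul_left _ _ _ hf hs (h.smooth _ _ hψ' hφ), h.leibniz _ _ _ hf hψ' (h.smooth _ _ hs hφ)]
  simp only [c.pairing_add, c.pairing_fsmul, Pi.add_apply, Pi.mul_apply]
  ring

section Riemann

variable {ι : Type*} [Fintype ι] {x : X} {e ε : ι → S} (hF : IsDualFrame 𝒞 x e ε)
include hF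

lemma riemannIn_frame_indep {κ : Type*} [Fintype κ] {b β : κ → S} (hF' : IsDualFrame 𝒞 x b β)
    (hφ : 𝒞.Smooth φ) (hψ : 𝒞.Smooth ψ) :
    riemannIn 𝒞 e ε nab φ' φ ψ ψ' x = riemannIn 𝒞 b β nab φ' φ ψ ψ' x := by
  have h := hn.isConnection
  unfold riemannIn
  rw [sum_eq_of_isDualFrame c (T := fun s t => 𝒞.pairing (nab s ψ) ψ' x *
    𝒞.pairing (nab t φ) φ' x) (fun t _ => ?_) (fun s _ => ?_) hF hF']
  · have := h.tensorial_left c (φ' := ψ') hψ x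
    exact ⟨fun s s' hs hs' => by rw [this.add _ _ hs hs', add_mul],
      fun f s hf hs => by rw [this.fsmul _ _ hf hs, mul_assoc]⟩
  · have := h.tensorial_left c (φ' := φ') hφ x
    exact ⟨fun s s' hs hs' => by rw [this.add _ _ hs hs', mul_add],
      fun f s hf hs => by rw [this.fsmul _ _ hf hs]; ring⟩

/-- The Riemann tensor has pair symmetry by construction: exchanging the pairs exchanges the naive
curvatures and replaces the frame by its dual. -/
lemma riemannIn_symm (hφ : 𝒞.Smooth φ) (hψ : 𝒞.Smooth ψ) :
    riemannIn 𝒞 e ε nab φ' φ ψ ψ' x = riemannIn 𝒞 e ε nab ψ' ψ φ φ' x := by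
  rw [hn.riemannIn_frame_indep c hF (hF.symm c) hφ hψ]
  unfold riemannIn
  simp only [mul_comm]
  ring

lemma riemannIn_tensorial_one (hψ : 𝒞.Smooth ψ) (hφ : 𝒞.Smooth φ) :
    IsTensorialAt 𝒞 x fun s => riemannIn 𝒞 e ε nab s φ ψ ψ' x := by
  have h1 := hn.naiveCurvature_tensorial_one c (φ := φ) (ψ := ψ) (ψ' := ψ') x
  have h2 := hn.naiveCurvature_tensorial_four c (φ' := ψ') hψ hφ x
  constructor
  · intro s t hs ht
    have h1 := h1.add s t hs ht
    have h2 := h2.add s t hs ht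
    simp only [riemannIn, h1, h2, c.pairing_add_right, Pi.add_apply, mul_add,
      Finset.sum_add_distrib]
    ring
  · intro f s hf hs
    have h1 := h1.fsmul f s hf hs
    have h2 := h2.fsmul f s hf hs
    simp only [riemannIn, h1, h2, c.pairing_fsmul_right, Pi.mul_apply]
    simp only [mul_left_comm _ (f x), ← Finset.mul_sum]
    ring

/-- In the third argument the defect of the naive curvature is cancelled by the quadratic term. -/
lemma riemannIn_tensorial_three (hφ : 𝒞.Smooth φ) (hφ' : 𝒞.Smooth φ') (hψ' : 𝒞.Smooth ψ') :
    IsTensorialAt 𝒞 x fun s => riemannIn 𝒞 e ε nab φ' φ s ψ' x := by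
  have h := hn.isConnection
  have h2 := hn.naiveCurvature_tensorial_two c (φ' := ψ') hφ hφ' x
  constructor
  · intro s t hs ht
    have h1 := hn.naiveCurvature_add_three c (φ' := φ') hφ hψ' hs ht x
    have h2 := h2.add s t hs ht
    simp only [riemannIn, h1, h2, h.add_right _ _ _ (hF.smooth_left _) hs ht, c.pairing_add,
      Pi.add_apply, add_mul, Finset.sum_add_distrib]
    ring
  · intro f s hf hs
    have h1 := hn.naiveCurvature_fsmul_three c (φ' := φ') hF hf hφ hψ' hs
    have h2 := h2.fsmul f s hf hs
    simp only [riemannIn, h1, h2, h.leibniz _ _ _ hf (hF.smooth_left _) hs, c.pairing_add,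
      c.pairing_fsmul, Pi.add_apply, Pi.mul_apply, add_mul, Finset.sum_add_distrib]
    simp only [mul_assoc, ← Finset.mul_sum]
    have : ∑ i, 𝒞.anchor (e i) f x * (𝒞.pairing s ψ' x * 𝒞.pairing (nab (ε i) φ) φ' x) =
        𝒞.pairing s ψ' x * ∑ i, 𝒞.anchor (e i) f x * 𝒞.pairing (nab (ε i) φ) φ' x := by
      rw [Finset.mul_sum]
      exact Finset.sum_congr rfl fun i _ => by ring
    rw [this]
    ring

lemma riemannIn_tensorial_four (hφ : 𝒞.Smooth φ) (hψ : 𝒞.Smooth ψ) :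
    IsTensorialAt 𝒞 x fun s => riemannIn 𝒞 e ε nab φ' φ ψ s x := by
  simp only [hn.riemannIn_symm c hF hφ hψ]
  exact hn.riemannIn_tensorial_one c hF hφ hψ

lemma riemannIn_tensorial_two (hφ' : 𝒞.Smooth φ') (hψ : 𝒞.Smooth ψ) (hψ' : 𝒞.Smooth ψ') :
    IsTensorialAt 𝒞 x fun s => riemannIn 𝒞 e ε nab φ' s ψ ψ' x := by
  have h := hn.riemannIn_tensorial_three c hF hψ hψ' hφ'
  constructor
  · intro s t hs ht
    have := h.add s t hs ht
    simp only [hn.riemannIn_symm c hF (c.smooth_add _ _ hs ht) hψ, hn.riemannIn_symm c hF hs hψ,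
      hn.riemannIn_symm c hF ht hψ, this]
  · intro f s hf hs
    have := h.fsmul f s hf hs
    simp only [hn.riemannIn_symm c hF (c.smooth_fsmul _ _ hf hs) hψ, hn.riemannIn_symm c hF hs hψ,
      this]

end Riemann

/-- The Ricci tensor can be computed in any pair of dual frames. -/
lemma ricci_eq {x : X} (hloc : IsDualFrame 𝒞 x (localFrame 𝒞 x).1 (localFrame 𝒞 x).2)
    {ι : Type*} [Fintype ι] {e ε : ι → S} (hF : IsDualFrame 𝒞 x e ε) (hψ : 𝒞.Smooth ψ)
    (hψ' : 𝒞.Smooth ψ') :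
    ricci 𝒞 nab ψ ψ' x = ∑ i, riemannIn 𝒞 e ε nab (ε i) ψ' (e i) ψ x := by
  have h1 : ricci 𝒞 nab ψ ψ' x = ∑ i, riemannIn 𝒞 e ε nab ((localFrame 𝒞 x).2 i) ψ'
      ((localFrame 𝒞 x).1 i) ψ x :=
    Finset.sum_congr rfl fun i _ =>
      hn.riemannIn_frame_indep c hloc hF hψ' (hloc.smooth_left i)
  rw [h1]
  exact sum_eq_of_isDualFrame c (T := fun s t => riemannIn 𝒞 e ε nab t ψ' s ψ x)
    (fun t ht => hn.riemannIn_tensorial_three c hF hψ' ht hψ)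
    (fun s hs => hn.riemannIn_tensorial_one c hF hs hψ') hloc hF

lemma ricci_tensorial_left {x : X}
    (hF : IsDualFrame 𝒞 x (localFrame 𝒞 x).1 (localFrame 𝒞 x).2) (hψ' : 𝒞.Smooth ψ') :
    IsTensorialAt 𝒞 x fun s => ricci 𝒞 nab s ψ' x := by
  have h := fun i => hn.riemannIn_tensorial_four c hF (φ' := (localFrame 𝒞 x).2 i) hψ'
    (hF.smooth_left i)
  constructor
  · intro s t hs ht
    simp only [ricci, ← Finset.sum_add_distrib]
    exact Finset.sum_congr rfl fun i _ => (h i).add s t hs ht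
  · intro f s hf hs
    simp only [ricci, Finset.mul_sum]
    exact Finset.sum_congr rfl fun i _ => (h i).fsmul f s hf hs

lemma ricci_tensorial_right {x : X}
    (hF : IsDualFrame 𝒞 x (localFrame 𝒞 x).1 (localFrame 𝒞 x).2) (hψ : 𝒞.Smooth ψ) :
    IsTensorialAt 𝒞 x fun s => ricci 𝒞 nab ψ s x := by
  have h := fun i => hn.riemannIn_tensorial_two c hF (hF.smooth_right i) (hF.smooth_left i) hψ
  constructor
  · intro s t hs ht
    simp only [ricci, ← Finset.sum_add_distrib]
    exact Finset.sum_congr rfl fun i _ => (h i).add s t hs ht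
  · intro f s hf hs
    simp only [ricci, Finset.mul_sum]
    exact Finset.sum_congr rfl fun i _ => (h i).fsmul f s hf hs

/-- The Ricci scalar can be computed in any pair of dual frames. -/
lemma ricciScalar_eq {τ : S → S} (hτ : IsGeneralizedMetric 𝒞 τ) {x : X}
    (hloc : IsDualFrame 𝒞 x (localFrame 𝒞 x).1 (localFrame 𝒞 x).2)
    {ι : Type*} [Fintype ι] {e ε : ι → S} (hF : IsDualFrame 𝒞 x e ε) :
    ricciScalar 𝒞 τ nab x = ∑ i, ricci 𝒞 nab (τ (ε i)) (e i) x := by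
  refine sum_eq_of_isDualFrame c (T := fun s t => ricci 𝒞 nab (τ t) s x)
    (fun t ht => hn.ricci_tensorial_right c hloc (hτ.smooth _ ht))
    (fun s hs => ?_) hloc hF
  have h := hn.ricci_tensorial_left c hloc hs
  constructor
  · intro t t' ht ht'
    simp only [hτ.add _ _ ht ht']
    exact h.add _ _ (hτ.smooth _ ht) (hτ.smooth _ ht')
  · intro f t hf ht
    simp only [hτ.fsmul _ _ hf ht]
    exact h.fsmul _ _ hf (hτ.smooth _ ht)

end IsTorsionFree

end Calculus

/-! ### Smooth maps, vector fields and forms in coordinates -/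

section Coordinates

open Bundle

variable {E : Type*} [NormedAddCommGroup E] [NormedSpace ℝ E]
  {N : Type*} [TopologicalSpace N] [ChartedSpace E N] [IsManifold 𝓘(ℝ, E) ∞ N]
  {V : Type*} [NormedAddCommGroup V] [NormedSpace ℝ V]

instance : IsManifold 𝓘(ℝ, E) 1 N := IsManifold.of_le (n := ∞) (by norm_num)

omit [IsManifold 𝓘(ℝ, E) ∞ N] in
lemma contMDiffAt_tangentMap {E' H H' N' : Type*} [NormedAddCommGroup E'] [NormedSpace ℝ E']
    [TopologicalSpace H] [TopologicalSpace H'] {I : ModelWithCorners ℝ E H}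
    {I' : ModelWithCorners ℝ E' H'} {N : Type*} [TopologicalSpace N] [ChartedSpace H N]
    [TopologicalSpace N'] [ChartedSpace H' N'] [IsManifold I 1 N] [IsManifold I' 1 N']
    {f : N → N'} {z : TangentBundle I N} (hf : ContMDiffAt I I' ∞ f z.1) :
    ContMDiffAt I.tangent I'.tangent ∞ (tangentMap I I' f) z := by
  have hid : ContMDiffAt I.tangent I.tangent ∞
      (fun y : TangentBundle I N => (⟨y.1, y.2⟩ : TangentBundle I N)) z := contMDiffAt_id
  have hb : ContMDiffAt I.tangent I' ∞ (fun y : TangentBundle I N => f y.1) z :=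
    hf.comp z (contMDiffAt_proj (TangentSpace I))
  have A : ContMDiffAt I.tangent 𝓘(ℝ, E →L[ℝ] E') ∞ (fun y : TangentBundle I N =>
      ContinuousLinearMap.inCoordinates E (TangentSpace I (M := N)) E'
        (TangentSpace I' (M := N')) z.1 y.1 (f z.1) (f y.1) (mfderiv I I' f y.1)) z :=
    (ContMDiffAt.mfderiv_const hf (m := ∞) (by simp)).comp z (contMDiffAt_proj (TangentSpace I))
  exact ContMDiffAt.clm_apply_of_inCoordinates A hid hb

/-- The differential of a function near a point at which it is smooth, applied to a vector field. -/
lemma contMDiffAt_diff {f : N → V} {X : Π q : N, TangentSpace 𝓘(ℝ, E) q} {p : N}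
    (hf : ContMDiffAt 𝓘(ℝ, E) 𝓘(ℝ, V) ∞ f p)
    (hX : ContMDiffAt 𝓘(ℝ, E) 𝓘(ℝ, E).tangent ∞ (fun q => (⟨q, X q⟩ : TangentBundle 𝓘(ℝ, E) N)) p) :
    ContMDiffAt 𝓘(ℝ, E) 𝓘(ℝ, V) ∞ (fun q => diff f q (X q)) p := by
  have h1 : ContMDiffAt 𝓘(ℝ, E).tangent 𝓘(ℝ, V).tangent ∞ (tangentMap 𝓘(ℝ, E) 𝓘(ℝ, V) f)
      (⟨p, X p⟩ : TangentBundle 𝓘(ℝ, E) N) := contMDiffAt_tangentMap hf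
  exact ((contMDiff_snd_tangentBundle_modelSpace V 𝓘(ℝ, V)).contMDiffAt.comp _
    (h1.comp p hX))

lemma contMDiff_diff {f : N → V} {X : Π q : N, TangentSpace 𝓘(ℝ, E) q}
    (hf : ContMDiff 𝓘(ℝ, E) 𝓘(ℝ, V) ∞ f) (hX : SmoothVF X) :
    ContMDiff 𝓘(ℝ, E) 𝓘(ℝ, V) ∞ (fun q => diff f q (X q)) :=
  fun q => contMDiffAt_diff (hf q) (hX q)

lemma smoothForm_diff {f : N → V} (hf : ContMDiff 𝓘(ℝ, E) 𝓘(ℝ, V) ∞ f) :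
    SmoothForm (diff (E := E) f) := fun _ hX => contMDiff_diff hf hX

lemma SmoothVF.add {X Y : Π q : N, TangentSpace 𝓘(ℝ, E) q} (hX : SmoothVF X) (hY : SmoothVF Y) :
    SmoothVF (X + Y) := ContMDiff.add_section hX hY

lemma SmoothVF.smul {f : N → ℝ} {X : Π q : N, TangentSpace 𝓘(ℝ, E) q}
    (hf : ContMDiff 𝓘(ℝ, E) 𝓘(ℝ, ℝ) ∞ f) (hX : SmoothVF X) : SmoothVF (fun q => f q • X q) :=
  ContMDiff.smul_section hf hX

lemma SmoothVF.zero : SmoothVF (0 : Π q : N, TangentSpace 𝓘(ℝ, E) q) :=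
  contMDiff_zeroSection _ _

lemma exists_bump [FiniteDimensional ℝ E] [T2Space N] (p : N) {U : Set N} (hU : U ∈ 𝓝 p) :
    ∃ b : N → ℝ, ContMDiff 𝓘(ℝ, E) 𝓘(ℝ, ℝ) ∞ b ∧ (∀ᶠ q in 𝓝 p, b q = 1) ∧ tsupport b ⊆ U := by
  obtain ⟨f, -, hf⟩ := (SmoothBumpFunction.nhds_basis_tsupport (I := 𝓘(ℝ, E)) p).mem_iff.1 hU
  exact ⟨f, f.contMDiff, f.eventuallyEq_one, hf⟩

/-- Coordinates near `p`: a globally defined smooth function `φ` to the model space, and globally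
defined smooth vector fields `D v` which near `p` are the coordinate vector fields of the preferred
chart at `p`. -/
structure IsCoord (p : N) (φ : N → E) (D : E → Π q : N, TangentSpace 𝓘(ℝ, E) q) : Prop where
  smooth_fun : ContMDiff 𝓘(ℝ, E) 𝓘(ℝ, E) ∞ φ
  smooth_vf : ∀ v, SmoothVF (D v)
  eq_symmL : ∀ᶠ q in 𝓝 p, ∀ v,
    D v q = (trivializationAt E (TangentSpace 𝓘(ℝ, E) : N → Type _) p).symmL ℝ q v
  diff_eq : ∀ᶠ q in 𝓝 p, ∀ w : TangentSpace 𝓘(ℝ, E) q, (diff φ q w : E) =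
    (trivializationAt E (TangentSpace 𝓘(ℝ, E) : N → Type _) p).continuousLinearMapAt ℝ q w

/-- Coordinates are obtained from the preferred chart by multiplication with a bump function. -/
lemma exists_isCoord [FiniteDimensional ℝ E] [T2Space N] (p : N) :
    ∃ (φ : N → E) (D : E → Π q : N, TangentSpace 𝓘(ℝ, E) q), IsCoord p φ D := by
  set e := trivializationAt E (TangentSpace 𝓘(ℝ, E) : N → Type _) p with he
  obtain ⟨b, hb, hb1, hbU⟩ := exists_bump (E := E) p (chart_source_mem_nhds E p)
  refine ⟨fun q => b q • extChartAt 𝓘(ℝ, E) p q, fun v q => b q • e.symmL ℝ q v, ?_, ?_, ?_, ?_⟩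
  · refine contMDiff_of_tsupport fun q hq => ?_
    have hq' : q ∈ (chartAt E p).source := hbU (tsupport_smul_subset_left _ _ hq)
    exact hb.contMDiffAt.smul (contMDiffAt_extChartAt' hq')
  · intro v
    refine ContMDiffOn.smul_section_of_tsupport (u := (chartAt E p).source)
      (s := fun q => e.symmL ℝ q v) hb.contMDiffOn (chartAt E p).open_source hbU ?_
    have hbs : (chartAt E p).source = e.baseSet := by simp [he]
    rw [hbs, e.contMDiffOn_section_baseSet_iff]
    refine (contMDiffOn_const (c := v)).congr fun q hq => ?_
    simp [hq]
  · filter_upwards [hb1] with q hq v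
    simp [hq, he]
  · filter_upwards [hb1.eventually_nhds, chart_source_mem_nhds E p] with q hq hqs w
    rw [TangentBundle.continuousLinearMapAt_trivializationAt hqs, diff]
    have : (fun q => b q • extChartAt 𝓘(ℝ, E) p q) =ᶠ[𝓝 q] extChartAt 𝓘(ℝ, E) p := by
      filter_upwards [hq] with y hy
      simp [hy]
    rw [this.mfderiv_eq]

namespace IsCoord

variable {p : N} {φ : N → E} {D : E → Π q : N, TangentSpace 𝓘(ℝ, E) q} (h : IsCoord p φ D)
include h

lemma diff_vf : ∀ᶠ q in 𝓝 p, ∀ v : E, (diff φ q (D v q) : E) = v := by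
  filter_upwards [h.eq_symmL, h.diff_eq, chart_source_mem_nhds E p] with q h1 h2 hq v
  rw [h2, h1]
  exact Trivialization.continuousLinearMapAt_symmL _ (by simpa using hq) v

lemma vf_diff : ∀ᶠ q in 𝓝 p, ∀ w : TangentSpace 𝓘(ℝ, E) q, D (diff φ q w) q = w := by
  filter_upwards [h.eq_symmL, h.diff_eq, chart_source_mem_nhds E p] with q h1 h2 hq w
  rw [h1, h2]
  exact Trivialization.symmL_continuousLinearMapAt _ (by simpa using hq) w

lemma vf_self (v : E) : D v p = v := by
  rw [h.eq_symmL.self_of_nhds, TangentBundle.symmL_trivializationAt_eq_core (by simp)]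
  exact (tangentBundleCore 𝓘(ℝ, E) N).coordChange_self (achart E p) p (mem_chart_source E p) v

lemma diff_self (v : TangentSpace 𝓘(ℝ, E) p) : (diff φ p v : E) = v := by
  have := h.diff_vf.self_of_nhds v
  rwa [show D v p = v from h.vf_self v] at this

/-- A vector field is smooth at `p` if its coordinate representation is. -/
lemma contMDiffAt_vf {X : Π q : N, TangentSpace 𝓘(ℝ, E) q}
    (hX : ContMDiffAt 𝓘(ℝ, E) 𝓘(ℝ, E) ∞ (fun q => diff φ q (X q)) p) :
    ContMDiffAt 𝓘(ℝ, E) 𝓘(ℝ, E).tangent ∞ (fun q => (⟨q, X q⟩ : TangentBundle 𝓘(ℝ, E) N)) p := by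
  set e := trivializationAt E (TangentSpace 𝓘(ℝ, E) : N → Type _) p with he
  refine (e.contMDiffAt_section_iff (by simp [he])).2 (hX.congr_of_eventuallyEq ?_)
  filter_upwards [h.diff_eq, chart_source_mem_nhds E p] with q h2 hq
  rw [h2]
  exact (Trivialization.continuousLinearMapAt_apply_of_mem _ e (by simpa [he] using hq) _).symm

end IsCoord

end Coordinates

/-! ### Lie brackets and exterior derivatives -/

section LieBracket

open Bundle VectorField

variable {E : Type*} [NormedAddCommGroup E] [NormedSpace ℝ E] [FiniteDimensional ℝ E]
  {N : Type*} [TopologicalSpace N] [ChartedSpace E N] [IsManifold 𝓘(ℝ, E) ∞ N]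
  {V : Type*} [NormedAddCommGroup V] [NormedSpace ℝ V]

omit [FiniteDimensional ℝ E] in
lemma SmoothVF.mdifferentiableAt {X : Π q : N, TangentSpace 𝓘(ℝ, E) q} (hX : SmoothVF X) (p : N) :
    MDifferentiableAt 𝓘(ℝ, E) 𝓘(ℝ, E).tangent
      (fun q => (⟨q, X q⟩ : TangentBundle 𝓘(ℝ, E) N)) p :=
  (hX p).mdifferentiableAt (by simp)

lemma SmoothVF.mlieBracket {X Y : Π q : N, TangentSpace 𝓘(ℝ, E) q} (hX : SmoothVF X)
    (hY : SmoothVF Y) : SmoothVF (VectorField.mlieBracket 𝓘(ℝ, E) X Y) := by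
  have : CompleteSpace E := FiniteDimensional.complete ℝ E
  have : IsManifold 𝓘(ℝ, E) ((⊤ : ℕ∞) + 1) N := by simpa using ‹IsManifold 𝓘(ℝ, E) ∞ N›
  have : IsManifold 𝓘(ℝ, E) (minSmoothness ℝ 2) N := IsManifold.of_le (n := ∞) (by
    rw [minSmoothness_of_isRCLikeNormedField]
    exact WithTop.coe_le_coe.2 le_top)
  exact ContDiff.mlieBracket_vectorField (m := ⊤) (n := ⊤) hX hY
    (by rw [minSmoothness_of_isRCLikeNormedField]; simp)

lemma mlieBracket_fsmul {X Y : Π q : N, TangentSpace 𝓘(ℝ, E) q} {f : N → ℝ} {p : N}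
    (hf : ContMDiff 𝓘(ℝ, E) 𝓘(ℝ, ℝ) ∞ f) (hY : SmoothVF Y) :
    mlieBracket 𝓘(ℝ, E) X (fun q => f q • Y q) p =
      (diff f p (X p) : ℝ) • Y p + f p • mlieBracket 𝓘(ℝ, E) X Y p :=
  haveI : CompleteSpace E := FiniteDimensional.complete ℝ E
  mlieBracket_smul_right ((hf p).mdifferentiableAt (by simp)) (hY.mdifferentiableAt p)

variable [T2Space N]

/-- The commutator formula `[X, Y] f = X (Y f) - Y (X f)` for real functions, deduced from the
Jacobi identity for `X`, `Y` and `f Z`, where `Z` is any vector field not vanishing at the point. -/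
lemma diff_mlieBracket_real {X Y : Π q : N, TangentSpace 𝓘(ℝ, E) q} {f : N → ℝ}
    (hX : SmoothVF X) (hY : SmoothVF Y) (hf : ContMDiff 𝓘(ℝ, E) 𝓘(ℝ, ℝ) ∞ f) (p : N) :
    diff f p (mlieBracket 𝓘(ℝ, E) X Y p) =
      diff (fun q => diff f q (Y q)) p (X p) - diff (fun q => diff f q (X q)) p (Y p) := by
  have : CompleteSpace E := FiniteDimensional.complete ℝ E
  rcases subsingleton_or_nontrivial E with hE | hE
  · have h0 : ∀ v : TangentSpace 𝓘(ℝ, E) p, v = 0 := fun v => Subsingleton.elim (α := E) v 0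
    rw [h0 (mlieBracket 𝓘(ℝ, E) X Y p), h0 (X p), h0 (Y p)]
    simp only [map_zero, sub_self]
  obtain ⟨v, hv⟩ := exists_ne (0 : E)
  obtain ⟨φ, D, hD⟩ := exists_isCoord (E := E) p
  set Z := D v
  have hZ : SmoothVF Z := hD.smooth_vf v
  have hZp : Z p ≠ 0 := by
    rw [show Z p = v from hD.vf_self v]
    exact hv
  have hXf := contMDiff_diff hf hX
  have hYf := contMDiff_diff hf hY
  have e1 : ∀ {W : Π q : N, TangentSpace 𝓘(ℝ, E) q}, SmoothVF W →
      mlieBracket 𝓘(ℝ, E) W (fun q => f q • Z q) =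
        (fun q => (diff f q (W q) : ℝ) • Z q) + fun q => f q • mlieBracket 𝓘(ℝ, E) W Z q :=
    fun {W} hW => funext fun q => mlieBracket_fsmul hf hZ
  have sm := @SmoothVF.smul E _ _ N _ _ _
  have e2 : ∀ {W W' : Π q : N, TangentSpace 𝓘(ℝ, E) q}, SmoothVF W → SmoothVF W' →
      mlieBracket 𝓘(ℝ, E) W' (mlieBracket 𝓘(ℝ, E) W (fun q => f q • Z q)) p =
        ((diff (fun q => diff f q (W q)) p (W' p) : ℝ) • Z p +
          (diff f p (W p) : ℝ) • mlieBracket 𝓘(ℝ, E) W' Z p) +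
        ((diff f p (W' p) : ℝ) • mlieBracket 𝓘(ℝ, E) W Z p +
          f p • mlieBracket 𝓘(ℝ, E) W' (mlieBracket 𝓘(ℝ, E) W Z) p) := by
    intro W W' hW hW'
    rw [e1 hW, mlieBracket_add_right ((sm (contMDiff_diff hf hW) hZ).mdifferentiableAt p)
      ((sm hf (hW.mlieBracket hZ)).mdifferentiableAt p), mlieBracket_fsmul (contMDiff_diff hf hW) hZ,
      mlieBracket_fsmul hf (hW.mlieBracket hZ)]
  have min2 : minSmoothness ℝ 2 ≤ (∞ : WithTop ℕ∞) := by
    rw [minSmoothness_of_isRCLikeNormedField]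
    exact WithTop.coe_le_coe.2 le_top
  have : IsManifold 𝓘(ℝ, E) (minSmoothness ℝ 3) N := IsManifold.of_le (n := ∞) (by
    rw [minSmoothness_of_isRCLikeNormedField]
    exact WithTop.coe_le_coe.2 le_top)
  have jac := leibniz_identity_mlieBracket_apply ((hX p).of_le min2) ((hY p).of_le min2)
    (((sm hf hZ) p).of_le min2)
  have jac' := leibniz_identity_mlieBracket_apply ((hX p).of_le min2) ((hY p).of_le min2)
    ((hZ p).of_le min2)
  rw [e2 hY hX, e2 hX hY, mlieBracket_fsmul hf hZ, jac'] at jac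
  have key : ((diff f p (mlieBracket 𝓘(ℝ, E) X Y p) : ℝ) -
      (diff (fun q => diff f q (Y q)) p (X p) - diff (fun q => diff f q (X q)) p (Y p))) • Z p
        = 0 := by
    have aux : ∀ {F : Type _} [AddCommGroup F] [Module ℝ F] (a b c d e k : ℝ) (z w w' t t' : F),
        (a • z + b • w) + (c • w' + k • (t + t')) =
          (d • z + k • t) + ((e • z + c • w') + (b • w + k • t')) → (d - (a - e)) • z = 0 := by
      intro F _ _ a b c d e k z w w' t t' h
      rw [← neg_eq_zero, ← sub_eq_zero.2 h]
      module
    exact aux _ _ _ _ _ _ _ _ _ _ _ jac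
  exact sub_eq_zero.1 ((smul_eq_zero.1 key).resolve_right hZp)

omit [FiniteDimensional ℝ E] [IsManifold 𝓘(ℝ, E) ∞ N] [T2Space N] in
lemma diff_clm_comp {W : Type*} [NormedAddCommGroup W] [NormedSpace ℝ W] (L : V →L[ℝ] W)
    {f : N → V} {p : N} (hf : ContMDiffAt 𝓘(ℝ, E) 𝓘(ℝ, V) ∞ f p) (v : TangentSpace 𝓘(ℝ, E) p) :
    diff (fun q => L (f q)) p v = L (diff f p v) := by
  have h := mfderiv_comp (I := 𝓘(ℝ, E)) (I' := 𝓘(ℝ, V)) (I'' := 𝓘(ℝ, W)) (g := L) (f := f) p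
    (L.contMDiff.mdifferentiableAt one_ne_zero) (hf.mdifferentiableAt (by simp))
  have h2 : mfderiv 𝓘(ℝ, V) 𝓘(ℝ, W) L (f p) = L := by
    rw [mfderiv_eq_fderiv]; exact L.fderiv
  rw [h2] at h
  exact congrArg (fun T : E →L[ℝ] W => T v) h

/-- The commutator formula `[X, Y] f = X (Y f) - Y (X f)`. -/
lemma diff_mlieBracket {X Y : Π q : N, TangentSpace 𝓘(ℝ, E) q} {f : N → V}
    (hX : SmoothVF X) (hY : SmoothVF Y) (hf : ContMDiff 𝓘(ℝ, E) 𝓘(ℝ, V) ∞ f) (p : N) :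
    diff f p (mlieBracket 𝓘(ℝ, E) X Y p) =
      diff (fun q => diff f q (Y q)) p (X p) - diff (fun q => diff f q (X q)) p (Y p) := by
  refine (SeparatingDual.eq_iff_forall_dual_eq (R := ℝ)).2 fun L => ?_
  have h := diff_mlieBracket_real hX hY (L.contMDiff.comp hf) p
  simp only [Function.comp_def, diff_clm_comp L (hf _),
    diff_clm_comp L (contMDiff_diff hf hX _), diff_clm_comp L (contMDiff_diff hf hY _)] at h
  rw [map_sub]
  exact h

omit [FiniteDimensional ℝ E] [IsManifold 𝓘(ℝ, E) ∞ N] [T2Space N] in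
/-- The product rule for a bilinear expression. -/
lemma diff_bilin {V' W : Type*} [NormedAddCommGroup V'] [NormedSpace ℝ V'] [NormedAddCommGroup W]
    [NormedSpace ℝ W] (B : V →L[ℝ] V' →L[ℝ] W) {f : N → V} {g : N → V'} {p : N}
    (hf : ContMDiffAt 𝓘(ℝ, E) 𝓘(ℝ, V) ∞ f p) (hg : ContMDiffAt 𝓘(ℝ, E) 𝓘(ℝ, V') ∞ g p)
    (v : TangentSpace 𝓘(ℝ, E) p) :
    diff (fun q => B (f q) (g q)) p v = B (f p) (diff g p v) + B (diff f p v) (g p) := by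
  have h1 := (hf.mdifferentiableAt (by simp)).hasMFDerivAt
  have h2 := (hg.mdifferentiableAt (by simp)).hasMFDerivAt
  have h3 : HasMFDerivAt 𝓘(ℝ, E) 𝓘(ℝ, V × V') (fun q => (f q, g q)) p
      ((mfderiv 𝓘(ℝ, E) 𝓘(ℝ, V) f p).prod (mfderiv 𝓘(ℝ, E) 𝓘(ℝ, V') g p)) :=
    ⟨h1.1.prodMk h2.1, h1.2.prodMk h2.2⟩
  have h4 : HasMFDerivAt 𝓘(ℝ, V × V') 𝓘(ℝ, W) (fun z : V × V' => B z.1 z.2) (f p, g p)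
      (B.isBoundedBilinearMap.deriv (f p, g p)) :=
    (B.isBoundedBilinearMap.hasFDerivAt (f p, g p)).hasMFDerivAt
  have h5 := (HasMFDerivAt.comp p h4 h3).mfderiv
  exact congrArg (fun T : E →L[ℝ] W => T v) h5

/-- A vector valued 1-form in the coordinate frame at `p`. -/
lemma contMDiffAt_comp_symmL {η : Π q : N, TangentSpace 𝓘(ℝ, E) q →L[ℝ] V} (hη : SmoothForm η)
    (p : N) : ContMDiffAt 𝓘(ℝ, E) 𝓘(ℝ, E →L[ℝ] V) ∞ (fun q => (η q).comp
      ((trivializationAt E (TangentSpace 𝓘(ℝ, E) : N → Type _) p).symmL ℝ q)) p := by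
  obtain ⟨φ, D, hD⟩ := exists_isCoord (E := E) p
  let b := Module.finBasis ℝ E
  have key : ContMDiffAt 𝓘(ℝ, E) 𝓘(ℝ, E →L[ℝ] V) ∞ (fun q => ∑ i,
      ContinuousLinearMap.smulRightL ℝ E V (LinearMap.toContinuousLinearMap (b.coord i))
        (η q (D (b i) q))) p := by
    refine ContMDiffAt.sum fun i _ => ?_
    exact (ContinuousLinearMap.contMDiff _).contMDiffAt.comp p (hη _ (hD.smooth_vf (b i)) p)
  refine key.congr_of_eventuallyEq ?_
  filter_upwards [hD.eq_symmL] with q hq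
  ext v
  rw [sum_apply]
  have : v = ∑ i, b.coord i v • b i := (b.sum_repr v).symm
  conv_lhs => rw [this]
  simp only [map_sum, map_smul]
  refine Finset.sum_congr rfl fun i _ => ?_
  rw [hq]
  rfl

/-- The invariant formula `dη(X, Y) = X η(Y) - Y η(X) - η([X, Y])` for the exterior derivative. -/
lemma extDerivOne_apply {η : Π q : N, TangentSpace 𝓘(ℝ, E) q →L[ℝ] V} (hη : SmoothForm η)
    {X Y : Π q : N, TangentSpace 𝓘(ℝ, E) q} (hX : SmoothVF X) (hY : SmoothVF Y) (p : N) :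
    extDerivOne η p (X p) (Y p) = diff (fun q => η q (Y q)) p (X p)
      - diff (fun q => η q (X q)) p (Y p) - η p (mlieBracket 𝓘(ℝ, E) X Y p) := by
  -- In coordinates a field `W` becomes the function `dφ(W)`, and `η(W)` becomes `L (dφ(W))` with `L`
  -- the coefficient function in the definition of `extDerivOne`.
  obtain ⟨φ, D, hD⟩ := exists_isCoord (E := E) p
  set L : N → E →L[ℝ] V := fun q => (η q).comp
      ((trivializationAt E (TangentSpace 𝓘(ℝ, E) : N → Type _) p).symmL ℝ q) with hL
  have hLs : ContMDiffAt 𝓘(ℝ, E) 𝓘(ℝ, E →L[ℝ] V) ∞ L p := contMDiffAt_comp_symmL hη p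
  have hLp : ∀ v : E, L p v = η p v := fun v => by
    have h1 := hD.eq_symmL.self_of_nhds v
    have h2 := hD.vf_self v
    change η p (_ : TangentSpace 𝓘(ℝ, E) p) = _
    rw [h2] at h1
    exact congrArg (η p) h1.symm
  have e : ∀ {W : Π q : N, TangentSpace 𝓘(ℝ, E) q}, SmoothVF W → ∀ v : TangentSpace 𝓘(ℝ, E) p,
      diff (fun q => η q (W q)) p v = η p (diff (fun q => diff φ q (W q)) p v : E) +
        (diff L p v : E →L[ℝ] V) (W p) := by
    intro W hW v
    have h1 : (fun q => η q (W q)) =ᶠ[𝓝 p] fun q => L q (diff φ q (W q)) := by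
      filter_upwards [hD.eq_symmL, hD.vf_diff] with q h1 h2
      have h3 := h2 (W q)
      rw [h1] at h3
      exact congrArg (η q) h3.symm
    have h2 : diff (E := E) (fun q => η q (W q)) p = diff (E := E) (fun q => L q (diff φ q (W q))) p :=
      Filter.EventuallyEq.mfderiv_eq h1
    have h3 : diff (fun q => L q (diff φ q (W q))) p v = η p (diff (fun q => diff φ q (W q)) p v : E) +
        (diff L p v : E →L[ℝ] V) (diff φ p (W p) : E) :=
      (diff_bilin (ContinuousLinearMap.id ℝ (E →L[ℝ] V)) hLs
        (contMDiff_diff hD.smooth_fun hW p) v).trans (congrArg (· + _) (hLp _))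
    rw [h2, h3]
    congr 2
    exact hD.diff_self (W p)
  have hbr := diff_mlieBracket hX hY hD.smooth_fun p
  rw [show (diff φ p (mlieBracket 𝓘(ℝ, E) X Y p) : E) = mlieBracket 𝓘(ℝ, E) X Y p from
    hD.diff_self _] at hbr
  rw [e hX, e hY]
  have h3 : η p (mlieBracket 𝓘(ℝ, E) X Y p) =
      η p (diff (fun q => diff φ q (Y q)) p (X p) : E) -
        η p (diff (fun q => diff φ q (X q)) p (Y p) : E) := by
    exact (congrArg (η p) hbr).trans ((η p).map_sub _ _)
  rw [h3]
  have h4 : extDerivOne η p (X p) (Y p) =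
    (diff L p (X p) : E →L[ℝ] V) (Y p) - (diff L p (Y p) : E →L[ℝ] V) (X p) := rfl
  rw [h4]
  abel

end LieBracket

/-! ### The Dorfman bracket -/

/-- Biorthogonal families whose number is the dimension resolve the identity of a bilinear form. -/
lemma sum_mul_of_biorthogonal {W ι : Type*} [AddCommGroup W] [Module ℝ W] [FiniteDimensional ℝ W]
    [Fintype ι] [DecidableEq ι] (B : W →ₗ[ℝ] W →ₗ[ℝ] ℝ) {e ε : ι → W}
    (hcard : Fintype.card ι = Module.finrank ℝ W)
    (h : ∀ i j, B (e i) (ε j) = if i = j then 1 else 0) (s χ : W) :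
    B s χ = ∑ i, B s (ε i) * B (e i) χ := by
  have hli : LinearIndependent ℝ e := by
    rw [Fintype.linearIndependent_iff]
    intro g hg j
    have := congrArg (fun w => B w (ε j)) hg
    simpa [map_sum, h] using this
  let b := basisOfLinearIndependentOfCardEqFinrank' e hli hcard
  have hs : s = ∑ i, b.repr s i • e i := by
    conv_lhs => rw [← b.sum_repr s]
    simp [b]
  have hc : ∀ j, B s (ε j) = b.repr s j := fun j => by
    conv_lhs => rw [hs]
    simp [map_sum, h]
  simp only [hc]
  conv_lhs => rw [hs]
  simp [map_sum]

section LocalFrame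

variable {X S : Type*} [AddCommGroup S] [TopologicalSpace X] {𝒞 : BracketData X S}

/-- A pair of biorthogonal families indexed by any type of the right cardinality ensures that
`localFrame` is a local frame. -/
lemma isLocalFrame_localFrame {x : X} {ι : Type*} [Fintype ι] [DecidableEq ι]
    (hcard : Fintype.card ι = 𝒞.rank) {e ε : ι → S} (he : ∀ i, 𝒞.Smooth (e i))
    (hε : ∀ i, 𝒞.Smooth (ε i))
    (h : ∀ᶠ y in 𝓝 x, ∀ i j, 𝒞.pairing (e i) (ε j) y = if i = j then 1 else 0) :
    IsLocalFrame 𝒞 x (localFrame 𝒞 x) := by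
  let f := (Fintype.equivFinOfCardEq hcard).symm
  refine Classical.epsilon_spec (p := IsLocalFrame 𝒞 x) ⟨(e ∘ f, ε ∘ f), fun i => he _,
    fun i => hε _, ?_⟩
  filter_upwards [h] with y hy i j
  simp [hy]

end LocalFrame

section Dorfman

variable {E : Type*} [NormedAddCommGroup E] [NormedSpace ℝ E]
  {N : Type*} [TopologicalSpace N] [ChartedSpace E N] [IsManifold 𝓘(ℝ, E) ∞ N]
  {V : Type*} [NormedAddCommGroup V] [NormedSpace ℝ V]

lemma SmoothForm.add {η θ : Π p : N, TangentSpace 𝓘(ℝ, E) p →L[ℝ] V} (h : SmoothForm η)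
    (h' : SmoothForm θ) : SmoothForm (η + θ) := fun X hX => (h X hX).add (h' X hX)

lemma SmoothForm.smul {f : N → ℝ} {η : Π p : N, TangentSpace 𝓘(ℝ, E) p →L[ℝ] V}
    (hf : ContMDiff 𝓘(ℝ, E) 𝓘(ℝ, ℝ) ∞ f) (h : SmoothForm η) : SmoothForm (fun p => f p • η p) :=
  fun X hX => hf.smul (h X hX)

lemma SmoothForm.zero : SmoothForm (0 : Π p : N, TangentSpace 𝓘(ℝ, E) p →L[ℝ] V) :=
  fun _ _ => contMDiff_const

lemma SmoothForm.clm_comp {W : Type*} [NormedAddCommGroup W] [NormedSpace ℝ W] (L : V →L[ℝ] W)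
    {η : Π p : N, TangentSpace 𝓘(ℝ, E) p →L[ℝ] V} (h : SmoothForm η) :
    SmoothForm (fun p => L.comp (η p)) := fun X hX => L.contMDiff.comp (h X hX)

/-- A function with values in a finite dimensional space is smooth if its coordinates are. -/
lemma contMDiff_of_basis {ι : Type*} [Fintype ι] (b : Module.Basis ι ℝ V) {f : N → V}
    (h : ∀ i, ContMDiff 𝓘(ℝ, E) 𝓘(ℝ, ℝ) ∞ (fun p => b.repr (f p) i)) :
    ContMDiff 𝓘(ℝ, E) 𝓘(ℝ, V) ∞ f := by
  have : f = fun p => ∑ i, b.repr (f p) i • b i := funext fun p => (b.sum_repr _).symm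
  rw [this]
  exact ContMDiff.sum fun i _ => (h i).smul contMDiff_const

variable {H : Π p : N, TangentSpace 𝓘(ℝ, E) p → TangentSpace 𝓘(ℝ, E) p →
      TangentSpace 𝓘(ℝ, E) p →L[ℝ] ℝ}

lemma dorfman_pairing (s t : GenSec E N) (p : N) :
    (dorfman H).pairing s t p = t.2 p (s.1 p) + s.2 p (t.1 p) := rfl

variable [FiniteDimensional ℝ E] [T2Space N]

/-- The section calculus of the generalized tangent bundle.  No condition on `H` is needed, because
smoothness of brackets is only asserted when their pairings are smooth. -/
lemma dorfman_calculus : SectionCalculus (dorfman H) where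
  fun_const c := contMDiff_const
  fun_add f g hf hg := ContMDiff.add hf hg
  fun_mul f g hf hg := ContMDiff.mul hf hg
  smooth_zero := ⟨SmoothVF.zero, SmoothForm.zero⟩
  smooth_add s t hs ht := ⟨hs.1.add ht.1, hs.2.add ht.2⟩
  smooth_fsmul f s hf hs := ⟨SmoothVF.smul hf hs.1, SmoothForm.smul hf hs.2⟩
  pairing_add s t χ := by
    ext p
    change χ.2 p (s.1 p + t.1 p) + (s.2 p + t.2 p) (χ.1 p) = _
    rw [map_add, add_apply]
    exact add_add_add_comm _ _ _ _
  pairing_fsmul f s χ := by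
    ext p
    change χ.2 p (f p • s.1 p) + (f p • s.2 p) (χ.1 p) = _
    rw [map_smul, smul_apply, ← smul_add]
    rfl
  pairing_comm s t := by
    ext p
    exact add_comm _ _
  pairing_smooth s t hs ht := ContMDiff.add (ht.2 _ hs.1) (hs.2 _ ht.1)
  anchor_smooth s f hs hf := contMDiff_diff hf hs.1
  anchor_bracket s t f hs ht hf := by
    ext p
    exact diff_mlieBracket hs.1 ht.1 hf p
  fsmul_const_neg s := by
    refine Prod.ext (funext fun p => ?_) (funext fun p => ?_)
    · exact neg_one_smul ℝ (s.1 p)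
    · exact neg_one_smul ℝ (s.2 p)
  ext s t _ _ h := by
    refine Prod.ext ?_ ?_ <;> ext1 p
    · obtain ⟨φ, D, hD⟩ := exists_isCoord (E := E) p
      have h1 : ∀ L : E →L[ℝ] ℝ, L (diff φ p (s.1 p)) = L (diff φ p (t.1 p)) := fun L => by
        have := congrFun (h (0, fun q => L.comp (diff φ q))
          ⟨SmoothVF.zero, (smoothForm_diff hD.smooth_fun).clm_comp L⟩) p
        rw [dorfman_pairing, dorfman_pairing] at this
        simpa using this
      have h2 := (SeparatingDual.eq_iff_forall_dual_eq (R := ℝ)).2 h1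
      have h3 : ∀ v : TangentSpace 𝓘(ℝ, E) p, diff φ p v = v := hD.diff_self
      rwa [h3, h3] at h2
    · obtain ⟨φ, D, hD⟩ := exists_isCoord (E := E) p
      ext v
      have := congrFun (h (D v, 0) ⟨hD.smooth_vf v, SmoothForm.zero⟩) p
      rw [dorfman_pairing, dorfman_pairing] at this
      simp only [Pi.zero_apply, zero_apply, zero_add] at this
      have h3 : D v p = v := hD.vf_self v
      rwa [h3] at this
  smooth_bracket s t _ _ h := by
    refine ⟨fun p => ?_, fun Y hY => ?_⟩
    · obtain ⟨φ, D, hD⟩ := exists_isCoord (E := E) p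
      let b := Module.finBasis ℝ E
      refine hD.contMDiffAt_vf (contMDiff_of_basis b (fun i => ?_) p)
      have := h (0, fun q => (LinearMap.toContinuousLinearMap (b.coord i)).comp (diff φ q))
        ⟨SmoothVF.zero, (smoothForm_diff hD.smooth_fun).clm_comp _⟩
      refine (congrArg (ContMDiff 𝓘(ℝ, E) 𝓘(ℝ, ℝ) ∞) (funext fun q => ?_)).mp this
      rw [dorfman_pairing]
      simp
    · have := h (Y, 0) ⟨hY, SmoothForm.zero⟩
      refine (congrArg (ContMDiff 𝓘(ℝ, E) 𝓘(ℝ, ℝ) ∞) (funext fun q => ?_)).mp this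
      rw [dorfman_pairing]
      simp
  bump p U hU := by
    obtain ⟨b, hb, hb1, hbU⟩ := exists_bump (E := E) p hU
    refine ⟨b, hb, hb1.self_of_nhds, fun y hy => ?_⟩
    exact image_eq_zero_of_notMem_tsupport fun h => hy (hbU h)

/-- The pairing on a fibre of the generalized tangent bundle. -/
def fibrePairing (E : Type*) [NormedAddCommGroup E] [NormedSpace ℝ E] :
    (E × (E →L[ℝ] ℝ)) →ₗ[ℝ] (E × (E →L[ℝ] ℝ)) →ₗ[ℝ] ℝ :=
  LinearMap.mk₂ ℝ (fun s t => t.2 s.1 + s.2 t.1)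
    (fun s s' t => by simp only [Prod.fst_add, Prod.snd_add, map_add, add_apply]; ring)
    (fun a s t => by
      simp only [Prod.smul_fst, Prod.smul_snd, map_smul, smul_apply, smul_eq_mul]; ring)
    (fun s t t' => by simp only [Prod.fst_add, Prod.snd_add, map_add, add_apply]; ring)
    (fun a s t => by
      simp only [Prod.smul_fst, Prod.smul_snd, map_smul, smul_apply, smul_eq_mul]; ring)

lemma dorfman_isDualFrame {ι : Type*} [Fintype ι] [DecidableEq ι]
    (hcard : Fintype.card ι = 2 * Module.finrank ℝ E) {p : N} {e ε : ι → GenSec E N}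
    (he : ∀ i, (dorfman H).Smooth (e i)) (hε : ∀ i, (dorfman H).Smooth (ε i))
    (h : ∀ᶠ y in 𝓝 p, ∀ i j, (dorfman H).pairing (e i) (ε j) y = if i = j then 1 else 0) :
    IsDualFrame (dorfman H) p e ε where
  smooth_left := he
  smooth_right := hε
  complete := by
    filter_upwards [h] with y hy s χ _ _
    have hd : Module.finrank ℝ (E × (E →L[ℝ] ℝ)) = 2 * Module.finrank ℝ E := by
      rw [Module.finrank_prod, ← (LinearMap.toContinuousLinearMap (𝕜 := ℝ) (E := E)
        (F' := ℝ)).finrank_eq, Module.finrank_linearMap, Module.finrank_self]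
      ring
    exact sum_mul_of_biorthogonal (fibrePairing E) (e := fun i => ((e i).1 y, (e i).2 y))
      (ε := fun i => ((ε i).1 y, (ε i).2 y)) (hcard.trans hd.symm) hy (s.1 y, s.2 y) (χ.1 y, χ.2 y)

/-- Coordinate vector fields and differentials of coordinates provide local frames. -/
lemma exists_dorfman_frame (p : N) :
    ∃ e ε : Fin (Module.finrank ℝ E) ⊕ Fin (Module.finrank ℝ E) → GenSec E N,
      (∀ i, (dorfman H).Smooth (e i)) ∧ (∀ i, (dorfman H).Smooth (ε i)) ∧
      ∀ᶠ y in 𝓝 p, ∀ i j, (dorfman H).pairing (e i) (ε j) y = if i = j then 1 else 0 := by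
  obtain ⟨φ, D, hD⟩ := exists_isCoord (E := E) p
  let b := Module.finBasis ℝ E
  let dx : Fin (Module.finrank ℝ E) → Π q : N, TangentSpace 𝓘(ℝ, E) q →L[ℝ] ℝ :=
    fun i q => (LinearMap.toContinuousLinearMap (b.coord i)).comp (diff φ q)
  have hdx : ∀ i, SmoothForm (dx i) := fun i => (smoothForm_diff hD.smooth_fun).clm_comp _
  refine ⟨Sum.elim (fun i => (D (b i), 0)) fun i => (0, dx i),
    Sum.elim (fun i => (0, dx i)) fun i => (D (b i), 0), ?_, ?_, ?_⟩
  · rintro (i | i)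
    · exact ⟨hD.smooth_vf _, SmoothForm.zero⟩
    · exact ⟨SmoothVF.zero, hdx i⟩
  · rintro (i | i)
    · exact ⟨SmoothVF.zero, hdx i⟩
    · exact ⟨hD.smooth_vf _, SmoothForm.zero⟩
  · filter_upwards [hD.diff_vf] with y hy
    have key : ∀ i j, dx j y (D (b i) y) = if i = j then 1 else 0 := fun i j => by
      change b.coord j (diff φ y (D (b i) y)) = _
      rw [hy]
      simp [Finsupp.single_apply]
    rintro (i | i) (j | j) <;> rw [dorfman_pairing]
    · simp [key]
    · simp
    · simp
    · simp only [Sum.elim_inr, Pi.zero_apply, zero_apply, zero_add, key, Sum.inr.injEq]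
      simp only [eq_comm]

lemma dorfman_localFrame (p : N) :
    IsDualFrame (dorfman H) p (localFrame (dorfman H) p).1 (localFrame (dorfman H) p).2 := by
  obtain ⟨e, ε, he, hε, h⟩ := exists_dorfman_frame (H := H) p
  obtain ⟨h1, h2, h3⟩ := isLocalFrame_localFrame (𝒞 := dorfman H)
    (by simp [dorfman, two_mul]) he hε h
  exact dorfman_isDualFrame (Fintype.card_fin _) h1 h2 h3

end Dorfman

/-! ### Related vector fields and partial derivatives -/

section Related

open Bundle VectorField

variable {E : Type*} [NormedAddCommGroup E] [NormedSpace ℝ E]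
  {N : Type*} [TopologicalSpace N] [ChartedSpace E N]
  {E' : Type*} [NormedAddCommGroup E'] [NormedSpace ℝ E']
  {N' : Type*} [TopologicalSpace N'] [ChartedSpace E' N']
  {V : Type*} [NormedAddCommGroup V] [NormedSpace ℝ V]

lemma diff_comp {f : N → N'} {h : N' → V} {p : N} (hh : ContMDiffAt 𝓘(ℝ, E') 𝓘(ℝ, V) ∞ h (f p))
    (hf : ContMDiffAt 𝓘(ℝ, E) 𝓘(ℝ, E') ∞ f p) (v : TangentSpace 𝓘(ℝ, E) p) :
    diff (fun q => h (f q)) p v = diff h (f p) (mfderiv 𝓘(ℝ, E) 𝓘(ℝ, E') f p v) :=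
  mfderiv_comp_apply p (hh.mdifferentiableAt (by simp)) (hf.mdifferentiableAt (by simp)) v

variable [IsManifold 𝓘(ℝ, E) ∞ N] [IsManifold 𝓘(ℝ, E') ∞ N'] [FiniteDimensional ℝ E] [T2Space N]
  [FiniteDimensional ℝ E'] [T2Space N']

/-- The Lie brackets of `f`-related vector fields are `f`-related. -/
lemma mfderiv_mlieBracket {f : N → N'} (hf : ContMDiff 𝓘(ℝ, E) 𝓘(ℝ, E') ∞ f)
    {X Y : Π q : N, TangentSpace 𝓘(ℝ, E) q} {X' Y' : Π q : N', TangentSpace 𝓘(ℝ, E') q}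
    (hX : SmoothVF X) (hY : SmoothVF Y) (hX' : SmoothVF X') (hY' : SmoothVF Y')
    (hXX' : ∀ p, mfderiv 𝓘(ℝ, E) 𝓘(ℝ, E') f p (X p) = X' (f p))
    (hYY' : ∀ p, mfderiv 𝓘(ℝ, E) 𝓘(ℝ, E') f p (Y p) = Y' (f p)) (p : N) :
    mfderiv 𝓘(ℝ, E) 𝓘(ℝ, E') f p (mlieBracket 𝓘(ℝ, E) X Y p) =
      mlieBracket 𝓘(ℝ, E') X' Y' (f p) := by
  obtain ⟨φ, D, hD⟩ := exists_isCoord (E := E') (f p)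
  have hφ := hD.smooth_fun
  have h1 := diff_mlieBracket hX hY (hφ.comp hf) p
  have h2 := diff_mlieBracket hX' hY' hφ (f p)
  have e1 : ∀ q v, diff (φ ∘ f) q v = diff φ (f q) (mfderiv 𝓘(ℝ, E) 𝓘(ℝ, E') f q v) :=
    fun q v => diff_comp (hφ _) (hf q) v
  have eY : (fun q => diff (φ ∘ f) q (Y q)) = fun q => (fun y => diff φ y (Y' y)) (f q) :=
    funext fun q => by rw [e1, hYY']
  have eX : (fun q => diff (φ ∘ f) q (X q)) = fun q => (fun y => diff φ y (X' y)) (f q) :=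
    funext fun q => by rw [e1, hXX']
  rw [e1, eX, eY, diff_comp (contMDiff_diff hφ hX' _) (hf p),
    diff_comp (contMDiff_diff hφ hY' _) (hf p), hXX', hYY', ← h2] at h1
  rwa [show ∀ v : TangentSpace 𝓘(ℝ, E') (f p), diff φ (f p) v = v from hD.diff_self,
    show ∀ v : TangentSpace 𝓘(ℝ, E') (f p), diff φ (f p) v = v from hD.diff_self] at h1

end Related

section Partial

open Bundle

variable {EA EB EC : Type*} [NormedAddCommGroup EA] [NormedSpace ℝ EA]
  [NormedAddCommGroup EB] [NormedSpace ℝ EB] [NormedAddCommGroup EC] [NormedSpace ℝ EC]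
  {A B C : Type*} [TopologicalSpace A] [ChartedSpace EA A] [TopologicalSpace B] [ChartedSpace EB B]
  [TopologicalSpace C] [ChartedSpace EC C] [IsManifold 𝓘(ℝ, EA) 1 A] [IsManifold 𝓘(ℝ, EB) 1 B]
  [IsManifold 𝓘(ℝ, EC) 1 C]
  {EQ HQ Q : Type*} [NormedAddCommGroup EQ] [NormedSpace ℝ EQ] [TopologicalSpace HQ]
  {J : ModelWithCorners ℝ EQ HQ} [TopologicalSpace Q] [ChartedSpace HQ Q]

/-- Smooth dependence of a partial derivative on the parameters, as a map to the tangent bundle. -/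
lemma contMDiffAt_partial {F : A → B → C} {a : Q → A} {b : Q → B}
    {w : Π q, TangentSpace 𝓘(ℝ, EB) (b q)} {q₀ : Q}
    (hF : ∀ᶠ q in 𝓝 q₀, ContMDiffAt (𝓘(ℝ, EA).prod 𝓘(ℝ, EB)) 𝓘(ℝ, EC) ∞
      (fun z : A × B => F z.1 z.2) (a q, b q))
    (ha : ContMDiffAt J 𝓘(ℝ, EA) ∞ a q₀)
    (hw : ContMDiffAt J 𝓘(ℝ, EB).tangent ∞ (fun q => (⟨b q, w q⟩ : TangentBundle 𝓘(ℝ, EB) B)) q₀) :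
    ContMDiffAt J 𝓘(ℝ, EC).tangent ∞
      (fun q => (⟨F (a q) (b q), mfderiv 𝓘(ℝ, EB) 𝓘(ℝ, EC) (F (a q)) (b q) (w q)⟩ :
        TangentBundle 𝓘(ℝ, EC) C)) q₀ := by
  have h1 : ContMDiffAt J 𝓘(ℝ, EA).tangent ∞
      (fun q => (⟨a q, 0⟩ : TangentBundle 𝓘(ℝ, EA) A)) q₀ :=
    (contMDiff_zeroSection ℝ (TangentSpace 𝓘(ℝ, EA) : A → Type _)).contMDiffAt.comp q₀ ha
  have h2 := (contMDiff_equivTangentBundleProd_symm (n := ∞) (I := 𝓘(ℝ, EA)) (M := A)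
    (I' := 𝓘(ℝ, EB)) (M' := B)).contMDiffAt.comp q₀ (h1.prodMk hw)
  have h3 := (contMDiffAt_tangentMap (z := (⟨(a q₀, b q₀), (0, w q₀)⟩ :
    TangentBundle (𝓘(ℝ, EA).prod 𝓘(ℝ, EB)) (A × B))) hF.self_of_nhds).comp q₀ h2
  refine h3.congr_of_eventuallyEq ?_
  filter_upwards [hF] with q hq
  let z : TangentSpace (𝓘(ℝ, EA).prod 𝓘(ℝ, EB)) (a q, b q) := ((0 : EA), (w q : EB))
  have h4 := mfderiv_prod_eq_add_apply (v := z) (hq.mdifferentiableAt (by simp))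
  have h5 := h4.trans ((congrArg (· + _) (map_zero _)).trans (zero_add _))
  exact congrArg (fun v => (⟨F (a q) (b q), v⟩ : TangentBundle 𝓘(ℝ, EC) C)) h5.symm

end Partial

section ConstBase

open Bundle

variable {E : Type*} [NormedAddCommGroup E] [NormedSpace ℝ E]
  {N : Type*} [TopologicalSpace N] [ChartedSpace E N] [IsManifold 𝓘(ℝ, E) 1 N]
  {EQ HQ Q : Type*} [NormedAddCommGroup EQ] [NormedSpace ℝ EQ] [TopologicalSpace HQ]
  {J : ModelWithCorners ℝ EQ HQ} [TopologicalSpace Q] [ChartedSpace HQ Q]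

/-- A smooth function to a fixed tangent space is smooth as a map to the tangent bundle. -/
lemma contMDiffAt_mk_const {p : N} {x : Q → E} {q₀ : Q} (hx : ContMDiffAt J 𝓘(ℝ, E) ∞ x q₀) :
    ContMDiffAt J 𝓘(ℝ, E).tangent ∞ (fun q => (⟨p, x q⟩ : TangentBundle 𝓘(ℝ, E) N)) q₀ := by
  rw [contMDiffAt_totalSpace]
  refine ⟨contMDiffAt_const, ?_⟩
  have : ∀ v : E, (trivializationAt E (TangentSpace 𝓘(ℝ, E) : N → Type _) p
      (⟨p, v⟩ : TangentBundle 𝓘(ℝ, E) N)).2 = v := fun v => by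
    have h := TangentBundle.trivializationAt_apply (I := 𝓘(ℝ, E)) p
      (⟨p, v⟩ : TangentBundle 𝓘(ℝ, E) N)
    rw [h]
    exact (tangentBundleCore 𝓘(ℝ, E) N).coordChange_self (achart E p) p (mem_chart_source E p) v
  simpa only [this] using hx

end ConstBase

/-! ### The adjoint representation and the Killing form -/

section LieAlgebraOps

variable {EG : Type*} [NormedAddCommGroup EG] [NormedSpace ℝ EG]
  (G : Type*) [TopologicalSpace G] [ChartedSpace EG G] [Group G]
  [LieGroup 𝓘(ℝ, EG) ∞ G] [FiniteDimensional ℝ EG] [CompleteSpace EG]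

lemma adj_add_left (x y z : EG) : adj G (x + y) z = adj G x z + adj G y z :=
  add_lie (L := GroupLieAlgebra 𝓘(ℝ, EG) G) (M := GroupLieAlgebra 𝓘(ℝ, EG) G) x y z

lemma adj_smul_left (a : ℝ) (x y : EG) : adj G (a • x) y = a • adj G x y :=
  smul_lie (L := GroupLieAlgebra 𝓘(ℝ, EG) G) (M := GroupLieAlgebra 𝓘(ℝ, EG) G) a x y

lemma adj_swap (x y : EG) : adj G y x = -adj G x y :=
  (lie_skew (L := GroupLieAlgebra 𝓘(ℝ, EG) G) y x).symm

lemma adj_adj (x y z : EG) : adj G x (adj G y z) = adj G (adj G x y) z + adj G y (adj G x z) :=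
  leibniz_lie (M := GroupLieAlgebra 𝓘(ℝ, EG) G)
    (show GroupLieAlgebra 𝓘(ℝ, EG) G from x) (show GroupLieAlgebra 𝓘(ℝ, EG) G from y) z

/-- The Lie bracket as a continuous bilinear map. -/
def adjL : EG →L[ℝ] EG →L[ℝ] EG :=
  LinearMap.toContinuousLinearMap
    { toFun := adj G
      map_add' := fun x y => by ext z; exact adj_add_left G x y z
      map_smul' := fun a x => by ext z; exact adj_smul_left G a x z }

lemma killing_add (x y z : EG) : killing G (x + y) z = killing G x z + killing G y z :=
  LinearMap.congr_fun (map_add (killingForm ℝ (GroupLieAlgebra 𝓘(ℝ, EG) G)) x y) z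

lemma killing_smul (a : ℝ) (x y : EG) : killing G (a • x) y = a * killing G x y :=
  LinearMap.congr_fun (map_smul (killingForm ℝ (GroupLieAlgebra 𝓘(ℝ, EG) G)) a x) y

lemma killing_comm (x y : EG) : killing G x y = killing G y x :=
  LieModule.traceForm_comm ℝ (GroupLieAlgebra 𝓘(ℝ, EG) G) (GroupLieAlgebra 𝓘(ℝ, EG) G) x y

/-- The Killing form as a continuous bilinear map. -/
def killingL : EG →L[ℝ] EG →L[ℝ] ℝ :=
  LinearMap.toContinuousLinearMap
    { toFun := killing G
      map_add' := fun x y => by ext z; exact killing_add G x y z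
      map_smul' := fun a x => by ext z; exact killing_smul G a x z }

lemma killing_adj (x y z : EG) : killing G (adj G x y) z = killing G x (adj G y z) :=
  LieModule.traceForm_apply_lie_apply ℝ (GroupLieAlgebra 𝓘(ℝ, EG) G)
    (GroupLieAlgebra 𝓘(ℝ, EG) G) x y z

lemma killing_eq_trace (x y : EG) : killing G x y =
    LinearMap.trace ℝ EG ((adj G x : EG →ₗ[ℝ] EG) ∘ₗ (adj G y : EG →ₗ[ℝ] EG)) :=
  LieModule.traceForm_apply_apply ℝ (GroupLieAlgebra 𝓘(ℝ, EG) G)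
    (GroupLieAlgebra 𝓘(ℝ, EG) G) x y

end LieAlgebraOps

section Adjoint

variable {EG : Type*} [NormedAddCommGroup EG] [NormedSpace ℝ EG]
  {G : Type*} [TopologicalSpace G] [ChartedSpace EG G] [Group G] [LieGroup 𝓘(ℝ, EG) ∞ G]

instance LieGroup.instIsManifoldTop : IsManifold 𝓘(ℝ, EG) ∞ G := LieGroup.toContMDiffMul.toIsManifold

lemma contMDiff_conj (g : G) :
    ContMDiff 𝓘(ℝ, EG) 𝓘(ℝ, EG) ∞ (fun h : G => g * h * g⁻¹) :=
  (contMDiff_const.mul contMDiff_id).mul contMDiff_const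

/-- The adjoint action as a continuous linear map. -/
def AdL (g : G) : EG →L[ℝ] EG := mfderiv 𝓘(ℝ, EG) 𝓘(ℝ, EG) (fun h : G => g * h * g⁻¹) 1

lemma Ad_one (x : EG) : Ad (1 : G) x = x := by
  have : (fun h : G => 1 * h * (1 : G)⁻¹) = id := by ext; simp
  rw [Ad, this, mfderiv_id]
  rfl

lemma Ad_mul (g h : G) (x : EG) : Ad (g * h) x = Ad g (Ad h x) := by
  have : (fun k : G => g * h * k * (g * h)⁻¹) =
      (fun k : G => g * k * g⁻¹) ∘ fun k : G => h * k * h⁻¹ := by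
    ext k; simp [mul_assoc]
  have h2 := mfderiv_comp_apply_of_eq (I := 𝓘(ℝ, EG)) (I' := 𝓘(ℝ, EG)) (I'' := 𝓘(ℝ, EG))
    (x := (1 : G)) (y := (1 : G)) (((contMDiff_conj g) 1).mdifferentiableAt (by simp))
    (((contMDiff_conj h) 1).mdifferentiableAt (by simp)) (by simp) x
  rw [← this] at h2
  exact h2

lemma Ad_add (g : G) (x y : EG) : Ad g (x + y) = Ad g x + Ad g y := map_add (AdL g) x y

lemma Ad_smul (g : G) (a : ℝ) (x : EG) : Ad g (a • x) = a • Ad g x := map_smul (AdL g) a x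

lemma Ad_inv_Ad (g : G) (x : EG) : Ad g⁻¹ (Ad g x) = x := by
  rw [← Ad_mul, inv_mul_cancel, Ad_one]

lemma Ad_Ad_inv (g : G) (x : EG) : Ad g (Ad g⁻¹ x) = x := by
  rw [← Ad_mul, mul_inv_cancel, Ad_one]

lemma smoothVF_mulInvariant (x : EG) :
    SmoothVF (mulInvariantVectorField (I := 𝓘(ℝ, EG)) (G := G) x) := fun g =>
  ((contMDiffAt_partial (F := fun a b : G => a * b) (a := fun g => g) (b := fun _ => (1 : G))
    (w := fun _ => x) (Filter.Eventually.of_forall fun _ => (contMDiff_mul 𝓘(ℝ, EG) ∞).contMDiffAt)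
    contMDiffAt_id contMDiffAt_const).congr_of_eventuallyEq
      (Filter.Eventually.of_forall fun g => by
        simp only [mulInvariantVectorField]
        congr 1
        exact (mul_one g).symm))

open VectorField

/-- The right invariant vector field with value `y` at `1`. -/
def rightInvariantVectorField (y : EG) (g : G) : TangentSpace 𝓘(ℝ, EG) g :=
  (mfderiv 𝓘(ℝ, EG) 𝓘(ℝ, EG) (fun h : G => h * g) 1 : EG →L[ℝ] EG) y

lemma smoothVF_rightInvariant (y : EG) :
    SmoothVF (rightInvariantVectorField (G := G) y) := fun g =>
  ((contMDiffAt_partial (F := fun a b : G => b * a) (a := fun g => g) (b := fun _ => (1 : G))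
    (w := fun _ => y) (Filter.Eventually.of_forall fun _ => by
      exact (contMDiff_snd.mul contMDiff_fst).contMDiffAt)
    contMDiffAt_id contMDiffAt_const).congr_of_eventuallyEq
      (Filter.Eventually.of_forall fun g => by
        simp only [rightInvariantVectorField]
        congr 1
        exact (one_mul g).symm))

lemma mfderiv_mul_left_mulInvariant (x : EG) (g h : G) :
    (mfderiv 𝓘(ℝ, EG) 𝓘(ℝ, EG) (fun k : G => g * k) h
      (mulInvariantVectorField (I := 𝓘(ℝ, EG)) x h) : EG) =
      mulInvariantVectorField (I := 𝓘(ℝ, EG)) x (g * h) := by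
  have h1 : (fun k : G => g * h * k) = (fun k => g * k) ∘ fun k => h * k := by
    ext k; simp [mul_assoc]
  have h2 := mfderiv_comp_apply_of_eq (I := 𝓘(ℝ, EG)) (I' := 𝓘(ℝ, EG)) (I'' := 𝓘(ℝ, EG))
    (x := (1 : G)) (y := h) (g := fun k => g * k) (f := fun k => h * k)
    ((contMDiff_mul_left (I := 𝓘(ℝ, EG)) (n := ∞) h).mdifferentiableAt (by simp))
    ((contMDiff_mul_left (I := 𝓘(ℝ, EG)) (n := ∞) 1).mdifferentiableAt (by simp)) (mul_one h) x
  rw [← h1] at h2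
  exact h2.symm

lemma mfderiv_mul_right_rightInvariant (y : EG) (g h : G) :
    (mfderiv 𝓘(ℝ, EG) 𝓘(ℝ, EG) (fun k : G => k * h) g (rightInvariantVectorField y g) : EG) =
      rightInvariantVectorField y (g * h) := by
  have h1 : (fun k : G => k * (g * h)) = (fun k => k * h) ∘ fun k => k * g := by
    ext k; simp [mul_assoc]
  have h2 := mfderiv_comp_apply_of_eq (I := 𝓘(ℝ, EG)) (I' := 𝓘(ℝ, EG)) (I'' := 𝓘(ℝ, EG))
    (x := (1 : G)) (y := g) (g := fun k => k * h) (f := fun k => k * g)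
    ((contMDiff_mul_right (I := 𝓘(ℝ, EG)) (n := ∞) g).mdifferentiableAt (by simp))
    ((contMDiff_mul_right (I := 𝓘(ℝ, EG)) (n := ∞) 1).mdifferentiableAt (by simp)) (one_mul g) y
  rw [← h1] at h2
  exact h2.symm

/-- A version of `mfderiv_mlieBracket` for models which are only propositionally trivial, such as
products of trivial models. -/
lemma mfderiv_mlieBracket_of_eq {E N E' N' : Type*} [NormedAddCommGroup E] [NormedSpace ℝ E]
    [TopologicalSpace N] [ChartedSpace E N] [NormedAddCommGroup E'] [NormedSpace ℝ E']
    [TopologicalSpace N'] [ChartedSpace E' N'] {I : ModelWithCorners ℝ E E} (hI : I = 𝓘(ℝ, E))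
    [IsManifold I ∞ N] [IsManifold 𝓘(ℝ, E') ∞ N'] [FiniteDimensional ℝ E] [T2Space N]
    [FiniteDimensional ℝ E'] [T2Space N'] [IsManifold I 1 N]
    {f : N → N'} (hf : ContMDiff I 𝓘(ℝ, E') ∞ f)
    {X Y : Π q : N, TangentSpace I q} {X' Y' : Π q : N', TangentSpace 𝓘(ℝ, E') q}
    (hX : ContMDiff I I.tangent ∞ (fun q => (⟨q, X q⟩ : TangentBundle I N)))
    (hY : ContMDiff I I.tangent ∞ (fun q => (⟨q, Y q⟩ : TangentBundle I N)))
    (hX' : SmoothVF X') (hY' : SmoothVF Y')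
    (hXX' : ∀ p, mfderiv I 𝓘(ℝ, E') f p (X p) = X' (f p))
    (hYY' : ∀ p, mfderiv I 𝓘(ℝ, E') f p (Y p) = Y' (f p)) (p : N) :
    mfderiv I 𝓘(ℝ, E') f p (mlieBracket I X Y p) = mlieBracket 𝓘(ℝ, E') X' Y' (f p) := by
  subst hI
  exact mfderiv_mlieBracket hf hX hY hX' hY' hXX' hYY' p

variable [FiniteDimensional ℝ EG] [T2Space G]

/-- Left and right invariant vector fields commute: they are related, by the multiplication map, to
the vector fields `(0, X)` and `(Y, 0)` on `G × G`, whose bracket is killed by both projections. -/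
lemma mlieBracket_left_right (x y : EG) (g : G) :
    mlieBracket 𝓘(ℝ, EG) (mulInvariantVectorField (I := 𝓘(ℝ, EG)) x)
      (rightInvariantVectorField y) g = 0 := by
  let J : ModelWithCorners ℝ (EG × EG) (EG × EG) := 𝓘(ℝ, EG).prod 𝓘(ℝ, EG)
  let _ : ChartedSpace (EG × EG) (G × G) :=
    inferInstanceAs (ChartedSpace (ModelProd EG EG) (G × G))
  have : IsManifold J ∞ (G × G) := inferInstanceAs (IsManifold (𝓘(ℝ, EG).prod 𝓘(ℝ, EG)) ∞ (G × G))
  have : IsManifold J 1 (G × G) := IsManifold.of_le (n := ∞) (by norm_num)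
  let X : Π z : G × G, TangentSpace J z :=
    fun z => ((0 : EG), (mulInvariantVectorField (I := 𝓘(ℝ, EG)) x z.2 : EG))
  let Y : Π z : G × G, TangentSpace J z :=
    fun z => ((rightInvariantVectorField y z.1 : EG), (0 : EG))
  have hs := contMDiff_equivTangentBundleProd_symm (n := ∞) (I := 𝓘(ℝ, EG)) (M := G)
    (I' := 𝓘(ℝ, EG)) (M' := G)
  have h0 : SmoothVF (0 : Π q : G, TangentSpace 𝓘(ℝ, EG) q) := SmoothVF.zero
  have hX : ContMDiff J J.tangent ∞ (fun z => (⟨z, X z⟩ : TangentBundle J (G × G))) :=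
    hs.comp ((h0.comp contMDiff_fst).prodMk ((smoothVF_mulInvariant x).comp contMDiff_snd))
  have hY : ContMDiff J J.tangent ∞ (fun z => (⟨z, Y z⟩ : TangentBundle J (G × G))) :=
    hs.comp (((smoothVF_rightInvariant y).comp contMDiff_fst).prodMk (h0.comp contMDiff_snd))
  have hJ : J = 𝓘(ℝ, EG × EG) := modelWithCornersSelf_prod.symm
  have hf1 : ∀ z : G × G, ∀ v, mfderiv J 𝓘(ℝ, EG) Prod.fst z v = v.1 := fun z v => by
    rw [mfderiv_fst]; rfl
  have hf2 : ∀ z : G × G, ∀ v, mfderiv J 𝓘(ℝ, EG) Prod.snd z v = v.2 := fun z v => by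
    rw [mfderiv_snd]; rfl
  have b1 := mfderiv_mlieBracket_of_eq (E := EG × EG) (N := G × G) hJ (f := Prod.fst)
    contMDiff_fst hX hY h0 (smoothVF_rightInvariant y) (fun z => hf1 z _) (fun z => hf1 z _) (g, 1)
  have b2 := mfderiv_mlieBracket_of_eq (E := EG × EG) (N := G × G) hJ (f := Prod.snd)
    contMDiff_snd hX hY (smoothVF_mulInvariant x) h0 (fun z => hf2 z _) (fun z => hf2 z _) (g, 1)
  have hm : ContMDiff J 𝓘(ℝ, EG) ∞ (fun z : G × G => z.1 * z.2) := contMDiff_mul 𝓘(ℝ, EG) ∞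
  have hmd : ∀ (z : G × G) (v : TangentSpace J z),
      mfderiv J 𝓘(ℝ, EG) (fun z : G × G => z.1 * z.2) z v =
      mfderiv 𝓘(ℝ, EG) 𝓘(ℝ, EG) (fun k => k * z.2) z.1 v.1 +
        mfderiv 𝓘(ℝ, EG) 𝓘(ℝ, EG) (fun k => z.1 * k) z.2 v.2 := fun z v =>
    mfderiv_prod_eq_add_apply ((hm z).mdifferentiableAt (by simp))
  have b3 := mfderiv_mlieBracket_of_eq (E := EG × EG) (N := G × G) hJ
    (f := fun z : G × G => z.1 * z.2) hm hX hY (smoothVF_mulInvariant x) (smoothVF_rightInvariant y)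
    (fun z => (hmd z _).trans ((congrArg (· + _) (map_zero _)).trans
      ((zero_add _).trans (mfderiv_mul_left_mulInvariant x z.1 z.2))))
    (fun z => (hmd z _).trans ((congrArg (_ + ·) (map_zero _)).trans
      ((add_zero _).trans (mfderiv_mul_right_rightInvariant y z.1 z.2)))) (g, 1)
  rw [hf1] at b1
  rw [hf2] at b2
  rw [mlieBracket_zero_left] at b1
  rw [mlieBracket_zero_right] at b2
  have b4 := (hmd (g, 1) (mlieBracket J X Y (g, 1))).symm.trans b3
  have b5 : mlieBracket 𝓘(ℝ, EG) (mulInvariantVectorField (I := 𝓘(ℝ, EG)) x)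
      (rightInvariantVectorField y) (g * 1) = 0 :=
    b4.symm.trans ((congrArg₂ (· + ·) ((congrArg _ b1).trans (map_zero _))
      ((congrArg _ b2).trans (map_zero _))).trans (add_zero _))
  rwa [mul_one] at b5

lemma contMDiffAt_Ad {EQ HQ Q : Type*} [NormedAddCommGroup EQ] [NormedSpace ℝ EQ]
    [TopologicalSpace HQ] {J : ModelWithCorners ℝ EQ HQ} [TopologicalSpace Q] [ChartedSpace HQ Q]
    {g : Q → G} {x : Q → EG} {q₀ : Q} (hg : ContMDiffAt J 𝓘(ℝ, EG) ∞ g q₀)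
    (hx : ContMDiffAt J 𝓘(ℝ, EG) ∞ x q₀) :
    ContMDiffAt J 𝓘(ℝ, EG) ∞ (fun q => Ad (g q) (x q)) q₀ := by
  -- Partial derivatives are smooth as maps to the tangent bundle; the differential of a coordinate
  -- function, which is the identity at `1`, turns this into smoothness of a map to the model space.
  obtain ⟨φ, D, hD⟩ := exists_isCoord (E := EG) (1 : G)
  have h1 := contMDiffAt_partial (F := fun a b : G => a * b * a⁻¹) (a := g) (b := fun _ => (1 : G))
    (w := x) (J := J) (q₀ := q₀) (Filter.Eventually.of_forall fun _ => by
      exact ((contMDiff_fst.mul contMDiff_snd).mul contMDiff_fst.inv).contMDiffAt) hg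
    (contMDiffAt_mk_const hx)
  have h2 := ((contMDiff_snd_tangentBundle_modelSpace EG 𝓘(ℝ, EG)).contMDiffAt.comp q₀
    ((contMDiffAt_tangentMap (hD.smooth_fun _)).comp q₀ h1))
  refine h2.congr_of_eventuallyEq (Filter.Eventually.of_forall fun q => ?_)
  have h3 : ∀ (k : G) (hk : k = 1) (v : EG), (mfderiv 𝓘(ℝ, EG) 𝓘(ℝ, EG) φ k v : EG) = v := by
    rintro k rfl v
    exact hD.diff_self v
  exact (h3 _ (by simp) _).symm

lemma contMDiff_Ad {EQ HQ Q : Type*} [NormedAddCommGroup EQ] [NormedSpace ℝ EQ]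
    [TopologicalSpace HQ] {J : ModelWithCorners ℝ EQ HQ} [TopologicalSpace Q] [ChartedSpace HQ Q]
    {g : Q → G} {x : Q → EG} (hg : ContMDiff J 𝓘(ℝ, EG) ∞ g) (hx : ContMDiff J 𝓘(ℝ, EG) ∞ x) :
    ContMDiff J 𝓘(ℝ, EG) ∞ (fun q => Ad (g q) (x q)) :=
  fun q => contMDiffAt_Ad (hg q) (hx q)

lemma mulInvariantVectorField_eq_rightInvariant (y : EG) (g : G) :
    mulInvariantVectorField (I := 𝓘(ℝ, EG)) y g = rightInvariantVectorField (Ad g y) g := by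
  have h1 : (fun h : G => g * h) = (fun k => k * g) ∘ fun h => g * h * g⁻¹ := by
    ext k; simp
  have h2 := mfderiv_comp_apply_of_eq (I := 𝓘(ℝ, EG)) (I' := 𝓘(ℝ, EG)) (I'' := 𝓘(ℝ, EG))
    (x := (1 : G)) (y := 1) (g := fun k => k * g) (f := fun h => g * h * g⁻¹)
    ((contMDiff_mul_right (I := 𝓘(ℝ, EG)) (n := ∞) (a := g)).mdifferentiableAt (by simp))
    ((contMDiff_conj g).mdifferentiableAt (by simp)) (by simp) y
  rw [← h1] at h2
  exact h2

lemma rightInvariantVectorField_one (y : EG) :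
    rightInvariantVectorField (G := G) y 1 = y := by
  have : (fun h : G => h * 1) = id := by ext; simp
  rw [rightInvariantVectorField, this, mfderiv_id]
  rfl

lemma mulInvariantVectorField_one (y : EG) :
    mulInvariantVectorField (I := 𝓘(ℝ, EG)) (G := G) y 1 = y := by
  have : (fun h : G => 1 * h) = id := by ext; simp
  change (mfderiv 𝓘(ℝ, EG) 𝓘(ℝ, EG) (fun h : G => 1 * h) 1 : EG →L[ℝ] EG) y = y
  rw [this, mfderiv_id]
  rfl

lemma mlieBracket_sum_fsmul {E N : Type*} [NormedAddCommGroup E] [NormedSpace ℝ E]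
    [TopologicalSpace N] [ChartedSpace E N] [IsManifold 𝓘(ℝ, E) ∞ N] [FiniteDimensional ℝ E]
    {ι : Type*} (s : Finset ι) {X : Π q : N, TangentSpace 𝓘(ℝ, E) q} {f : ι → N → ℝ}
    {Y : ι → Π q : N, TangentSpace 𝓘(ℝ, E) q} (hf : ∀ i, ContMDiff 𝓘(ℝ, E) 𝓘(ℝ, ℝ) ∞ (f i))
    (hY : ∀ i, SmoothVF (Y i)) (p : N) :
    SmoothVF (∑ i ∈ s, fun q => f i q • Y i q) ∧
    mlieBracket 𝓘(ℝ, E) X (∑ i ∈ s, fun q => f i q • Y i q) p =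
      ∑ i ∈ s, ((diff (f i) p (X p) : ℝ) • Y i p + f i p • mlieBracket 𝓘(ℝ, E) X (Y i) p) := by
  classical
  have : CompleteSpace E := FiniteDimensional.complete ℝ E
  induction s using Finset.induction_on with
  | empty => exact ⟨SmoothVF.zero, by simp⟩
  | insert a s ha ih =>
    have h1 : SmoothVF (fun q => f a q • Y a q) := SmoothVF.smul (hf a) (hY a)
    rw [Finset.sum_insert ha, Finset.sum_insert ha]
    refine ⟨h1.add ih.1, ?_⟩
    rw [mlieBracket_add_right (h1.mdifferentiableAt p) (ih.1.mdifferentiableAt p), ih.2,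
      mlieBracket_fsmul (hf a) (hY a)]

variable [CompleteSpace EG]

lemma rightInvariantVectorField_basis {ι : Type*} [Fintype ι] (b : Module.Basis ι ℝ EG) (y : EG)
    (g : G) : rightInvariantVectorField y g =
      ∑ i, b.repr y i • rightInvariantVectorField (b i) g := by
  let L : EG →L[ℝ] EG := mfderiv 𝓘(ℝ, EG) 𝓘(ℝ, EG) (fun h : G => h * g) 1
  have h : L y = ∑ i, b.repr y i • L (b i) := by
    conv_lhs => rw [← b.sum_repr y, map_sum]
    simp only [map_smul]
  exact h

/-- The differential of the adjoint representation of the group is the adjoint representation of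
the Lie algebra.  Expand the left invariant field of `y` in right invariant fields, with coefficients
the coordinates of `Ad g y`; since left and right invariant fields commute, its bracket with the left
invariant field of `x` only differentiates the coefficients. -/
lemma diff_Ad (x y : EG) : diff (E := EG) (fun g : G => Ad g y) 1 x = adj G x y := by
  set b := Module.finBasis ℝ EG
  have hAd : ContMDiff 𝓘(ℝ, EG) 𝓘(ℝ, EG) ∞ (fun g : G => Ad g y) :=
    contMDiff_Ad contMDiff_id contMDiff_const
  let c : Fin (Module.finrank ℝ EG) → EG →L[ℝ] ℝ := fun i =>
    LinearMap.toContinuousLinearMap (b.coord i)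
  have hc : ∀ i, ContMDiff 𝓘(ℝ, EG) 𝓘(ℝ, ℝ) ∞ (fun g : G => c i (Ad g y)) := fun i =>
    (c i).contMDiff.comp hAd
  have h1 : mulInvariantVectorField (I := 𝓘(ℝ, EG)) (G := G) y =
      ∑ i, fun g => c i (Ad g y) • rightInvariantVectorField (b i) g := by
    ext g
    rw [Finset.sum_apply, mulInvariantVectorField_eq_rightInvariant,
      rightInvariantVectorField_basis b]
    rfl
  have h2 := (mlieBracket_sum_fsmul (X := mulInvariantVectorField (I := 𝓘(ℝ, EG)) (G := G) x)
    Finset.univ hc (fun i => smoothVF_rightInvariant (G := G) (b i)) 1).2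
  rw [← h1] at h2
  have h3 : adj G x y = ∑ i, (c i (diff (E := EG) (fun g : G => Ad g y) 1 x)) • b i := by
    refine Eq.trans h2 (Finset.sum_congr rfl fun i _ => ?_)
    refine (congrArg₂ (· + ·) (congrArg₂ (· • ·) ?_ (rightInvariantVectorField_one (b i)))
      ((congrArg (_ • ·) (mlieBracket_left_right x (b i) 1)).trans (smul_zero _))).trans
      (add_zero _)
    exact (diff_clm_comp (c i) (hAd 1) _).trans (congrArg (fun v => c i (diff (E := EG) (fun g : G => Ad g y) 1 v))
      (mulInvariantVectorField_one x))
  rw [h3]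
  exact (b.sum_repr _).symm

/-- The adjoint action is by automorphisms of the Lie algebra. -/
lemma Ad_adj (g : G) (x y : EG) : Ad g (adj G x y) = adj G (Ad g x) (Ad g y) := by
  have h1 : ∀ (z : EG) (h : G), mfderiv 𝓘(ℝ, EG) 𝓘(ℝ, EG) (fun k : G => g * k * g⁻¹) h
      (mulInvariantVectorField (I := 𝓘(ℝ, EG)) z h) =
      mulInvariantVectorField (I := 𝓘(ℝ, EG)) (Ad g z : EG) (g * h * g⁻¹) := by
    intro z h
    have e1 := mfderiv_comp_apply_of_eq (I := 𝓘(ℝ, EG)) (I' := 𝓘(ℝ, EG)) (I'' := 𝓘(ℝ, EG))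
      (x := (1 : G)) (y := h) (g := fun k => g * k * g⁻¹) (f := fun k => h * k)
      ((contMDiff_conj g).mdifferentiableAt (by simp))
      ((contMDiff_mul_left (I := 𝓘(ℝ, EG)) (n := ∞) (a := h)).mdifferentiableAt (by simp))
      (mul_one h) z
    have e2 := mfderiv_comp_apply_of_eq (I := 𝓘(ℝ, EG)) (I' := 𝓘(ℝ, EG)) (I'' := 𝓘(ℝ, EG))
      (x := (1 : G)) (y := 1) (g := fun k => g * h * g⁻¹ * k) (f := fun k => g * k * g⁻¹)
      ((contMDiff_mul_left (I := 𝓘(ℝ, EG)) (n := ∞) (a := g * h * g⁻¹)).mdifferentiableAt (by simp))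
      ((contMDiff_conj g).mdifferentiableAt (by simp)) (by simp) z
    have e3 : (fun k => g * k * g⁻¹) ∘ (fun k => h * k) =
        (fun k => g * h * g⁻¹ * k) ∘ fun k => g * k * g⁻¹ := by
      ext k; simp [mul_assoc]
    rw [e3] at e1
    exact e1.symm.trans e2
  have h2 := mfderiv_mlieBracket (contMDiff_conj g) (smoothVF_mulInvariant x)
    (smoothVF_mulInvariant y) (smoothVF_mulInvariant (Ad g x : EG))
    (smoothVF_mulInvariant (Ad g y : EG))
    (h1 x) (h1 y) 1
  have h3 : ∀ k : G, k = 1 → (mlieBracket 𝓘(ℝ, EG)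
      (mulInvariantVectorField (I := 𝓘(ℝ, EG)) (G := G) (Ad g x : EG))
      (mulInvariantVectorField (I := 𝓘(ℝ, EG)) (Ad g y : EG)) k : EG) = adj G (Ad g x) (Ad g y) := by
    rintro k rfl
    rfl
  exact h2.trans (h3 _ (by simp))

/-- The Killing form is invariant under the adjoint action. -/
lemma killing_Ad (g : G) (x y : EG) : killing G (Ad g x) (Ad g y) = killing G x y := by
  let e : EG ≃ₗ[ℝ] EG := LinearEquiv.ofLinearMap (AdL g).toLinearMap (AdL g⁻¹).toLinearMap
    (LinearMap.ext fun z => Ad_Ad_inv g z) (LinearMap.ext fun z => Ad_inv_Ad g z)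
  have h : ∀ z, (adj G (Ad g z)).toLinearMap = e.conj (adj G z).toLinearMap := by
    intro z
    refine LinearMap.ext fun w => ?_
    have : adj G (Ad g z) w = Ad g (adj G z (Ad g⁻¹ w)) := by rw [Ad_adj, Ad_Ad_inv]
    exact this
  rw [killing_eq_trace, killing_eq_trace, h, h, ← LinearEquiv.conj_comp, LinearMap.trace_conj']

end Adjoint

/-! ### Negative definiteness of the Killing form -/

section SkewTrace

variable {V : Type*} [AddCommGroup V] [Module ℝ V] [FiniteDimensional ℝ V]

/-- The square of a nonzero endomorphism which is skew for a positive definite form has negative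
trace. -/
lemma trace_comp_self_neg_of_skew (Q : LinearMap.BilinForm ℝ V) (hsymm : ∀ x y, Q x y = Q y x)
    (hpos : ∀ x, x ≠ 0 → 0 < Q x x) (T : V →ₗ[ℝ] V) (hT : ∀ x y, Q (T x) y = -Q x (T y))
    (h0 : T ≠ 0) : LinearMap.trace ℝ V (T ∘ₗ T) < 0 := by
  obtain ⟨v, hv⟩ := LinearMap.BilinForm.exists_orthogonal_basis (B := Q) ⟨fun x y => hsymm x y⟩
  have hvp : ∀ i, 0 < Q (v i) (v i) := fun i => hpos _ (v.ne_zero i)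
  have hrepr : ∀ x i, v.repr x i = Q x (v i) / Q (v i) (v i) := by
    intro x i
    rw [eq_div_iff (hvp i).ne']
    conv_rhs => rw [← v.sum_repr x]
    rw [map_sum, LinearMap.sum_apply, Finset.sum_eq_single i]
    · simp
    · intro j _ hj
      have : Q (v j) (v i) = 0 := hv hj
      simp [this]
    · simp
  have htr : LinearMap.trace ℝ V (T ∘ₗ T) = ∑ i, -(Q (T (v i)) (T (v i)) / Q (v i) (v i)) := by
    rw [LinearMap.trace_eq_matrix_trace ℝ v, Matrix.trace]
    refine Finset.sum_congr rfl fun i _ => ?_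
    rw [Matrix.diag_apply, LinearMap.toMatrix_apply, hrepr, LinearMap.comp_apply, hT, neg_div]
  have hnn : ∀ x, 0 ≤ Q x x := fun x => by
    rcases eq_or_ne x 0 with rfl | hx
    · simp
    · exact (hpos x hx).le
  obtain ⟨i, hi⟩ : ∃ i, T (v i) ≠ 0 := by
    by_contra! h
    exact h0 (v.ext fun i => by simp [h i])
  rw [htr, Finset.sum_neg_distrib, neg_lt_zero]
  exact Finset.sum_pos' (fun j _ => div_nonneg (hnn _) (hvp j).le)
    ⟨i, Finset.mem_univ i, div_pos (hpos _ hi) (hvp i)⟩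

end SkewTrace

section Compact

variable {EG : Type*} [NormedAddCommGroup EG] [NormedSpace ℝ EG]
  {G : Type*} [TopologicalSpace G] [ChartedSpace EG G] [Group G] [LieGroup 𝓘(ℝ, EG) ∞ G]
  [FiniteDimensional ℝ EG] [T2Space G] [CompactSpace G]

open MeasureTheory

variable (EG G) in
/-- Averaging over a compact group gives an inner product invariant under the adjoint action. -/
lemma exists_Ad_invariant_form : ∃ Q : LinearMap.BilinForm ℝ EG, (∀ x y, Q x y = Q y x) ∧
    (∀ x, x ≠ 0 → 0 < Q x x) ∧ ∀ (g : G) x y, Q (Ad g x) (Ad g y) = Q x y := by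
  have : IsTopologicalGroup G := topologicalGroup_of_lieGroup 𝓘(ℝ, EG) ∞
  let _ : MeasurableSpace G := borel G
  have : BorelSpace G := ⟨rfl⟩
  let μ : Measure G := Measure.haar
  let b := Module.finBasis ℝ EG
  let c : Fin (Module.finrank ℝ EG) → EG →L[ℝ] ℝ := fun i =>
    LinearMap.toContinuousLinearMap (b.coord i)
  let B : EG → EG → ℝ := fun x y => ∑ i, c i x * c i y
  have hcont : ∀ x, Continuous (fun g : G => Ad g⁻¹ x) := fun x =>
    (contMDiff_Ad (EG := EG) (J := 𝓘(ℝ, EG)) (contMDiff_inv 𝓘(ℝ, EG) ∞)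
      (contMDiff_const (c := x))).continuous
  have hBc : ∀ x y, Continuous (fun g : G => B (Ad g⁻¹ x) (Ad g⁻¹ y)) := fun x y =>
    continuous_finsetSum _ fun i _ => ((c i).continuous.comp (hcont x)).mul
      ((c i).continuous.comp (hcont y))
  have hint : ∀ x y, Integrable (fun g : G => B (Ad g⁻¹ x) (Ad g⁻¹ y)) μ := fun x y =>
    (hBc x y).integrable_of_hasCompactSupport (HasCompactSupport.of_compactSpace _)
  have hsymm : ∀ x y, B x y = B y x := fun x y => Finset.sum_congr rfl fun i _ => mul_comm _ _
  have hadd : ∀ x y z, B (x + y) z = B x z + B y z := fun x y z => by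
    simp only [B, map_add, add_mul, Finset.sum_add_distrib]
  have hsmul : ∀ (a : ℝ) x z, B (a • x) z = a * B x z := fun a x z => by
    simp only [B, map_smul, smul_eq_mul, mul_assoc, Finset.mul_sum]
  have hnn : ∀ x, 0 ≤ B x x := fun x => Finset.sum_nonneg fun i _ => mul_self_nonneg _
  have hz : ∀ x, B x x = 0 → x = 0 := fun x hx => by
    have := (Finset.sum_eq_zero_iff_of_nonneg fun i _ => mul_self_nonneg (c i x)).1 hx
    exact b.ext_elem fun i => by
      rw [map_zero]
      exact mul_self_eq_zero.1 (this i (Finset.mem_univ i))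
  refine ⟨LinearMap.mk₂ ℝ (fun x y => ∫ g, B (Ad g⁻¹ x) (Ad g⁻¹ y) ∂μ) ?_ ?_ ?_ ?_, ?_, ?_, ?_⟩
  · intro x y z
    rw [← integral_add (hint _ _) (hint _ _)]
    simp only [Ad_add, hadd]
  · intro a x z
    rw [smul_eq_mul, ← integral_const_mul]
    simp only [Ad_smul, hsmul]
  · intro x y z
    rw [← integral_add (hint _ _) (hint _ _)]
    simp only [Ad_add, hadd, hsymm (Ad _ x)]
  · intro a x z
    rw [smul_eq_mul, ← integral_const_mul]
    simp only [Ad_smul, hsmul, hsymm (Ad _ x)]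
  · intro x y
    simp only [LinearMap.mk₂_apply, hsymm (Ad _ x)]
  · intro x hx
    rw [LinearMap.mk₂_apply]
    refine (hBc x x).integral_pos_of_hasCompactSupport_nonneg_nonzero
      (HasCompactSupport.of_compactSpace _) (fun g => hnn _) (x := 1) fun h => hx ?_
    rw [← Ad_one (G := G) x, ← inv_one]
    exact hz _ h
  · intro h x y
    simp only [LinearMap.mk₂_apply]
    rw [← integral_mul_left_eq_self (fun g => B (Ad g⁻¹ (Ad h x)) (Ad g⁻¹ (Ad h y))) h]
    simp only [mul_inv_rev, ← Ad_mul, inv_mul_cancel_right]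

variable [CompleteSpace EG]

/-- The Killing form of a compact semisimple Lie group is negative definite: `ad x` is skew for an
invariant inner product, and nonzero since the center is trivial. -/
lemma killing_self_neg [LieAlgebra.IsSemisimple ℝ (GroupLieAlgebra 𝓘(ℝ, EG) G)] {x : EG}
    (hx : x ≠ 0) : killing G x x < 0 := by
  obtain ⟨Q, hsymm, hpos, hinv⟩ := exists_Ad_invariant_form EG G
  rw [killing_eq_trace]
  refine trace_comp_self_neg_of_skew Q hsymm hpos _ (fun y z => ?_) fun h => hx ?_
  · let Qc : EG →L[ℝ] EG →L[ℝ] ℝ := LinearMap.toContinuousLinearMap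
      ((LinearMap.toContinuousLinearMap (𝕜 := ℝ) (E := EG) (F' := ℝ)).toLinearMap ∘ₗ Q)
    have hAd : ∀ y : EG, ContMDiff 𝓘(ℝ, EG) 𝓘(ℝ, EG) ∞ (fun g : G => Ad g y) := fun y =>
      contMDiff_Ad contMDiff_id contMDiff_const
    have h1 := diff_bilin (E := EG) Qc (hAd y 1) (hAd z 1) x
    have h2 : (fun g : G => Qc (Ad g y) (Ad g z)) = fun _ => Q y z := funext fun g => hinv g y z
    rw [h2, diff_Ad, diff_Ad, Ad_one, Ad_one, diff, mfderiv_const] at h1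
    have h3 : (0 : ℝ) = Q y (adj G x z) + Q (adj G x y) z := h1
    exact (neg_eq_of_add_eq_zero_right h3.symm).symm
  · let L := GroupLieAlgebra 𝓘(ℝ, EG) G
    let x' : L := x
    have hc : x' ∈ LieAlgebra.center ℝ L := (LieModule.mem_maxTrivSubmodule ℝ L L x').2 fun y =>
      (adj_swap G x y).trans (neg_eq_zero.2 (LinearMap.congr_fun h y))
    rw [LieAlgebra.center_eq_bot] at hc
    exact (LieSubmodule.mem_bot x').1 hc

end Compact

/-! ### Local sections and horizontal lifts -/

section Local

variable {E : Type*} [NormedAddCommGroup E] [NormedSpace ℝ E]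
  {N : Type*} [TopologicalSpace N] [ChartedSpace E N] [IsManifold 𝓘(ℝ, E) ∞ N]
  {V : Type*} [NormedAddCommGroup V] [NormedSpace ℝ V] [FiniteDimensional ℝ E] [T2Space N]

/-- A smooth form evaluated along a map on a vector which depends smoothly on parameters. -/
lemma SmoothForm.contMDiffAt_comp {EQ HQ Q : Type*} [NormedAddCommGroup EQ] [NormedSpace ℝ EQ]
    [TopologicalSpace HQ] {J : ModelWithCorners ℝ EQ HQ} [TopologicalSpace Q] [ChartedSpace HQ Q]
    {η : Π p : N, TangentSpace 𝓘(ℝ, E) p →L[ℝ] V} (hη : SmoothForm η) {b : Q → N}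
    {w : Π q, TangentSpace 𝓘(ℝ, E) (b q)} {q₀ : Q} (hb : ContMDiffAt J 𝓘(ℝ, E) ∞ b q₀)
    (hw : ContMDiffAt J 𝓘(ℝ, E).tangent ∞ (fun q => (⟨b q, w q⟩ : TangentBundle 𝓘(ℝ, E) N)) q₀) :
    ContMDiffAt J 𝓘(ℝ, V) ∞ (fun q => η (b q) (w q)) q₀ := by
  obtain ⟨φ, D, hD⟩ := exists_isCoord (E := E) (b q₀)
  have h1 := (contMDiffAt_comp_symmL hη (b q₀)).comp q₀ hb
  have h2 : ContMDiffAt J 𝓘(ℝ, E) ∞ (fun q => (diff φ (b q) (w q) : E)) q₀ :=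
    ((contMDiff_snd_tangentBundle_modelSpace E 𝓘(ℝ, E)).contMDiffAt.comp q₀
      ((contMDiffAt_tangentMap (hD.smooth_fun _)).comp q₀ hw))
  refine (h1.clm_apply h2).congr_of_eventuallyEq ?_
  filter_upwards [hb.continuousAt.eventually hD.eq_symmL, hb.continuousAt.eventually hD.vf_diff]
    with q e1 e2
  have h3 := e2 (w q)
  rw [e1] at h3
  exact congrArg (η (b q)) h3.symm

end Local

section Bundle

variable {EM EG EP : Type*}
  [NormedAddCommGroup EM] [NormedSpace ℝ EM] [FiniteDimensional ℝ EM]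
  [NormedAddCommGroup EG] [NormedSpace ℝ EG] [FiniteDimensional ℝ EG] [CompleteSpace EG]
  [NormedAddCommGroup EP] [NormedSpace ℝ EP] [FiniteDimensional ℝ EP]
  {M G P : Type*}
  [TopologicalSpace M] [ChartedSpace EM M] [IsManifold 𝓘(ℝ, EM) ∞ M] [T2Space M]
  [TopologicalSpace G] [ChartedSpace EG G] [Group G] [LieGroup 𝓘(ℝ, EG) ∞ G] [T2Space G]
  [TopologicalSpace P] [ChartedSpace EP P] [IsManifold 𝓘(ℝ, EP) ∞ P] [T2Space P]
  {𝓟 : PrincipalBundle EM EG EP M G P}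

/-- A local trivialization near `p`, in terms of a section `s` over `U` through `p` and the
`G`-component `k`. -/
structure LocalSection (𝓟 : PrincipalBundle EM EG EP M G P) (p : P) (U : Set M) (s : M → P)
    (k : P → G) : Prop where
  isOpen : IsOpen U
  mem : 𝓟.proj p ∈ U
  smooth_section : ContMDiffOn 𝓘(ℝ, EM) 𝓘(ℝ, EP) ∞ s U
  section_self : s (𝓟.proj p) = p
  proj_section : ∀ m ∈ U, 𝓟.proj (s m) = m
  smooth_comp : ContMDiffOn 𝓘(ℝ, EP) 𝓘(ℝ, EG) ∞ k (𝓟.proj ⁻¹' U)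
  comp_self : k p = 1
  act_comp : ∀ q, 𝓟.proj q ∈ U → 𝓟.act (s (𝓟.proj q)) (k q) = q
  comp_act : ∀ q g, 𝓟.proj q ∈ U → k (𝓟.act q g) = k q * g

namespace PrincipalBundle

lemma smooth_act_right (g : G) : ContMDiff 𝓘(ℝ, EP) 𝓘(ℝ, EP) ∞ (fun q => 𝓟.act q g) :=
  𝓟.smooth_act.comp (contMDiff_id.prodMk contMDiff_const)

lemma smooth_act_left (p : P) : ContMDiff 𝓘(ℝ, EG) 𝓘(ℝ, EP) ∞ (fun g => 𝓟.act p g) :=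
  𝓟.smooth_act.comp (contMDiff_const.prodMk contMDiff_id)

variable (𝓟) in
lemma exists_localSection (p : P) : ∃ U s k, LocalSection 𝓟 p U s k := by
  obtain ⟨U, e, hU, hm, hs, ht, he, hes, heq⟩ := 𝓟.locallyTrivial (𝓟.proj p)
  have hp : p ∈ e.source := by rw [hs]; exact hm
  have hmem : ∀ m ∈ U, ∀ g : G, ((m, g) : M × G) ∈ e.target := fun m hm g => by
    rw [ht]; exact ⟨hm, trivial⟩
  have hsrc : ∀ m ∈ U, ∀ g : G, e.symm (m, g) ∈ e.source := fun m hm g =>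
    e.map_target (hmem m hm g)
  have hpr : ∀ m ∈ U, ∀ g : G, 𝓟.proj (e.symm (m, g)) = m := fun m hm g => by
    rw [← (heq _ (hsrc m hm g)).1, e.right_inv (hmem m hm g)]
  refine ⟨U, fun m => e.symm (m, (e p).2), fun q => ((e p).2)⁻¹ * (e q).2, ?_⟩
  refine ⟨hU, hm, ?_, ?_, fun m hm => hpr m hm _, ?_, by simp, ?_, ?_⟩
  · exact hes.comp (contMDiff_id.prodMk contMDiff_const).contMDiffOn fun m hm => hmem m hm _
  · have : (𝓟.proj p, (e p).2) = e p := by rw [← (heq p hp).1]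
    rw [this, e.left_inv hp]
  · rw [← hs]
    exact contMDiffOn_const.mul (contMDiff_snd.comp_contMDiffOn he)
  · intro q hq
    have hq' : q ∈ e.source := by rw [hs]; exact hq
    have h1 := (heq _ (hsrc _ hq (e p).2)).2 ((e p).2⁻¹ * (e q).2)
    rw [e.right_inv (hmem _ hq _), mul_inv_cancel_left, ← (heq q hq').1] at h1
    have h2 : 𝓟.act (e.symm ((e q).1, (e p).2)) ((e p).2⁻¹ * (e q).2) ∈ e.source := by
      rw [hs]
      change 𝓟.proj _ ∈ U
      rw [𝓟.proj_act, (heq q hq').1, hpr _ hq]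
      exact hq
    have h3 := congrArg e.symm h1
    rw [e.left_inv h2, e.left_inv hq', (heq q hq').1] at h3
    exact h3
  · intro q g hq
    have hq' : q ∈ e.source := by rw [hs]; exact hq
    simp only [(heq q hq').2 g, mul_assoc]

variable (𝓟) in
lemma proj_surjective : Function.Surjective 𝓟.proj := by
  intro m
  obtain ⟨U, e, hU, hm, hs, ht, he, hes, heq⟩ := 𝓟.locallyTrivial m
  have h1 : ((m, 1) : M × G) ∈ e.target := by rw [ht]; exact ⟨hm, trivial⟩
  refine ⟨e.symm (m, 1), ?_⟩
  rw [← (heq _ (e.map_target h1)).1, e.right_inv h1]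

lemma exists_act_eq {p q : P} (h : 𝓟.proj q = 𝓟.proj p) : ∃ g, 𝓟.act p g = q := by
  obtain ⟨U, s, k, hs⟩ := 𝓟.exists_localSection p
  refine ⟨k q, ?_⟩
  have := hs.act_comp q (by rw [h]; exact hs.mem)
  rwa [h, hs.section_self] at this

lemma descend_proj {V : Type*} [Zero V] {f : P → V} (hf : ∀ p g, f (𝓟.act p g) = f p) (p : P) :
    𝓟.descend f (𝓟.proj p) = f p := by
  refine Function.FactorsThrough.extend_apply (fun q q' h => ?_) (0 : M → V) p
  obtain ⟨g, rfl⟩ := exists_act_eq h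
  exact hf _ g

/-- A function on the base is smooth if its pullback to the total space is. -/
lemma contMDiff_of_comp_proj {V : Type*} [NormedAddCommGroup V] [NormedSpace ℝ V] {f : M → V}
    (hf : ContMDiff 𝓘(ℝ, EP) 𝓘(ℝ, V) ∞ (fun p => f (𝓟.proj p))) :
    ContMDiff 𝓘(ℝ, EM) 𝓘(ℝ, V) ∞ f := by
  intro m
  obtain ⟨p, rfl⟩ := 𝓟.proj_surjective m
  obtain ⟨U, s, k, hs⟩ := 𝓟.exists_localSection p
  have hU := hs.isOpen.mem_nhds hs.mem
  refine ((hf.contMDiffAt).comp _ (hs.smooth_section.contMDiffAt hU)).congr_of_eventuallyEq ?_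
  filter_upwards [hU] with m hm
  simp [hs.proj_section m hm]

end PrincipalBundle

namespace LocalSection

variable {p : P} {U : Set M} {s : M → P} {k : P → G} (h : LocalSection 𝓟 p U s k)
include h

lemma nhds : U ∈ 𝓝 (𝓟.proj p) := h.isOpen.mem_nhds h.mem

lemma nhds' : 𝓟.proj ⁻¹' U ∈ 𝓝 p := 𝓟.smooth_proj.continuous.continuousAt.preimage_mem_nhds h.nhds

lemma contMDiffAt_section {m : M} (hm : m ∈ U) : ContMDiffAt 𝓘(ℝ, EM) 𝓘(ℝ, EP) ∞ s m :=
  h.smooth_section.contMDiffAt (h.isOpen.mem_nhds hm)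

lemma contMDiffAt_comp {q : P} (hq : 𝓟.proj q ∈ U) : ContMDiffAt 𝓘(ℝ, EP) 𝓘(ℝ, EG) ∞ k q :=
  h.smooth_comp.contMDiffAt ((h.isOpen.preimage 𝓟.smooth_proj.continuous).mem_nhds hq)

/-- Vertical tangent vectors are values of fundamental vector fields. -/
lemma sharp_mfderiv_comp {v : TangentSpace 𝓘(ℝ, EP) p} (hv : 𝓟.dproj p v = 0) :
    𝓟.sharp (mfderiv 𝓘(ℝ, EP) 𝓘(ℝ, EG) k p v : EG) p = v := by
  have h1 : (fun q => 𝓟.act (s (𝓟.proj q)) (k q)) =ᶠ[𝓝 p] id := by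
    filter_upwards [h.nhds'] with q hq
    exact h.act_comp q hq
  have hs := h.contMDiffAt_section h.mem
  have hk := h.contMDiffAt_comp h.mem
  have hsp : ContMDiffAt 𝓘(ℝ, EP) 𝓘(ℝ, EP) ∞ (fun q => s (𝓟.proj q)) p :=
    hs.comp p (𝓟.smooth_proj p)
  have hact := 𝓟.smooth_act.mdifferentiableAt (x := (p, (1 : G))) (by simp)
  have h2 := mfderiv_comp_apply_of_eq (I := 𝓘(ℝ, EP)) (I' := 𝓘(ℝ, EP).prod 𝓘(ℝ, EG))
    (I'' := 𝓘(ℝ, EP)) (x := p) (y := (p, (1 : G))) (g := fun z : P × G => 𝓟.act z.1 z.2)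
    (f := fun q => (s (𝓟.proj q), k q)) hact
    ((hsp.prodMk hk).mdifferentiableAt (by simp)) (by simp [h.section_self, h.comp_self]) v
  have h3 : mfderiv 𝓘(ℝ, EP) 𝓘(ℝ, EP)
      ((fun z : P × G => 𝓟.act z.1 z.2) ∘ fun q => (s (𝓟.proj q), k q)) p =
      mfderiv 𝓘(ℝ, EP) 𝓘(ℝ, EP) id p := Filter.EventuallyEq.mfderiv_eq h1
  rw [mfderiv_id] at h3
  have h4 : v = _ := (congrArg (fun T : EP →L[ℝ] EP => T v) h3.symm).trans h2
  have h5 : mfderiv 𝓘(ℝ, EP) 𝓘(ℝ, EP) (fun q => s (𝓟.proj q)) p v = 0 := by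
    have h6 := mfderiv_comp_apply (I := 𝓘(ℝ, EP)) (I' := 𝓘(ℝ, EM)) (I'' := 𝓘(ℝ, EP)) p
      (hs.mdifferentiableAt (by simp)) ((𝓟.smooth_proj p).mdifferentiableAt (by simp)) v
    exact h6.trans ((congrArg _ hv).trans (map_zero _))
  have h7 : mfderiv 𝓘(ℝ, EP) (𝓘(ℝ, EP).prod 𝓘(ℝ, EG)) (fun q => (s (𝓟.proj q), k q)) p v =
      ((0 : EP), (mfderiv 𝓘(ℝ, EP) 𝓘(ℝ, EG) k p v : EG)) := by
    rw [mfderiv_prodMk (hsp.mdifferentiableAt (by simp)) (hk.mdifferentiableAt (by simp))]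
    exact Prod.ext h5 rfl
  let w : TangentSpace (𝓘(ℝ, EP).prod 𝓘(ℝ, EG)) (p, (1 : G)) :=
    ((0 : EP), (mfderiv 𝓘(ℝ, EP) 𝓘(ℝ, EG) k p v : EG))
  have h8 := mfderiv_prod_eq_add_apply (v := w) hact
  have h9 := h8.trans ((congrArg (· + _) (map_zero _)).trans (zero_add _))
  exact (h4.trans ((congrArg _ h7).trans h9)).symm

lemma dproj_mfderiv_section {m : M} (hm : m ∈ U) {q : P} (hq : s m = q)
    (u : TangentSpace 𝓘(ℝ, EM) m) :
    (𝓟.dproj q : EP →L[ℝ] EM) (mfderiv 𝓘(ℝ, EM) 𝓘(ℝ, EP) s m u : EP) = u := by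
  have h1 : 𝓟.proj ∘ s =ᶠ[𝓝 m] id := by
    filter_upwards [h.isOpen.mem_nhds hm] with m hm
    exact h.proj_section m hm
  have h2 := mfderiv_comp_apply_of_eq (I := 𝓘(ℝ, EM)) (I' := 𝓘(ℝ, EP)) (I'' := 𝓘(ℝ, EM))
    (x := m) (y := q) (g := 𝓟.proj) (f := s)
    ((𝓟.smooth_proj q).mdifferentiableAt (by simp))
    ((h.contMDiffAt_section hm).mdifferentiableAt (by simp)) hq u
  rw [h1.mfderiv_eq, mfderiv_id] at h2
  exact h2.symm

end LocalSection

namespace PrincipalBundle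

lemma dproj_sharp (x : EG) (p : P) : 𝓟.dproj p (𝓟.sharp x p) = 0 := by
  have h2 := mfderiv_comp_apply_of_eq (I := 𝓘(ℝ, EG)) (I' := 𝓘(ℝ, EP)) (I'' := 𝓘(ℝ, EM))
    (x := (1 : G)) (y := p) (g := 𝓟.proj) (f := fun g => 𝓟.act p g)
    ((𝓟.smooth_proj p).mdifferentiableAt (by simp))
    ((𝓟.smooth_act_left p 1).mdifferentiableAt (by simp)) (𝓟.act_one p) x
  have h3 : 𝓟.proj ∘ (fun g => 𝓟.act p g) = fun _ => 𝓟.proj p := funext fun g => 𝓟.proj_act p g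
  rw [h3, mfderiv_const] at h2
  exact h2.symm

lemma dproj_act {p q : P} {g : G} (hq : 𝓟.act p g = q) (v : TangentSpace 𝓘(ℝ, EP) p) :
    (𝓟.dproj q : EP →L[ℝ] EM) (mfderiv 𝓘(ℝ, EP) 𝓘(ℝ, EP) (fun q => 𝓟.act q g) p v : EP) =
      𝓟.dproj p v := by
  have h2 := mfderiv_comp_apply_of_eq (I := 𝓘(ℝ, EP)) (I' := 𝓘(ℝ, EP)) (I'' := 𝓘(ℝ, EM))
    (x := p) (y := q) (g := 𝓟.proj) (f := fun q => 𝓟.act q g)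
    ((𝓟.smooth_proj q).mdifferentiableAt (by simp))
    ((𝓟.smooth_act_right g p).mdifferentiableAt (by simp)) hq v
  have h3 : 𝓟.proj ∘ (fun q => 𝓟.act q g) = 𝓟.proj := funext fun q => 𝓟.proj_act q g
  rw [h3] at h2
  exact h2.symm

lemma sharp_add (x y : EG) (p : P) : 𝓟.sharp (x + y) p = 𝓟.sharp x p + 𝓟.sharp y p :=
  map_add (mfderiv 𝓘(ℝ, EG) 𝓘(ℝ, EP) (fun g : G => 𝓟.act p g) 1 : EG →L[ℝ] EP) x y

lemma sharp_zero (p : P) : 𝓟.sharp 0 p = 0 :=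
  map_zero (mfderiv 𝓘(ℝ, EG) 𝓘(ℝ, EP) (fun g : G => 𝓟.act p g) 1 : EG →L[ℝ] EP)

lemma contMDiffAt_sharp {Φ : P → EG} {p : P} (hΦ : ContMDiffAt 𝓘(ℝ, EP) 𝓘(ℝ, EG) ∞ Φ p) :
    ContMDiffAt 𝓘(ℝ, EP) 𝓘(ℝ, EP).tangent ∞
      (fun q => (⟨q, 𝓟.sharp (Φ q) q⟩ : TangentBundle 𝓘(ℝ, EP) P)) p :=
  (contMDiffAt_partial (F := 𝓟.act) (a := fun q => q) (b := fun _ => (1 : G)) (w := Φ)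
    (Filter.Eventually.of_forall fun _ => 𝓟.smooth_act.contMDiffAt) contMDiffAt_id
    (contMDiffAt_mk_const hΦ)).congr_of_eventuallyEq
      (Filter.Eventually.of_forall fun q => by
        simp only [PrincipalBundle.sharp]
        congr 1
        exact (𝓟.act_one q).symm)

lemma smoothVF_sharp {Φ : P → EG} (hΦ : ContMDiff 𝓘(ℝ, EP) 𝓘(ℝ, EG) ∞ Φ) :
    SmoothVF (fun p => 𝓟.sharp (Φ p) p) := fun p => contMDiffAt_sharp (hΦ p)

end PrincipalBundle

namespace PrincipalConnection

variable (A : PrincipalConnection 𝓟)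

lemma splitting_injective (p : P) :
    Function.Injective ((𝓟.dproj p).prod (A.form p) : EP →L[ℝ] EM × EG) := by
  rw [injective_iff_map_eq_zero]
  intro v hv
  obtain ⟨U, s, k, hs⟩ := 𝓟.exists_localSection p
  have h1 : 𝓟.dproj p v = 0 := congrArg Prod.fst hv
  have h2 : A.form p v = 0 := congrArg Prod.snd hv
  have h3 := hs.sharp_mfderiv_comp h1
  have h4 := A.form_sharp (mfderiv 𝓘(ℝ, EP) 𝓘(ℝ, EG) k p v : EG) p
  rw [h3, h2] at h4
  rw [← h4] at h3
  exact h3.symm.trans (𝓟.sharp_zero p)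

lemma splitting_surjective (p : P) :
    Function.Surjective ((𝓟.dproj p).prod (A.form p) : EP →L[ℝ] EM × EG) := by
  rintro ⟨u, a⟩
  obtain ⟨U, s, k, hs⟩ := 𝓟.exists_localSection p
  let w : TangentSpace 𝓘(ℝ, EP) p := (mfderiv 𝓘(ℝ, EM) 𝓘(ℝ, EP) s (𝓟.proj p) u : EP)
  have hw : 𝓟.dproj p w = u := hs.dproj_mfderiv_section hs.mem hs.section_self u
  refine ⟨w + 𝓟.sharp (a - A.form p w) p, Prod.ext ?_ ?_⟩
  · have := (map_add (𝓟.dproj p) w (𝓟.sharp (a - A.form p w) p)).trans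
      (congrArg₂ (· + ·) hw (𝓟.dproj_sharp _ p))
    exact this.trans (add_zero _)
  · have := (map_add (A.form p) w (𝓟.sharp (a - A.form p w) p)).trans
      (congrArg (_ + ·) (A.form_sharp _ p))
    exact this.trans (add_sub_cancel _ _)

/-- The isomorphism of `T_p P` with `T_{π(p)} M × 𝔤` given by the connection. -/
def splitting (p : P) : EP ≃L[ℝ] EM × EG :=
  let L : EP →L[ℝ] EM × EG := (𝓟.dproj p).prod (A.form p)
  (LinearEquiv.ofBijective L.toLinearMap
    ⟨A.splitting_injective p, A.splitting_surjective p⟩).toContinuousLinearEquiv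

lemma hlift_apply (p : P) (u : TangentSpace 𝓘(ℝ, EM) (𝓟.proj p)) :
    A.hlift p u = (A.splitting p).symm (u, 0) := by
  have h2 := ContinuousLinearMap.inverse_equiv (A.splitting p)
  exact congrArg (fun T : EM × EG →L[ℝ] EP => T (u, 0)) h2

lemma splitting_hlift (p : P) (u : TangentSpace 𝓘(ℝ, EM) (𝓟.proj p)) :
    A.splitting p (A.hlift p u) = (u, 0) := by
  rw [hlift_apply]
  exact (A.splitting p).apply_symm_apply (u, 0)

lemma dproj_hlift (p : P) (u : TangentSpace 𝓘(ℝ, EM) (𝓟.proj p)) :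
    𝓟.dproj p (A.hlift p u) = u := congrArg Prod.fst (A.splitting_hlift p u)

lemma form_hlift (p : P) (u : TangentSpace 𝓘(ℝ, EM) (𝓟.proj p)) :
    A.form p (A.hlift p u) = 0 := congrArg Prod.snd (A.splitting_hlift p u)

lemma ext_splitting {p : P} {v w : TangentSpace 𝓘(ℝ, EP) p} (h1 : 𝓟.dproj p v = 𝓟.dproj p w)
    (h2 : A.form p v = A.form p w) : v = w :=
  A.splitting_injective p (Prod.ext h1 h2)

lemma hlift_dproj (p : P) (v : TangentSpace 𝓘(ℝ, EP) p) :
    A.hlift p (𝓟.dproj p v) = v - 𝓟.sharp (A.form p v) p := by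
  refine A.ext_splitting ?_ ?_
  · rw [dproj_hlift, map_sub, 𝓟.dproj_sharp, sub_zero]
  · rw [form_hlift, map_sub, A.form_sharp, sub_self]

include A in
lemma finrank_total [Nonempty P] :
    Module.finrank ℝ EP = Module.finrank ℝ EM + Module.finrank ℝ EG := by
  obtain ⟨p⟩ := ‹Nonempty P›
  rw [(A.splitting p).toLinearEquiv.finrank_eq, Module.finrank_prod]

/-- Horizontal lifts of smooth vector fields are smooth: near a point the horizontal lift is the
horizontal part of a lift constructed in a local trivialization. -/
lemma smoothVF_hlift {X : Π m : M, TangentSpace 𝓘(ℝ, EM) m} (hX : SmoothVF X) :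
    SmoothVF (fun p => A.hlift p (X (𝓟.proj p))) := by
  intro p
  obtain ⟨U, s, k, hs⟩ := 𝓟.exists_localSection p
  have hk := hs.contMDiffAt_comp hs.mem
  have hsm := hs.contMDiffAt_section hs.mem
  -- a lift of `X` to a vector field near `p` which is not necessarily horizontal
  let Y : Π q : P, TangentSpace 𝓘(ℝ, EP) (𝓟.act (s (𝓟.proj q)) (k q)) := fun q =>
    mfderiv 𝓘(ℝ, EP) 𝓘(ℝ, EP) (fun r => 𝓟.act r (k q)) (s (𝓟.proj q))
      (mfderiv 𝓘(ℝ, EM) 𝓘(ℝ, EP) s (𝓟.proj q) (X (𝓟.proj q)))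
  have hXp : ContMDiffAt 𝓘(ℝ, EP) 𝓘(ℝ, EM).tangent ∞
      (fun q => (⟨𝓟.proj q, X (𝓟.proj q)⟩ : TangentBundle 𝓘(ℝ, EM) M)) p :=
    (hX _).comp p (𝓟.smooth_proj p)
  have hw : ContMDiffAt 𝓘(ℝ, EP) 𝓘(ℝ, EP).tangent ∞
      (fun q => (⟨s (𝓟.proj q), mfderiv 𝓘(ℝ, EM) 𝓘(ℝ, EP) s (𝓟.proj q) (X (𝓟.proj q))⟩ :
        TangentBundle 𝓘(ℝ, EP) P)) p :=
    (contMDiffAt_tangentMap (z := ⟨𝓟.proj p, X (𝓟.proj p)⟩) hsm).comp p hXp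
  have hY : ContMDiffAt 𝓘(ℝ, EP) 𝓘(ℝ, EP).tangent ∞
      (fun q => (⟨𝓟.act (s (𝓟.proj q)) (k q), Y q⟩ : TangentBundle 𝓘(ℝ, EP) P)) p :=
    contMDiffAt_partial (F := fun (g : G) r => 𝓟.act r g) (a := k) (b := fun q => s (𝓟.proj q))
      (w := fun q => mfderiv 𝓘(ℝ, EM) 𝓘(ℝ, EP) s (𝓟.proj q) (X (𝓟.proj q)))
      (Filter.Eventually.of_forall fun _ => by
        exact (𝓟.smooth_act.comp (contMDiff_snd.prodMk contMDiff_fst)).contMDiffAt) hk hw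
  let Z : Π q : P, TangentSpace 𝓘(ℝ, EP) q := Y
  have hq : ∀ᶠ q in 𝓝 p, 𝓟.act (s (𝓟.proj q)) (k q) = q := by
    filter_upwards [hs.nhds'] with q hq
    exact hs.act_comp q hq
  have hZ : ContMDiffAt 𝓘(ℝ, EP) 𝓘(ℝ, EP).tangent ∞
      (fun q => (⟨q, Z q⟩ : TangentBundle 𝓘(ℝ, EP) P)) p := by
    refine hY.congr_of_eventuallyEq ?_
    filter_upwards [hq] with q hq
    have : ∀ (r : P) (hr : r = q) (v : EP), (⟨q, v⟩ : TangentBundle 𝓘(ℝ, EP) P) = ⟨r, v⟩ := by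
      rintro r rfl v; rfl
    exact this _ hq _
  have hAZ : ContMDiffAt 𝓘(ℝ, EP) 𝓘(ℝ, EG) ∞ (fun q => A.form q (Z q)) p :=
    A.smooth.contMDiffAt_comp contMDiffAt_id hZ
  have hsharp : ContMDiffAt 𝓘(ℝ, EP) 𝓘(ℝ, EP).tangent ∞
      (fun q => (⟨q, 𝓟.sharp (A.form q (Z q)) q⟩ : TangentBundle 𝓘(ℝ, EP) P)) p :=
    PrincipalBundle.contMDiffAt_sharp hAZ
  have hsub := hZ.sub_section hsharp
  refine hsub.congr_of_eventuallyEq ?_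
  filter_upwards [hs.nhds'] with q hqU
  have hd : 𝓟.dproj q (Z q) = X (𝓟.proj q) :=
    (𝓟.dproj_act (hs.act_comp q hqU) _).trans (hs.dproj_mfderiv_section hqU rfl _)
  have := A.hlift_dproj q (Z q)
  rw [hd] at this
  rw [this]
  rfl

end PrincipalConnection

end Bundle

/-! ### Sections of the adjoint bundle -/

section AdSections

variable {EM EG EP : Type*}
  [NormedAddCommGroup EM] [NormedSpace ℝ EM] [FiniteDimensional ℝ EM]
  [NormedAddCommGroup EG] [NormedSpace ℝ EG] [FiniteDimensional ℝ EG] [CompleteSpace EG]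
  [NormedAddCommGroup EP] [NormedSpace ℝ EP] [FiniteDimensional ℝ EP]
  {M G P : Type*}
  [TopologicalSpace M] [ChartedSpace EM M] [IsManifold 𝓘(ℝ, EM) ∞ M] [T2Space M]
  [TopologicalSpace G] [ChartedSpace EG G] [Group G] [LieGroup 𝓘(ℝ, EG) ∞ G] [T2Space G]
  [TopologicalSpace P] [ChartedSpace EP P] [IsManifold 𝓘(ℝ, EP) ∞ P] [T2Space P]
  {𝓟 : PrincipalBundle EM EG EP M G P}

open VectorField

namespace PrincipalBundle.AdSection

variable {Φ Φ' : P → EG}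

lemma zero : 𝓟.AdSection (0 : P → EG) :=
  ⟨contMDiff_const, fun _ g => (map_zero (AdL g⁻¹)).symm⟩

lemma add (h : 𝓟.AdSection Φ) (h' : 𝓟.AdSection Φ') : 𝓟.AdSection (Φ + Φ') :=
  ⟨h.1.add h'.1, fun p g => by simp only [Pi.add_apply, h.2 p g, h'.2 p g, Ad_add]⟩

lemma neg (h : 𝓟.AdSection Φ) : 𝓟.AdSection (-Φ) :=
  ⟨h.1.neg, fun p g => by
    simp only [Pi.neg_apply, h.2 p g]; exact (map_neg (AdL g⁻¹) (Φ p)).symm⟩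

lemma sub (h : 𝓟.AdSection Φ) (h' : 𝓟.AdSection Φ') : 𝓟.AdSection (Φ - Φ') := by
  rw [sub_eq_add_neg]; exact h.add h'.neg

lemma fsmul {f : M → ℝ} (hf : ContMDiff 𝓘(ℝ, EM) 𝓘(ℝ, ℝ) ∞ f) (h : 𝓟.AdSection Φ) :
    𝓟.AdSection (fun p => f (𝓟.proj p) • Φ p) :=
  ⟨(hf.comp 𝓟.smooth_proj).smul h.1, fun p g => by
    simp only [h.2 p g, 𝓟.proj_act, Ad_smul]⟩

lemma const_smul (a : ℝ) (h : 𝓟.AdSection Φ) : 𝓟.AdSection (fun p => a • Φ p) :=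
  h.fsmul (f := fun _ => a) contMDiff_const

lemma adj (h : 𝓟.AdSection Φ) (h' : 𝓟.AdSection Φ') :
    𝓟.AdSection (fun p => CourantReduction.adj G (Φ p) (Φ' p)) :=
  ⟨((adjL G).contMDiff.comp h.1).clm_apply h'.1, fun p g => by
    simp only [h.2 p g, h'.2 p g, Ad_adj]⟩

lemma killing_act (h : 𝓟.AdSection Φ) (h' : 𝓟.AdSection Φ') (p : P) (g : G) :
    killing G (Φ (𝓟.act p g)) (Φ' (𝓟.act p g)) = killing G (Φ p) (Φ' p) := by
  rw [h.2, h'.2, killing_Ad]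

lemma contMDiff_killing (h : 𝓟.AdSection Φ) (h' : 𝓟.AdSection Φ') :
    ContMDiff 𝓘(ℝ, EP) 𝓘(ℝ, ℝ) ∞ (fun p => killing G (Φ p) (Φ' p)) :=
  ((killingL G).contMDiff.comp h.1).clm_apply h'.1

lemma descend_killing (h : 𝓟.AdSection Φ) (h' : 𝓟.AdSection Φ') (p : P) :
    𝓟.descend (fun p => killing G (Φ p) (Φ' p)) (𝓟.proj p) = killing G (Φ p) (Φ' p) :=
  𝓟.descend_proj (fun p g => h.killing_act h' p g) p

end PrincipalBundle.AdSection

/-- Near a point the adjoint bundle has sections `Ad (k q)⁻¹ x` which are constant in a local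
trivialization; a bump function on the base makes them global. -/
lemma LocalSection.exists_adSection {p : P} {U : Set M} {s : M → P} {k : P → G}
    (h : LocalSection 𝓟 p U s k) : ∃ Φ : EG → P → EG, (∀ x, 𝓟.AdSection (Φ x)) ∧
      ∀ᶠ m in 𝓝 (𝓟.proj p), ∀ q, 𝓟.proj q = m → ∀ x, Φ x q = Ad (k q)⁻¹ x := by
  obtain ⟨b, hb, hb1, hbU⟩ := exists_bump (E := EM) (𝓟.proj p) h.nhds
  refine ⟨fun x q => b (𝓟.proj q) • Ad (k q)⁻¹ x, fun x => ⟨fun q => ?_, fun q g => ?_⟩, ?_⟩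
  · by_cases hq : 𝓟.proj q ∈ U
    · exact ((hb.comp 𝓟.smooth_proj) q).smul
        (contMDiffAt_Ad (h.contMDiffAt_comp hq).inv contMDiffAt_const)
    · have h0 : b =ᶠ[𝓝 (𝓟.proj q)] 0 := notMem_tsupport_iff_eventuallyEq.1 fun h => hq (hbU h)
      have h1 := 𝓟.smooth_proj.continuous.continuousAt.eventually h0
      refine (contMDiffAt_const (c := (0 : EG))).congr_of_eventuallyEq ?_
      filter_upwards [h1] with r hr
      simp [hr]
  · simp only [𝓟.proj_act]
    by_cases hq : 𝓟.proj q ∈ U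
    · rw [h.comp_act q g hq, mul_inv_rev, Ad_mul, Ad_smul]
    · have : b (𝓟.proj q) = 0 := image_eq_zero_of_notMem_tsupport fun h => hq (hbU h)
      rw [this, zero_smul, zero_smul]
      exact (map_zero (AdL g⁻¹)).symm
  · filter_upwards [hb1] with m hm q hq x
    simp only [hq, hm, one_smul]

namespace PrincipalConnection

variable (A : PrincipalConnection 𝓟)

lemma hlift_act (p : P) (g : G) (u : EM) : (A.hlift (𝓟.act p g) u : EP) =
    mfderiv 𝓘(ℝ, EP) 𝓘(ℝ, EP) (fun q => 𝓟.act q g) p (A.hlift p u) := by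
  refine A.ext_splitting (p := 𝓟.act p g) ?_ ?_
  · exact (A.dproj_hlift _ u).trans ((𝓟.dproj_act rfl _).trans (A.dproj_hlift p u)).symm
  · exact (A.form_hlift _ u).trans ((A.equivariant p g _).trans
      ((congrArg (AdL g⁻¹) (A.form_hlift p u)).trans (map_zero (AdL g⁻¹)))).symm

lemma hlift_act_vf (X : Π m : M, TangentSpace 𝓘(ℝ, EM) m) (p : P) (g : G) :
    mfderiv 𝓘(ℝ, EP) 𝓘(ℝ, EP) (fun q => 𝓟.act q g) p (A.hlift p (X (𝓟.proj p))) =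
      A.hlift (𝓟.act p g) (X (𝓟.proj (𝓟.act p g))) := by
  have h : (X (𝓟.proj (𝓟.act p g)) : EM) = X (𝓟.proj p) :=
    congrArg (fun m => (X m : EM)) (𝓟.proj_act p g)
  exact ((congrArg (fun u : EM => (A.hlift (𝓟.act p g) u : EP)) h).trans
    (A.hlift_act p g _)).symm

variable {X Y : Π m : M, TangentSpace 𝓘(ℝ, EM) m} {Φ Φ' : P → EG}

lemma adSection_covD (hX : SmoothVF X) (hΦ : 𝓟.AdSection Φ) :
    𝓟.AdSection (fun p => A.covD Φ p (X (𝓟.proj p))) := by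
  refine ⟨contMDiff_diff hΦ.1 (A.smoothVF_hlift hX), fun p g => ?_⟩
  change diff Φ (𝓟.act p g) (A.hlift (𝓟.act p g) (X (𝓟.proj (𝓟.act p g)))) =
    Ad g⁻¹ (diff Φ p (A.hlift p (X (𝓟.proj p))))
  rw [← A.hlift_act_vf X p g]
  rw [← diff_comp (hΦ.1 _) (𝓟.smooth_act_right g p)]
  have : (fun q => Φ (𝓟.act q g)) = fun q => AdL g⁻¹ (Φ q) := funext fun q => hΦ.2 q g
  rw [this]
  exact diff_clm_comp (AdL g⁻¹) (hΦ.1 p) _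

/-- The curvature is the vertical part of the bracket of horizontal lifts. -/
lemma curvature_apply (hX : SmoothVF X) (hY : SmoothVF Y) (p : P) :
    A.curvature p (X (𝓟.proj p)) (Y (𝓟.proj p)) = -A.form p (mlieBracket 𝓘(ℝ, EP)
      (fun p => A.hlift p (X (𝓟.proj p))) (fun p => A.hlift p (Y (𝓟.proj p))) p) := by
  have h1 := extDerivOne_apply A.smooth (A.smoothVF_hlift hX) (A.smoothVF_hlift hY) p
  have h2 : ∀ Z : Π m : M, TangentSpace 𝓘(ℝ, EM) m,
      (fun q => A.form q (A.hlift q (Z (𝓟.proj q)))) = fun _ => 0 :=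
    fun Z => funext fun q => A.form_hlift q _
  rw [h2, h2, diff, mfderiv_const] at h1
  have h3 : A.curvature p (X (𝓟.proj p)) (Y (𝓟.proj p)) =
    extDerivOne A.form p (A.hlift p (X (𝓟.proj p))) (A.hlift p (Y (𝓟.proj p))) +
      adj G (A.form p (A.hlift p (X (𝓟.proj p)))) (A.form p (A.hlift p (Y (𝓟.proj p)))) := rfl
  rw [h3, h1, form_hlift, form_hlift, map_zero, add_zero]
  exact (congrArg (· - _) (sub_self _)).trans (zero_sub _)

lemma adSection_curvature (hX : SmoothVF X) (hY : SmoothVF Y) :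
    𝓟.AdSection (fun p => A.curvature p (X (𝓟.proj p)) (Y (𝓟.proj p))) := by
  have hX' := A.smoothVF_hlift hX
  have hY' := A.smoothVF_hlift hY
  simp only [A.curvature_apply hX hY]
  refine ⟨(A.smooth _ (hX'.mlieBracket hY')).neg, fun p g => ?_⟩
  beta_reduce
  rw [← mfderiv_mlieBracket (𝓟.smooth_act_right g) hX' hY' hX' hY' (fun q => A.hlift_act_vf X q g)
    (fun q => A.hlift_act_vf Y q g) p, A.equivariant]
  exact (map_neg (AdL g⁻¹) _).symm

/-- The covariant derivative is a derivation of the bracket of the adjoint bundle. -/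
lemma covD_adj (hΦ : 𝓟.AdSection Φ) (hΦ' : 𝓟.AdSection Φ') (p : P)
    (u : TangentSpace 𝓘(ℝ, EM) (𝓟.proj p)) :
    A.covD (fun q => adj G (Φ q) (Φ' q)) p u =
      adj G (A.covD Φ p u) (Φ' p) + adj G (Φ p) (A.covD Φ' p u) :=
  (diff_bilin (adjL G) (hΦ.1 p) (hΦ'.1 p) _).trans (add_comm _ _)

end PrincipalConnection

end AdSections

/-! ### The reduced bundle -/

section Reduced

variable {EM EG EP : Type*}
  [NormedAddCommGroup EM] [NormedSpace ℝ EM] [FiniteDimensional ℝ EM]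
  [NormedAddCommGroup EG] [NormedSpace ℝ EG] [FiniteDimensional ℝ EG] [CompleteSpace EG]
  [NormedAddCommGroup EP] [NormedSpace ℝ EP] [FiniteDimensional ℝ EP]
  {M G P : Type*}
  [TopologicalSpace M] [ChartedSpace EM M] [IsManifold 𝓘(ℝ, EM) ∞ M] [T2Space M]
  [TopologicalSpace G] [ChartedSpace EG G] [Group G] [LieGroup 𝓘(ℝ, EG) ∞ G] [T2Space G]
  [TopologicalSpace P] [ChartedSpace EP P] [IsManifold 𝓘(ℝ, EP) ∞ P] [T2Space P]
  {𝓟 : PrincipalBundle EM EG EP M G P}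

open VectorField

namespace PrincipalBundle

variable (𝓟) in
/-- A point in the fibre over `m`.  Quantities which `PrincipalBundle.descend` moves to the base are
evaluated there. -/
def fibrePoint (m : M) : P := Classical.choose (𝓟.proj_surjective m)

lemma proj_fibrePoint (m : M) : 𝓟.proj (𝓟.fibrePoint m) = m :=
  Classical.choose_spec (𝓟.proj_surjective m)

lemma descend_apply {V : Type*} [Zero V] (f : P → V) (m : M) :
    𝓟.descend f m = f (𝓟.fibrePoint m) := by
  classical
  rw [PrincipalBundle.descend, Function.extend_def, dif_pos (𝓟.proj_surjective m)]
  rfl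

end PrincipalBundle

namespace PrincipalConnection

variable {A : PrincipalConnection 𝓟} {H₀ : ThreeForm EM M}

lemma reduced_pairing (s t : RedSec EM EG M P) (m : M) : (A.reduced H₀).pairing s t m =
    t.2.2 m (s.1 m) + s.2.2 m (t.1 m) +
      killing G (s.2.1 (𝓟.fibrePoint m)) (t.2.1 (𝓟.fibrePoint m)) := by
  rw [← 𝓟.descend_apply (fun p => killing G (s.2.1 p) (t.2.1 p))]
  rfl

lemma reduced_pairing_proj {s t : RedSec EM EG M P} (hs : 𝓟.AdSection s.2.1)
    (ht : 𝓟.AdSection t.2.1) (p : P) : (A.reduced H₀).pairing s t (𝓟.proj p) =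
    t.2.2 (𝓟.proj p) (s.1 (𝓟.proj p)) + s.2.2 (𝓟.proj p) (t.1 (𝓟.proj p)) +
      killing G (s.2.1 p) (t.2.1 p) := by
  rw [← hs.descend_killing ht]
  rfl

variable [CompactSpace G] [LieAlgebra.IsSemisimple ℝ (GroupLieAlgebra 𝓘(ℝ, EG) G)]

variable (A H₀) in
/-- The section calculus of the reduced bundle.  Smooth sections are determined by their pairings
since the Killing form is definite. -/
lemma reduced_calculus : SectionCalculus (A.reduced H₀) where
  fun_const c := contMDiff_const
  fun_add f g hf hg := ContMDiff.add hf hg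
  fun_mul f g hf hg := ContMDiff.mul hf hg
  smooth_zero := ⟨SmoothVF.zero, PrincipalBundle.AdSection.zero, SmoothForm.zero⟩
  smooth_add s t hs ht := ⟨hs.1.add ht.1, hs.2.1.add ht.2.1, hs.2.2.add ht.2.2⟩
  smooth_fsmul f s hf hs := ⟨SmoothVF.smul hf hs.1, hs.2.1.fsmul hf, SmoothForm.smul hf hs.2.2⟩
  pairing_add s t χ := by
    ext m
    rw [Pi.add_apply, reduced_pairing, reduced_pairing, reduced_pairing]
    change χ.2.2 m (s.1 m + t.1 m) + (s.2.2 m + t.2.2 m) (χ.1 m) +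
      killing G (s.2.1 _ + t.2.1 _) _ = _
    rw [map_add, add_apply, killing_add]
    ring
  pairing_fsmul f s χ := by
    ext m
    rw [Pi.mul_apply, reduced_pairing, reduced_pairing]
    change χ.2.2 m (f m • s.1 m) + (f m • s.2.2 m) (χ.1 m) + killing G (f _ • s.2.1 _) _ = _
    rw [map_smul, smul_apply, 𝓟.proj_fibrePoint, killing_smul, smul_eq_mul, smul_eq_mul]
    ring
  pairing_comm s t := by
    ext m
    rw [reduced_pairing, reduced_pairing, killing_comm]
    ring
  pairing_smooth s t hs ht := by
    refine 𝓟.contMDiff_of_comp_proj ?_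
    simp only [reduced_pairing_proj hs.2.1 ht.2.1]
    exact (((ht.2.2 _ hs.1).add (hs.2.2 _ ht.1)).comp 𝓟.smooth_proj).add
      (hs.2.1.contMDiff_killing ht.2.1)
  anchor_smooth s f hs hf := contMDiff_diff hf hs.1
  anchor_bracket s t f hs ht hf := by
    ext m
    exact diff_mlieBracket hs.1 ht.1 hf m
  fsmul_const_neg s := by
    refine Prod.ext (funext fun m => ?_) (Prod.ext (funext fun p => ?_) (funext fun m => ?_))
    · exact neg_one_smul ℝ (s.1 m)
    · exact neg_one_smul ℝ (s.2.1 p)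
    · exact neg_one_smul ℝ (s.2.2 m)
  ext s t hs ht h := by
    have h1 : ((s.1, s.2.2) : GenSec EM M) = (t.1, t.2.2) := by
      refine (dorfman_calculus (H := fun _ _ _ => 0)).ext _ _ ⟨hs.1, hs.2.2⟩ ⟨ht.1, ht.2.2⟩
        fun χ hχ => funext fun m => ?_
      have := congrFun (h (χ.1, 0, χ.2) ⟨hχ.1, PrincipalBundle.AdSection.zero, hχ.2⟩) m
      rw [reduced_pairing, reduced_pairing] at this
      simp only [Pi.zero_apply, map_zero, add_zero] at this
      exact this
    have h2 : s.1 = t.1 := (Prod.ext_iff.1 h1).1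
    have h3 : s.2.2 = t.2.2 := (Prod.ext_iff.1 h1).2
    refine Prod.ext h2 (Prod.ext (funext fun p => ?_) h3)
    obtain ⟨U, σ, k, hσ⟩ := 𝓟.exists_localSection p
    obtain ⟨Φ, hΦ, hv⟩ := hσ.exists_adSection
    have h4 : ∀ x : EG, killing G (s.2.1 p) x = killing G (t.2.1 p) x := fun x => by
      have := congrFun (h (0, Φ x, 0) ⟨SmoothVF.zero, hΦ x, SmoothForm.zero⟩) (𝓟.proj p)
      rw [reduced_pairing_proj hs.2.1 (hΦ x), reduced_pairing_proj ht.2.1 (hΦ x)] at this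
      have hx : Φ x p = x := by
        rw [hv.self_of_nhds p rfl x, hσ.comp_self, inv_one, Ad_one]
      simpa [hx] using this
    by_contra hne
    have h5 := killing_self_neg (G := G) (sub_ne_zero.2 hne)
    rw [sub_eq_add_neg, killing_add, ← neg_one_smul ℝ, killing_smul, h4] at h5
    linarith
  smooth_bracket s t hs ht h := by
    refine ⟨hs.1.mlieBracket ht.1, ?_, fun Z hZ => ?_⟩
    · exact (((A.adSection_covD hs.1 ht.2.1).sub (A.adSection_covD ht.1 hs.2.1)).sub
        (A.adSection_curvature hs.1 ht.1)).sub (hs.2.1.adj ht.2.1)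
    · have := h (Z, 0, 0) ⟨hZ, PrincipalBundle.AdSection.zero, SmoothForm.zero⟩
      refine (congrArg (ContMDiff 𝓘(ℝ, EM) 𝓘(ℝ, ℝ) ∞) (funext fun m => ?_)).mp this
      rw [reduced_pairing]
      simp
  bump m U hU := by
    obtain ⟨b, hb, hb1, hbU⟩ := exists_bump (E := EM) m hU
    exact ⟨b, hb, hb1.self_of_nhds, fun y hy =>
      image_eq_zero_of_notMem_tsupport fun h => hy (hbU h)⟩

variable (EM EG G) in
/-- The pairing on a fibre of the reduced bundle. -/
def reducedFibrePairing : (EM × EG × (EM →L[ℝ] ℝ)) →ₗ[ℝ] (EM × EG × (EM →L[ℝ] ℝ)) →ₗ[ℝ] ℝ :=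
  LinearMap.mk₂ ℝ (fun s t => t.2.2 s.1 + s.2.2 t.1 + killing G s.2.1 t.2.1)
    (fun s s' t => by
      simp only [Prod.fst_add, Prod.snd_add, map_add, add_apply, killing_add]; ring)
    (fun a s t => by
      simp only [Prod.smul_fst, Prod.smul_snd, map_smul, smul_apply, smul_eq_mul,
        killing_smul]; ring)
    (fun s t t' => by simp only [Prod.fst_add, Prod.snd_add, map_add, add_apply]; ring)
    (fun a s t => by
      simp only [Prod.smul_fst, Prod.smul_snd, map_smul, smul_apply, smul_eq_mul]; ring)

lemma reduced_isDualFrame {ι : Type*} [Fintype ι] [DecidableEq ι]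
    (hcard : Fintype.card ι = 2 * Module.finrank ℝ EM + Module.finrank ℝ EG) {m : M}
    {e ε : ι → RedSec EM EG M P}
    (he : ∀ i, (A.reduced H₀).Smooth (e i)) (hε : ∀ i, (A.reduced H₀).Smooth (ε i))
    (h : ∀ᶠ y in 𝓝 m, ∀ i j, (A.reduced H₀).pairing (e i) (ε j) y = if i = j then 1 else 0) :
    IsDualFrame (A.reduced H₀) m e ε where
  smooth_left := he
  smooth_right := hε
  complete := by
    filter_upwards [h] with y hy s χ _ _
    have hd : Module.finrank ℝ (EM × EG × (EM →L[ℝ] ℝ)) =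
        2 * Module.finrank ℝ EM + Module.finrank ℝ EG := by
      rw [Module.finrank_prod, Module.finrank_prod, ← (LinearMap.toContinuousLinearMap (𝕜 := ℝ)
        (E := EM) (F' := ℝ)).finrank_eq, Module.finrank_linearMap, Module.finrank_self]
      ring
    simp only [reduced_pairing] at hy ⊢
    exact sum_mul_of_biorthogonal (reducedFibrePairing EM EG G)
      (e := fun i => ((e i).1 y, (e i).2.1 (𝓟.fibrePoint y), (e i).2.2 y))
      (ε := fun i => ((ε i).1 y, (ε i).2.1 (𝓟.fibrePoint y), (ε i).2.2 y)) (hcard.trans hd.symm) hy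
      (s.1 y, s.2.1 (𝓟.fibrePoint y), s.2.2 y) (χ.1 y, χ.2.1 (𝓟.fibrePoint y), χ.2.2 y)

variable (EG G) in
/-- A basis of the Lie algebra which is orthonormal for the negative of the Killing form. -/
lemma exists_killing_orthonormal : ∃ b : Fin (Module.finrank ℝ EG) → EG,
    ∀ i j, killing G (b i) (b j) = if i = j then -1 else 0 := by
  let B : LinearMap.BilinForm ℝ EG := LinearMap.mk₂ ℝ (fun x y => killing G x y)
    (killing_add G) (killing_smul G) (fun x y z => map_add _ _ _) (fun a x y => map_smul _ _ _)
  obtain ⟨v, hv⟩ := LinearMap.BilinForm.exists_orthogonal_basis (B := B) ⟨killing_comm G⟩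
  have hneg : ∀ i, 0 < -killing G (v i) (v i) := fun i =>
    neg_pos.2 (killing_self_neg (v.ne_zero i))
  refine ⟨fun i => (√(-killing G (v i) (v i)))⁻¹ • v i, fun i j => ?_⟩
  rw [killing_smul, map_smul, smul_eq_mul]
  split_ifs with h
  · subst h
    have h1 := Real.mul_self_sqrt (hneg i).le
    have h2 := (Real.sqrt_pos.2 (hneg i)).ne'
    field_simp
    rw [sq, h1]
    ring
  · have h1 : killing G (v i) (v j) = 0 := hv h
    rw [h1, mul_zero, mul_zero]

variable (𝓟) in
/-- Local frames of the adjoint bundle which are orthonormal for the negative of the Killing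
form. -/
lemma exists_adSection_frame (p : P) : ∃ Φ : Fin (Module.finrank ℝ EG) → P → EG,
    (∀ i, 𝓟.AdSection (Φ i)) ∧ ∀ᶠ m in 𝓝 (𝓟.proj p), ∀ q,
      𝓟.proj q = m → ∀ i j, killing G (Φ i q) (Φ j q) = if i = j then -1 else 0 := by
  obtain ⟨U, σ, k, hσ⟩ := 𝓟.exists_localSection p
  obtain ⟨Φ, hΦ, hv⟩ := hσ.exists_adSection
  obtain ⟨b, h⟩ := exists_killing_orthonormal EG G
  refine ⟨fun i => Φ (b i), fun i => hΦ _, ?_⟩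
  filter_upwards [hv] with m hm q hq i j
  rw [hm q hq, hm q hq, killing_Ad, h]

variable (A H₀) in
/-- Local frames of `TM ⊕ T*M` and orthonormal frames `Φ` of the adjoint bundle combine to local
frames of the reduced bundle; the dual of `Φ` is `-Φ`. -/
lemma exists_reduced_frame (m : M) : ∃ e ε : (Fin (Module.finrank ℝ EM) ⊕
      Fin (Module.finrank ℝ EM)) ⊕ Fin (Module.finrank ℝ EG) → RedSec EM EG M P,
    (∀ i, (A.reduced H₀).Smooth (e i)) ∧ (∀ i, (A.reduced H₀).Smooth (ε i)) ∧
      ∀ᶠ y in 𝓝 m, ∀ i j, (A.reduced H₀).pairing (e i) (ε j) y = if i = j then 1 else 0 := by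
  obtain ⟨p, rfl⟩ := 𝓟.proj_surjective m
  obtain ⟨e, ε, he, hε, h⟩ :=
    exists_dorfman_frame (E := EM) (N := M) (H := fun _ _ _ => 0) (𝓟.proj p)
  obtain ⟨Φ, hΦ, h'⟩ := exists_adSection_frame 𝓟 p
  refine ⟨Sum.elim (fun i => ((e i).1, 0, (e i).2)) fun i => (0, Φ i, 0),
    Sum.elim (fun i => ((ε i).1, 0, (ε i).2)) fun i => (0, -Φ i, 0), ?_, ?_, ?_⟩
  · rintro (i | i)
    · exact ⟨(he i).1, PrincipalBundle.AdSection.zero, (he i).2⟩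
    · exact ⟨SmoothVF.zero, hΦ i, SmoothForm.zero⟩
  · rintro (i | i)
    · exact ⟨(hε i).1, PrincipalBundle.AdSection.zero, (hε i).2⟩
    · exact ⟨SmoothVF.zero, (hΦ i).neg, SmoothForm.zero⟩
  · have h0 : ∀ z : EG, killing G 0 z = 0 := fun z => by rw [killing_comm, map_zero]
    filter_upwards [h, h'] with y h h'
    rintro (i | i) (j | j) <;> rw [reduced_pairing]
    · have := h i j
      rw [dorfman_pairing] at this
      simpa using this
    · simp [h0]
    · simp
    · have := h' _ (𝓟.proj_fibrePoint y) i j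
      simp only [Sum.elim_inr, Pi.zero_apply, Pi.neg_apply, map_neg, map_zero, this,
        Sum.inr.injEq]
      split_ifs <;> simp

variable (A H₀) in
lemma reduced_localFrame (m : M) : IsDualFrame (A.reduced H₀) m
    (localFrame (A.reduced H₀) m).1 (localFrame (A.reduced H₀) m).2 := by
  obtain ⟨e, ε, he, hε, h⟩ := exists_reduced_frame A H₀ m
  obtain ⟨h1, h2, h3⟩ := isLocalFrame_localFrame (𝒞 := A.reduced H₀)
    (by simp [reduced, two_mul]) he hε h
  exact reduced_isDualFrame (Fintype.card_fin _) h1 h2 h3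

end PrincipalConnection

end Reduced

/-! ### The decomposition of the invariant sections -/

section Total

variable {EM EG EP : Type*}
  [NormedAddCommGroup EM] [NormedSpace ℝ EM] [FiniteDimensional ℝ EM]
  [NormedAddCommGroup EG] [NormedSpace ℝ EG] [FiniteDimensional ℝ EG] [CompleteSpace EG]
  [NormedAddCommGroup EP] [NormedSpace ℝ EP] [FiniteDimensional ℝ EP]
  {M G P : Type*}
  [TopologicalSpace M] [ChartedSpace EM M] [IsManifold 𝓘(ℝ, EM) ∞ M] [T2Space M]
  [TopologicalSpace G] [ChartedSpace EG G] [Group G] [LieGroup 𝓘(ℝ, EG) ∞ G] [T2Space G]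
  [TopologicalSpace P] [ChartedSpace EP P] [IsManifold 𝓘(ℝ, EP) ∞ P] [T2Space P]
  {𝓟 : PrincipalBundle EM EG EP M G P} {A : PrincipalConnection 𝓟} {H₀ : ThreeForm EM M}

/-- The pullback of a smooth 1-form on the base is smooth. -/
lemma smoothForm_pullback {ξ : Π m : M, TangentSpace 𝓘(ℝ, EM) m →L[ℝ] ℝ} (hξ : SmoothForm ξ) :
    SmoothForm (fun p : P => (ξ (𝓟.proj p)).comp (𝓟.dproj p)) := fun X hX p =>
  hξ.contMDiffAt_comp (𝓟.smooth_proj p)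
    ((contMDiffAt_tangentMap (z := ⟨p, X p⟩) (𝓟.smooth_proj p)).comp p (hX p))

namespace PrincipalConnection

lemma smoothForm_killing {Φ : P → EG} (hΦ : ContMDiff 𝓘(ℝ, EP) 𝓘(ℝ, EG) ∞ Φ) :
    SmoothForm (fun p => (1 / 2 : ℝ) • (killing G (Φ p)).comp (A.form p)) :=
  SmoothForm.smul (f := fun _ => 1 / 2) contMDiff_const fun X hX =>
    ((killingL G).contMDiff.comp hΦ).clm_apply (A.smooth X hX)

lemma smooth_incl {ψ : RedSec EM EG M P} (h : (A.reduced H₀).Smooth ψ) :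
    (A.total H₀).Smooth (A.incl ψ) :=
  ⟨(A.smoothVF_hlift h.1).add (𝓟.smoothVF_sharp h.2.1.1),
    (smoothForm_pullback h.2.2).add (smoothForm_killing h.2.1.1)⟩

lemma smooth_lift_of_contMDiff {Φ : P → EG} (h : ContMDiff 𝓘(ℝ, EP) 𝓘(ℝ, EG) ∞ Φ) :
    (A.total H₀).Smooth (A.lift Φ) :=
  ⟨𝓟.smoothVF_sharp h, fun X hX => (smoothForm_killing (A := A) h X hX).neg⟩

lemma smooth_lift {Φ : P → EG} (h : 𝓟.AdSection Φ) : (A.total H₀).Smooth (A.lift Φ) :=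
  smooth_lift_of_contMDiff h.1

lemma incl_add (ψ ψ' : RedSec EM EG M P) : A.incl (ψ + ψ') = A.incl ψ + A.incl ψ' := by
  refine Prod.ext (funext fun p => ?_) (funext fun p => ContinuousLinearMap.ext fun v => ?_)
  · change A.hlift p (ψ.1 _ + ψ'.1 _) + 𝓟.sharp (ψ.2.1 p + ψ'.2.1 p) p =
      (A.hlift p (ψ.1 _) + 𝓟.sharp (ψ.2.1 p) p) + (A.hlift p (ψ'.1 _) + 𝓟.sharp (ψ'.2.1 p) p)
    rw [map_add, 𝓟.sharp_add]
    exact add_add_add_comm _ _ _ _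
  · change (ψ.2.2 _ (𝓟.dproj p v) + ψ'.2.2 _ (𝓟.dproj p v)) +
      (1 / 2 : ℝ) * killing G (ψ.2.1 p + ψ'.2.1 p) (A.form p v) =
      (ψ.2.2 _ (𝓟.dproj p v) + (1 / 2 : ℝ) * killing G (ψ.2.1 p) (A.form p v)) +
      (ψ'.2.2 _ (𝓟.dproj p v) + (1 / 2 : ℝ) * killing G (ψ'.2.1 p) (A.form p v))
    rw [killing_add]
    ring

lemma lift_add (Φ Φ' : P → EG) : A.lift (Φ + Φ') = A.lift Φ + A.lift Φ' := by
  refine Prod.ext (funext fun p => ?_) (funext fun p => ContinuousLinearMap.ext fun v => ?_)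
  · exact 𝓟.sharp_add _ _ p
  · change -((1 / 2 : ℝ) * killing G (Φ p + Φ' p) (A.form p v)) =
      -((1 / 2 : ℝ) * killing G (Φ p) (A.form p v)) +
        -((1 / 2 : ℝ) * killing G (Φ' p) (A.form p v))
    rw [killing_add]
    ring

lemma incl_zero : A.incl (0 : RedSec EM EG M P) = 0 := by
  have h := incl_add (A := A) 0 0
  rw [add_zero] at h
  exact left_eq_add.1 h

lemma lift_zero : A.lift (0 : P → EG) = 0 := by
  have h := lift_add (A := A) 0 0
  rw [add_zero] at h
  exact left_eq_add.1 h

lemma incl_neg (ψ : RedSec EM EG M P) : A.incl (-ψ) = -A.incl ψ := by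
  rw [eq_neg_iff_add_eq_zero, ← incl_add, neg_add_cancel, incl_zero]

section Pairing

variable (ψ ψ' : RedSec EM EG M P) (Φ Φ' : P → EG) (p : P)

lemma dproj_incl : 𝓟.dproj p ((A.incl ψ).1 p) = ψ.1 (𝓟.proj p) := by
  change 𝓟.dproj p (A.hlift p (ψ.1 (𝓟.proj p)) + 𝓟.sharp (ψ.2.1 p) p) = _
  rw [map_add, dproj_hlift, 𝓟.dproj_sharp, add_zero]

lemma form_incl : A.form p ((A.incl ψ).1 p) = ψ.2.1 p := by
  change A.form p (A.hlift p (ψ.1 (𝓟.proj p)) + 𝓟.sharp (ψ.2.1 p) p) = _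
  rw [map_add, form_hlift, A.form_sharp, zero_add]

lemma dproj_lift : 𝓟.dproj p ((A.lift Φ).1 p) = 0 := 𝓟.dproj_sharp _ p

lemma form_lift : A.form p ((A.lift Φ).1 p) = Φ p := A.form_sharp _ p

lemma incl_snd (v : TangentSpace 𝓘(ℝ, EP) p) : (A.incl ψ).2 p v =
    ψ.2.2 (𝓟.proj p) (𝓟.dproj p v) + 1 / 2 * killing G (ψ.2.1 p) (A.form p v) := rfl

lemma lift_snd (v : TangentSpace 𝓘(ℝ, EP) p) : (A.lift Φ).2 p v =
    -(1 / 2 * killing G (Φ p) (A.form p v)) := rfl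

lemma total_pairing (s t : GenSec EP P) :
    (A.total H₀).pairing s t p = t.2 p (s.1 p) + s.2 p (t.1 p) := rfl

variable {ψ ψ'} in
/-- The embedding of the reduced bundle is isometric. -/
lemma pairing_incl_incl (h : 𝓟.AdSection ψ.2.1) (h' : 𝓟.AdSection ψ'.2.1) :
    (A.total H₀).pairing (A.incl ψ) (A.incl ψ') p =
      (A.reduced H₀).pairing ψ ψ' (𝓟.proj p) := by
  rw [total_pairing, incl_snd, incl_snd, dproj_incl, dproj_incl, form_incl, form_incl,
    reduced_pairing_proj h h', killing_comm G (ψ'.2.1 p)]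
  ring

lemma pairing_incl_lift : (A.total H₀).pairing (A.incl ψ) (A.lift Φ) p = 0 := by
  rw [total_pairing, incl_snd, lift_snd, dproj_lift, form_lift, form_incl, map_zero,
    killing_comm G (Φ p)]
  ring

lemma pairing_lift_incl : (A.total H₀).pairing (A.lift Φ) (A.incl ψ) p = 0 := by
  rw [total_pairing, add_comm]
  exact pairing_incl_lift (H₀ := H₀) ψ Φ p

lemma pairing_lift_lift :
    (A.total H₀).pairing (A.lift Φ) (A.lift Φ') p = -killing G (Φ p) (Φ' p) := by
  rw [total_pairing, lift_snd, lift_snd, form_lift, form_lift, killing_comm G (Φ' p)]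
  ring

end Pairing

variable (A H₀) in
lemma total_calculus : SectionCalculus (A.total H₀) := dorfman_calculus

variable (A H₀) in
lemma total_localFrame (p : P) : IsDualFrame (A.total H₀) p
    (localFrame (A.total H₀) p).1 (localFrame (A.total H₀) p).2 := dorfman_localFrame p

/-- Invariant frames: frames of the reduced bundle and of the adjoint bundle combine to a frame of
the generalized tangent bundle of the total space. -/
lemma total_isDualFrame {ι κ : Type*} [Fintype ι] [Fintype κ] [DecidableEq ι] [DecidableEq κ]
    (hι : Fintype.card ι = 2 * Module.finrank ℝ EM + Module.finrank ℝ EG)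
    (hκ : Fintype.card κ = Module.finrank ℝ EG) {p : P} {e ε : ι → RedSec EM EG M P}
    {Φ : κ → P → EG} (he : ∀ i, (A.reduced H₀).Smooth (e i))
    (hε : ∀ i, (A.reduced H₀).Smooth (ε i)) (hΦ : ∀ i, 𝓟.AdSection (Φ i))
    (h : ∀ᶠ y in 𝓝 (𝓟.proj p), ∀ i j,
      (A.reduced H₀).pairing (e i) (ε j) y = if i = j then 1 else 0)
    (h' : ∀ᶠ m in 𝓝 (𝓟.proj p), ∀ q, 𝓟.proj q = m → ∀ i j,
      killing G (Φ i q) (Φ j q) = if i = j then -1 else 0) :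
    IsDualFrame (A.total H₀) p (Sum.elim (fun i => A.incl (e i)) fun i => A.lift (Φ i))
      (Sum.elim (fun i => A.incl (ε i)) fun i => A.lift (Φ i)) := by
  have : Nonempty P := ⟨p⟩
  refine dorfman_isDualFrame (by rw [Fintype.card_sum, hι, hκ, A.finrank_total]; ring) ?_ ?_ ?_
  · rintro (i | i)
    · exact smooth_incl (he i)
    · exact smooth_lift (hΦ i)
  · rintro (i | i)
    · exact smooth_incl (hε i)
    · exact smooth_lift (hΦ i)
  · have hc := 𝓟.smooth_proj.continuous.continuousAt (x := p)
    filter_upwards [hc.eventually h, hc.eventually h'] with y h h'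
    rintro (i | i) (j | j)
    · have := pairing_incl_incl (A := A) (H₀ := H₀) y (he i).2.1 (hε j).2.1
      rw [h] at this
      exact this.trans (by simp)
    · exact (pairing_incl_lift (H₀ := H₀) (e i) (Φ j) y).trans (by simp)
    · exact (pairing_lift_incl (H₀ := H₀) (ε j) (Φ i) y).trans (by simp)
    · have := pairing_lift_lift (A := A) (H₀ := H₀) (Φ i) (Φ j) y
      rw [h' y rfl] at this
      refine this.trans ?_
      simp only [Sum.inr.injEq]
      split_ifs <;> simp

end PrincipalConnection

end Total

/-! ### Connections and brackets on invariant sections -/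

section ReducedConnection

variable {EM EG EP : Type*}
  [NormedAddCommGroup EM] [NormedSpace ℝ EM] [FiniteDimensional ℝ EM]
  [NormedAddCommGroup EG] [NormedSpace ℝ EG] [FiniteDimensional ℝ EG] [CompleteSpace EG]
  [NormedAddCommGroup EP] [NormedSpace ℝ EP] [FiniteDimensional ℝ EP]
  {M G P : Type*}
  [TopologicalSpace M] [ChartedSpace EM M] [IsManifold 𝓘(ℝ, EM) ∞ M] [T2Space M]
  [TopologicalSpace G] [ChartedSpace EG G] [Group G] [LieGroup 𝓘(ℝ, EG) ∞ G] [T2Space G]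
  [CompactSpace G] [LieAlgebra.IsSemisimple ℝ (GroupLieAlgebra 𝓘(ℝ, EG) G)]
  [TopologicalSpace P] [ChartedSpace EP P] [IsManifold 𝓘(ℝ, EP) ∞ P] [T2Space P]
  {𝓟 : PrincipalBundle EM EG EP M G P} {A : PrincipalConnection 𝓟} {H₀ : ThreeForm EM M}

namespace PrincipalConnection

/-- Torsion free connections on the total and on the reduced bundle which are related by
reduction. -/
structure IsReduction (A : PrincipalConnection 𝓟) (H₀ : ThreeForm EM M)
    (nab : GenSec EP P → GenSec EP P → GenSec EP P)
    (nab' : RedSec EM EG M P → RedSec EM EG M P → RedSec EM EG M P) : Prop where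
  total : IsTorsionFree (A.total H₀) nab
  reduced : IsTorsionFree (A.reduced H₀) nab'
  relevant : A.RelevantForReduction H₀ nab nab'

variable (A) in
/-- The representation `D_X Φ - [Ψ, Φ]` of a section `(X, Ψ, ξ)` of the reduced bundle on sections of
the adjoint bundle. -/
def act (ψ : RedSec EM EG M P) (Φ : P → EG) (p : P) : EG :=
  A.covD Φ p (ψ.1 (𝓟.proj p)) - adj G (ψ.2.1 p) (Φ p)

variable {ψ ψ' : RedSec EM EG M P} {Φ Φ' Φ'' : P → EG}

lemma adSection_act (hψ : (A.reduced H₀).Smooth ψ) (hΦ : 𝓟.AdSection Φ) :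
    𝓟.AdSection (A.act ψ Φ) := (A.adSection_covD hψ.1 hΦ).sub (hψ.2.1.adj hΦ)

/-- The representation is by derivations of the bracket of the adjoint bundle. -/
lemma act_adj (hΦ : 𝓟.AdSection Φ) (hΦ' : 𝓟.AdSection Φ') (p : P) :
    A.act ψ (fun q => adj G (Φ q) (Φ' q)) p =
      adj G (A.act ψ Φ p) (Φ' p) + adj G (Φ p) (A.act ψ Φ' p) := by
  simp only [act]
  rw [covD_adj A hΦ hΦ', adj_adj, map_sub, sub_eq_add_neg (A.covD Φ p _), adj_add_left,
    ← neg_one_smul ℝ, adj_smul_left, neg_one_smul]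
  abel

lemma covD_zero (p : P) (u : TangentSpace 𝓘(ℝ, EM) (𝓟.proj p)) :
    A.covD (0 : P → EG) p u = 0 := by
  change diff (0 : P → EG) p (A.hlift p u) = 0
  have : (0 : P → EG) = fun _ => 0 := rfl
  rw [this, diff, mfderiv_const]
  rfl

lemma adj_zero_left (x : EG) : adj G 0 x = 0 := by
  rw [adj_swap, map_zero, neg_zero]

lemma smooth_reduced_zero : (A.reduced H₀).Smooth 0 := (reduced_calculus A H₀).smooth_zero

namespace IsReduction

variable {nab : GenSec EP P → GenSec EP P → GenSec EP P}
  {nab' : RedSec EM EG M P → RedSec EM EG M P → RedSec EM EG M P}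
  (h : A.IsReduction H₀ nab nab')
include h

lemma nab_incl_incl (hψ : (A.reduced H₀).Smooth ψ) (hψ' : (A.reduced H₀).Smooth ψ') :
    nab (A.incl ψ) (A.incl ψ') = A.incl (nab' ψ ψ') := by
  have h1 := h.relevant ψ ψ' 0 0 hψ hψ' PrincipalBundle.AdSection.zero
    PrincipalBundle.AdSection.zero
  have h2 : (fun p => A.covD (0 : P → EG) p (ψ.1 (𝓟.proj p)) - adj G (ψ.2.1 p) ((0 : P → EG) p) -
      (2 / 3 : ℝ) • adj G ((0 : P → EG) p) ((0 : P → EG) p)) = 0 := by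
    ext p
    rw [covD_zero, Pi.zero_apply, map_zero, map_zero, sub_zero, smul_zero, sub_zero]
  rw [h2, lift_zero, add_zero, add_zero, add_zero] at h1
  exact h1

lemma nab_incl_lift (hψ : (A.reduced H₀).Smooth ψ) (hΦ : 𝓟.AdSection Φ) :
    nab (A.incl ψ) (A.lift Φ) = A.lift (A.act ψ Φ) := by
  have h1 := h.relevant ψ 0 0 Φ hψ smooth_reduced_zero PrincipalBundle.AdSection.zero hΦ
  have h2 : (fun p => A.covD Φ p (ψ.1 (𝓟.proj p)) - adj G (ψ.2.1 p) (Φ p) -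
      (2 / 3 : ℝ) • adj G ((0 : P → EG) p) (Φ p)) = A.act ψ Φ := by
    ext p
    rw [Pi.zero_apply, adj_zero_left, smul_zero, sub_zero]
    rfl
  rw [h2, lift_zero, incl_zero, add_zero, zero_add,
    h.reduced.isConnection.zero_right (reduced_calculus A H₀) hψ, incl_zero, zero_add] at h1
  exact h1

lemma nab_lift_incl (hΦ : 𝓟.AdSection Φ) (hψ : (A.reduced H₀).Smooth ψ) :
    nab (A.lift Φ) (A.incl ψ) = 0 := by
  have h1 := h.relevant 0 ψ Φ 0 smooth_reduced_zero hψ hΦ PrincipalBundle.AdSection.zero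
  have h2 : (fun p => A.covD (0 : P → EG) p ((0 : RedSec EM EG M P).1 (𝓟.proj p)) -
      adj G ((0 : RedSec EM EG M P).2.1 p) ((0 : P → EG) p) -
      (2 / 3 : ℝ) • adj G (Φ p) ((0 : P → EG) p)) = 0 := by
    ext p
    rw [covD_zero, Pi.zero_apply, map_zero, map_zero, sub_zero, smul_zero, sub_zero]
  rw [h2, lift_zero, incl_zero, add_zero, zero_add, add_zero,
    h.reduced.isConnection.zero_left (reduced_calculus A H₀) hψ, incl_zero] at h1
  exact h1

lemma nab_lift_lift (hΦ : 𝓟.AdSection Φ) (hΦ' : 𝓟.AdSection Φ') :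
    nab (A.lift Φ) (A.lift Φ') = A.lift (fun p => (-(2 / 3) : ℝ) • adj G (Φ p) (Φ' p)) := by
  have h1 := h.relevant 0 0 Φ Φ' smooth_reduced_zero smooth_reduced_zero hΦ hΦ'
  have h2 : (fun p => A.covD Φ' p ((0 : RedSec EM EG M P).1 (𝓟.proj p)) -
      adj G ((0 : RedSec EM EG M P).2.1 p) (Φ' p) -
      (2 / 3 : ℝ) • adj G (Φ p) (Φ' p)) = fun p => (-(2 / 3) : ℝ) • adj G (Φ p) (Φ' p) := by
    ext p
    have e1 : A.covD Φ' p ((0 : RedSec EM EG M P).1 (𝓟.proj p)) = 0 := map_zero (A.covD Φ' p)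
    have e2 : adj G ((0 : RedSec EM EG M P).2.1 p) (Φ' p) = 0 := adj_zero_left _
    rw [e1, e2, sub_zero, zero_sub, neg_smul]
  rw [h2, incl_zero, zero_add, zero_add, h.reduced.isConnection.zero_right (reduced_calculus A H₀)
    smooth_reduced_zero, incl_zero, zero_add] at h1
  exact h1

end IsReduction

/-- Smooth sections of the generalized tangent bundle of the total space are determined by their
pairings with invariant sections. -/
lemma ext_invariant {s t : GenSec EP P} (hs : (A.total H₀).Smooth s) (ht : (A.total H₀).Smooth t)
    (h1 : ∀ ψ, (A.reduced H₀).Smooth ψ →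
      (A.total H₀).pairing s (A.incl ψ) = (A.total H₀).pairing t (A.incl ψ))
    (h2 : ∀ Φ, 𝓟.AdSection Φ →
      (A.total H₀).pairing s (A.lift Φ) = (A.total H₀).pairing t (A.lift Φ)) : s = t := by
  refine (total_calculus A H₀).ext _ _ hs ht fun χ hχ => funext fun p => ?_
  obtain ⟨e, ε, he, hε, hee⟩ := exists_reduced_frame A H₀ (𝓟.proj p)
  obtain ⟨Φ, hΦ, hΦΦ⟩ := exists_adSection_frame 𝓟 p
  have hF := total_isDualFrame (A := A) (H₀ := H₀) (by simp [two_mul]) (Fintype.card_fin _) he hε hΦ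
    hee hΦΦ
  rw [hF.complete.self_of_nhds s χ hs hχ, hF.complete.self_of_nhds t χ ht hχ]
  refine Finset.sum_congr rfl fun i _ => ?_
  rcases i with i | i
  · simp only [Sum.elim_inl, h1 _ (hε i)]
  · simp only [Sum.elim_inr, h2 _ (hΦ i)]

lemma reduced_bracket_fst : ((A.reduced H₀).bracket (0, Φ, 0) (0, Φ', 0)).1 = 0 := by
  ext m
  exact congrFun (VectorField.mlieBracket_zero_left) m

lemma reduced_bracket_adjoint : ((A.reduced H₀).bracket (0, Φ, 0) (0, Φ', 0)).2.1 =
    fun p => -adj G (Φ p) (Φ' p) := by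
  ext p
  change A.covD Φ' p 0 - A.covD Φ p 0 - A.curvature p 0 0 - adj G (Φ p) (Φ' p) = _
  rw [map_zero, map_zero, map_zero]
  simp

lemma curvature_zero_left (p : P) : A.curvature p 0 = 0 := by
  have h1 : A.curvatureForm p 0 = 0 := by
    ext v
    change extDerivOne A.form p 0 v + adj G (A.form p 0) (A.form p v) = 0
    rw [map_zero, map_zero, adj_zero_left, add_zero]
    rfl
  rw [curvature, map_zero, h1, ContinuousLinearMap.zero_comp]

lemma mixedForm_zero_apply (Φ Φ' : P → EG) (m : M) (v : TangentSpace 𝓘(ℝ, EM) m) :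
    A.mixedForm 0 0 Φ Φ' m v =
      killing G (Φ' (𝓟.fibrePoint m)) (A.covD Φ (𝓟.fibrePoint m) (v : EM)) := by
  refine (congrArg (fun T : EM →L[ℝ] ℝ => T v)
    (𝓟.descend_apply (V := EM →L[ℝ] ℝ) _ m)).trans ?_
  have h1 : ∀ (q : P) (x : EG), (killing G x).comp (A.curvature q 0) = 0 := fun q x => by
    rw [curvature_zero_left, ContinuousLinearMap.comp_zero]
  have h2 : ∀ q : P, (killing G (Φ' q)).comp (A.curvature q 0) -
      (killing G (Φ q)).comp (A.curvature q 0) + (killing G (Φ' q)).comp (A.covD Φ q) =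
      (killing G (Φ' q)).comp (A.covD Φ q) := fun q => by rw [h1, h1, sub_zero, zero_add]
  exact congrArg (fun T : EM →L[ℝ] ℝ => T v) (h2 (𝓟.fibrePoint m))

lemma reduced_bracket_covector (m : M) (v : TangentSpace 𝓘(ℝ, EM) m) :
    ((A.reduced H₀).bracket (0, Φ, 0) (0, Φ', 0)).2.2 m v =
      killing G (Φ' (𝓟.fibrePoint m)) (A.covD Φ (𝓟.fibrePoint m) (v : EM)) := by
  rw [← mixedForm_zero_apply Φ Φ' m v]
  have h1 : (fun q : M => (0 : Π m : M, TangentSpace 𝓘(ℝ, EM) m →L[ℝ] ℝ) q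
      ((0 : Π m : M, TangentSpace 𝓘(ℝ, EM) m) q)) = fun _ => 0 := rfl
  change (extDerivOne 0 m 0 v + diff (fun q : M => (0 : Π m : M, TangentSpace 𝓘(ℝ, EM) m →L[ℝ] ℝ) q
      ((0 : Π m : M, TangentSpace 𝓘(ℝ, EM) m) q)) m v) - extDerivOne 0 m 0 v - H₀.val m 0 0 v + _ = _
  rw [h1, diff, mfderiv_const, map_zero, map_zero]
  change 0 + 0 - 0 - 0 + _ = _
  simp

/-- The bracket of two sections of the adjoint bundle, as a section of the reduced bundle, encodes
the representation of the reduced bundle on the adjoint bundle. -/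
lemma reduced_bracket_pairing (hΦ : 𝓟.AdSection Φ) (hΦ' : 𝓟.AdSection Φ')
    (hψ : (A.reduced H₀).Smooth ψ) (p : P) :
    (A.reduced H₀).pairing ((A.reduced H₀).bracket (0, Φ, 0) (0, Φ', 0)) ψ (𝓟.proj p) =
      killing G (A.act ψ Φ p) (Φ' p) := by
  set q := 𝓟.fibrePoint (𝓟.proj p) with hq
  obtain ⟨g, hg⟩ := 𝓟.exists_act_eq (p := p) (q := q) (𝓟.proj_fibrePoint _)
  rw [← (adSection_act hψ hΦ).killing_act hΦ' p g, hg, reduced_pairing, reduced_bracket_fst,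
    reduced_bracket_adjoint, reduced_bracket_covector, ← hq, act]
  have h1 : (ψ.1 (𝓟.proj p) : EM) = ψ.1 (𝓟.proj q) :=
    congrArg (fun m => (ψ.1 m : EM)) (𝓟.proj_fibrePoint (𝓟.proj p)).symm
  have h2 : A.covD Φ q (ψ.1 (𝓟.proj p) : EM) = A.covD Φ q (ψ.1 (𝓟.proj q)) :=
    congrArg (A.covD Φ q) h1
  rw [h2, Pi.zero_apply, map_zero, killing_comm G (-_), map_neg,
    killing_comm G (ψ.2.1 q), killing_adj, killing_comm G _ (Φ' q), map_sub,
    ← killing_adj G (Φ' q) (ψ.2.1 q), killing_comm G (adj G (Φ' q) (ψ.2.1 q))]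
  ring

namespace IsReduction

variable {nab : GenSec EP P → GenSec EP P → GenSec EP P}
  {nab' : RedSec EM EG M P → RedSec EM EG M P → RedSec EM EG M P}
  (h : A.IsReduction H₀ nab nab')
include h

/-- The bracket of a torsion free connection is determined by the connection, on both algebroids. -/
lemma bracket_incl_incl (hψ : (A.reduced H₀).Smooth ψ) (hψ' : (A.reduced H₀).Smooth ψ') :
    (A.total H₀).bracket (A.incl ψ) (A.incl ψ') = A.incl ((A.reduced H₀).bracket ψ ψ') := by
  have hc := h.reduced.isConnection.smooth
  have hb := h.reduced.bracket_smooth (reduced_calculus A H₀) hψ hψ'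
  refine ext_invariant (H₀ := H₀) (h.total.bracket_smooth (total_calculus A H₀) (smooth_incl hψ)
    (smooth_incl hψ')) (smooth_incl hb) (fun χ hχ => ?_) (fun Φ hΦ => ?_)
  · rw [h.total.pairing_bracket (total_calculus A H₀) (smooth_incl hψ) (smooth_incl hψ')
      (smooth_incl hχ), h.nab_incl_incl hψ hψ', h.nab_incl_incl hψ' hψ, h.nab_incl_incl hχ hψ]
    ext p
    simp only [Pi.add_apply, Pi.sub_apply]
    rw [pairing_incl_incl p (hc _ _ hψ hψ').2.1 hχ.2.1, pairing_incl_incl p (hc _ _ hψ' hψ).2.1 hχ.2.1,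
      pairing_incl_incl p (hc _ _ hχ hψ).2.1 hψ'.2.1, pairing_incl_incl p hb.2.1 hχ.2.1,
      h.reduced.pairing_bracket (reduced_calculus A H₀) hψ hψ' hχ]
    rfl
  · rw [h.total.pairing_bracket (total_calculus A H₀) (smooth_incl hψ) (smooth_incl hψ')
      (smooth_lift hΦ), h.nab_incl_incl hψ hψ', h.nab_incl_incl hψ' hψ, h.nab_lift_incl hΦ hψ,
      (total_calculus A H₀).pairing_zero]
    ext p
    simp only [Pi.add_apply, Pi.sub_apply, Pi.zero_apply]
    rw [pairing_incl_lift, pairing_incl_lift, pairing_incl_lift]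
    ring

lemma bracket_incl_lift (hψ : (A.reduced H₀).Smooth ψ) (hΦ : 𝓟.AdSection Φ) :
    (A.total H₀).bracket (A.incl ψ) (A.lift Φ) = A.lift (A.act ψ Φ) := by
  have hc := h.reduced.isConnection.smooth
  have ha := adSection_act hψ hΦ
  refine ext_invariant (H₀ := H₀) (h.total.bracket_smooth (total_calculus A H₀) (smooth_incl hψ)
    (smooth_lift hΦ)) (smooth_lift ha) (fun χ hχ => ?_) (fun Ψ hΨ => ?_)
  · rw [h.total.pairing_bracket (total_calculus A H₀) (smooth_incl hψ) (smooth_lift hΦ)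
      (smooth_incl hχ), h.nab_incl_lift hψ hΦ, h.nab_lift_incl hΦ hψ, h.nab_incl_incl hχ hψ,
      (total_calculus A H₀).pairing_zero]
    ext p
    simp only [Pi.add_apply, Pi.sub_apply, Pi.zero_apply]
    rw [pairing_incl_lift, pairing_lift_incl]
    ring
  · rw [h.total.pairing_bracket (total_calculus A H₀) (smooth_incl hψ) (smooth_lift hΦ)
      (smooth_lift hΨ), h.nab_incl_lift hψ hΦ, h.nab_lift_incl hΦ hψ, h.nab_lift_incl hΨ hψ,
      (total_calculus A H₀).pairing_zero, (total_calculus A H₀).pairing_zero, sub_zero, add_zero]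

lemma bracket_lift_incl (hψ : (A.reduced H₀).Smooth ψ) (hΦ : 𝓟.AdSection Φ) :
    (A.total H₀).bracket (A.lift Φ) (A.incl ψ) = -A.lift (A.act ψ Φ) := by
  have hc := h.reduced.isConnection.smooth
  have ha := adSection_act hψ hΦ
  refine ext_invariant (H₀ := H₀) (h.total.bracket_smooth (total_calculus A H₀) (smooth_lift hΦ)
    (smooth_incl hψ)) ((total_calculus A H₀).smooth_neg _ (smooth_lift ha)) (fun χ hχ => ?_)
    (fun Ψ hΨ => ?_)
  · rw [h.total.pairing_bracket (total_calculus A H₀) (smooth_lift hΦ) (smooth_incl hψ)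
      (smooth_incl hχ), h.nab_incl_lift hψ hΦ, h.nab_lift_incl hΦ hψ, h.nab_incl_lift hχ hΦ,
      (total_calculus A H₀).pairing_zero, (total_calculus A H₀).pairing_neg]
    ext p
    simp only [Pi.add_apply, Pi.sub_apply, Pi.zero_apply, Pi.neg_apply]
    rw [pairing_lift_incl, pairing_lift_incl]
    ring
  · rw [h.total.pairing_bracket (total_calculus A H₀) (smooth_lift hΦ) (smooth_incl hψ)
      (smooth_lift hΨ), h.nab_incl_lift hψ hΦ, h.nab_lift_incl hΦ hψ, h.nab_lift_lift hΨ hΦ,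
      (total_calculus A H₀).pairing_zero, (total_calculus A H₀).pairing_neg]
    ext p
    simp only [Pi.add_apply, Pi.sub_apply, Pi.zero_apply, Pi.neg_apply]
    rw [pairing_lift_incl]
    ring

/-- The bracket on `Γ_G(K)` has a component in `K^⊥`, since differentiating along the reduced bundle
contributes to the torsion. -/
lemma bracket_lift_lift (hΦ : 𝓟.AdSection Φ) (hΦ' : 𝓟.AdSection Φ') :
    (A.total H₀).bracket (A.lift Φ) (A.lift Φ') =
      -A.incl ((A.reduced H₀).bracket (0, Φ, 0) (0, Φ', 0)) +
        A.lift (fun p => (-2 : ℝ) • adj G (Φ p) (Φ' p)) := by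
  have hr : ∀ {Ψ : P → EG}, 𝓟.AdSection Ψ → (A.reduced H₀).Smooth (0, Ψ, 0) := fun hΨ =>
    ⟨SmoothVF.zero, hΨ, SmoothForm.zero⟩
  have hb := h.reduced.bracket_smooth (reduced_calculus A H₀) (hr hΦ) (hr hΦ')
  have hs : 𝓟.AdSection (fun p => (-2 : ℝ) • adj G (Φ p) (Φ' p)) := (hΦ.adj hΦ').const_smul _
  have ct := total_calculus A H₀
  refine ext_invariant (H₀ := H₀) (h.total.bracket_smooth ct (smooth_lift hΦ)
    (smooth_lift hΦ')) (ct.smooth_add _ _ (ct.smooth_neg _ (smooth_incl hb)) (smooth_lift hs))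
    (fun χ hχ => ?_) (fun Ψ hΨ => ?_)
  · rw [h.total.pairing_bracket ct (smooth_lift hΦ) (smooth_lift hΦ')
      (smooth_incl hχ), h.nab_lift_lift hΦ hΦ', h.nab_lift_lift hΦ' hΦ, h.nab_incl_lift hχ hΦ,
      ct.pairing_add, ct.pairing_neg]
    ext p
    simp only [Pi.add_apply, Pi.sub_apply, Pi.neg_apply]
    rw [pairing_lift_incl, pairing_lift_incl, pairing_lift_incl, pairing_lift_lift,
      pairing_incl_incl p hb.2.1 hχ.2.1, reduced_bracket_pairing hΦ hΦ' hχ]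
    ring
  · rw [h.total.pairing_bracket ct (smooth_lift hΦ) (smooth_lift hΦ')
      (smooth_lift hΨ), h.nab_lift_lift hΦ hΦ', h.nab_lift_lift hΦ' hΦ, h.nab_lift_lift hΨ hΦ,
      ct.pairing_add, ct.pairing_neg]
    ext p
    simp only [Pi.add_apply, Pi.sub_apply, Pi.neg_apply]
    rw [pairing_lift_lift, pairing_lift_lift, pairing_lift_lift, pairing_lift_lift,
      pairing_incl_lift, killing_smul, killing_smul, killing_smul, killing_smul,
      adj_swap G (Φ p) (Φ' p), ← neg_one_smul ℝ (adj G (Φ p) (Φ' p)), killing_smul,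
      killing_adj G (Ψ p), killing_comm G (Ψ p)]
    ring

end IsReduction

end PrincipalConnection

end ReducedConnection

/-! ### Curvature on invariant sections -/

/-- The trace of an endomorphism in terms of biorthogonal families. -/
lemma trace_eq_sum_of_biorthogonal {W ι : Type*} [AddCommGroup W] [Module ℝ W]
    [FiniteDimensional ℝ W] [Fintype ι] [DecidableEq ι] (B : W →ₗ[ℝ] W →ₗ[ℝ] ℝ) {e ε : ι → W}
    (hcard : Fintype.card ι = Module.finrank ℝ W)
    (h : ∀ i j, B (e i) (ε j) = if i = j then 1 else 0) (L : W →ₗ[ℝ] W) :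
    LinearMap.trace ℝ W L = ∑ i, B (e i) (L (ε i)) := by
  have hli : LinearIndependent ℝ ε := by
    rw [Fintype.linearIndependent_iff]
    intro g hg j
    have := congrArg (fun w => B (e j) w) hg
    simpa [map_sum, h] using this
  let b := basisOfLinearIndependentOfCardEqFinrank' ε hli hcard
  have hb : ∀ i, b i = ε i := fun i => by simp [b]
  have hc : ∀ w j, B (e j) w = b.repr w j := fun w j => by
    conv_lhs => rw [← b.sum_repr w]
    simp [map_sum, hb, h]
  rw [LinearMap.trace_eq_matrix_trace ℝ b, Matrix.trace]
  refine Finset.sum_congr rfl fun i _ => ?_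
  rw [Matrix.diag_apply, LinearMap.toMatrix_apply, hc, hb]

section Curvature

variable {EM EG EP : Type*}
  [NormedAddCommGroup EM] [NormedSpace ℝ EM] [FiniteDimensional ℝ EM]
  [NormedAddCommGroup EG] [NormedSpace ℝ EG] [FiniteDimensional ℝ EG] [CompleteSpace EG]
  [NormedAddCommGroup EP] [NormedSpace ℝ EP] [FiniteDimensional ℝ EP]
  {M G P : Type*}
  [TopologicalSpace M] [ChartedSpace EM M] [IsManifold 𝓘(ℝ, EM) ∞ M] [T2Space M]
  [TopologicalSpace G] [ChartedSpace EG G] [Group G] [LieGroup 𝓘(ℝ, EG) ∞ G] [T2Space G]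
  [CompactSpace G] [LieAlgebra.IsSemisimple ℝ (GroupLieAlgebra 𝓘(ℝ, EG) G)]
  [TopologicalSpace P] [ChartedSpace EP P] [IsManifold 𝓘(ℝ, EP) ∞ P] [T2Space P]
  {𝓟 : PrincipalBundle EM EG EP M G P} {A : PrincipalConnection 𝓟} {H₀ : ThreeForm EM M}

namespace PrincipalConnection

lemma smooth_adjoint {Φ : P → EG} (hΦ : 𝓟.AdSection Φ) : (A.reduced H₀).Smooth (0, Φ, 0) :=
  ⟨SmoothVF.zero, hΦ, SmoothForm.zero⟩

variable (A H₀) in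
/-- The invariant sections which belong to one of the two summands. -/
def IsPure (a : GenSec EP P) : Prop :=
  (∃ ψ, (A.reduced H₀).Smooth ψ ∧ a = A.incl ψ) ∨ ∃ Φ, 𝓟.AdSection Φ ∧ a = A.lift Φ

lemma isPure_incl {ψ : RedSec EM EG M P} (hψ : (A.reduced H₀).Smooth ψ) :
    A.IsPure H₀ (A.incl ψ) := Or.inl ⟨ψ, hψ, rfl⟩

lemma isPure_lift {Φ : P → EG} (hΦ : 𝓟.AdSection Φ) : A.IsPure H₀ (A.lift Φ) :=
  Or.inr ⟨Φ, hΦ, rfl⟩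

lemma IsPure.smooth {a : GenSec EP P} (ha : A.IsPure H₀ a) : (A.total H₀).Smooth a := by
  rcases ha with ⟨ψ, hψ, rfl⟩ | ⟨Φ, hΦ, rfl⟩
  · exact smooth_incl hψ
  · exact smooth_lift hΦ

variable (A H₀) in
/-- A frame of the generalized tangent bundle near `p` which consists of a frame `e` of the reduced
bundle with dual frame `ε` and of a frame `Φ` of the adjoint bundle which is orthonormal for the
negative of the Killing form.  The sections `A.lift (Φ i)` are orthonormal, hence self-dual. -/
structure InvariantFrame (p : P) {ι κ : Type*} [Fintype ι] [Fintype κ] [DecidableEq ι]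
    [DecidableEq κ] (e ε : ι → RedSec EM EG M P) (Φ : κ → P → EG) : Prop where
  smooth_left : ∀ i, (A.reduced H₀).Smooth (e i)
  smooth_right : ∀ i, (A.reduced H₀).Smooth (ε i)
  adSection : ∀ i, 𝓟.AdSection (Φ i)
  card : Fintype.card κ = Module.finrank ℝ EG
  killing_eq : ∀ i j, killing G (Φ i p) (Φ j p) = if i = j then -1 else 0
  reduced : IsDualFrame (A.reduced H₀) (𝓟.proj p) e ε
  total : IsDualFrame (A.total H₀) p (Sum.elim (fun i => A.incl (e i)) fun i => A.lift (Φ i))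
      (Sum.elim (fun i => A.incl (ε i)) fun i => A.lift (Φ i))

variable (A H₀) in
lemma exists_invariantFrame (p : P) : ∃ (ι κ : Type) (_ : Fintype ι) (_ : Fintype κ)
    (_ : DecidableEq ι) (_ : DecidableEq κ) (e ε : ι → RedSec EM EG M P) (Φ : κ → P → EG),
    A.InvariantFrame H₀ p e ε Φ := by
  obtain ⟨e, ε, he, hε, hee⟩ := exists_reduced_frame A H₀ (𝓟.proj p)
  obtain ⟨Φ, hΦ, hΦΦ⟩ := exists_adSection_frame 𝓟 p
  exact ⟨_, _, _, _, _, _, e, ε, Φ, he, hε, hΦ, Fintype.card_fin _, hΦΦ.self_of_nhds p rfl,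
    reduced_isDualFrame (by simp [two_mul]) he hε hee,
    total_isDualFrame (by simp [two_mul]) (Fintype.card_fin _) he hε hΦ hee hΦΦ⟩

namespace IsReduction

variable {nab : GenSec EP P → GenSec EP P → GenSec EP P}
  {nab' : RedSec EM EG M P → RedSec EM EG M P → RedSec EM EG M P}
  (h : A.IsReduction H₀ nab nab') {ψ ψ' χ χ' : RedSec EM EG M P} {Φ Φ' Φ₁ Φ₂ : P → EG}
  {a b s : GenSec EP P}
include h

lemma nab_incl (ha : A.IsPure H₀ a) (hψ : (A.reduced H₀).Smooth ψ) :
    ∃ ψ', (A.reduced H₀).Smooth ψ' ∧ nab a (A.incl ψ) = A.incl ψ' := by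
  rcases ha with ⟨χ, hχ, rfl⟩ | ⟨Φ, hΦ, rfl⟩
  · exact ⟨_, h.reduced.isConnection.smooth _ _ hχ hψ, h.nab_incl_incl hχ hψ⟩
  · exact ⟨0, smooth_reduced_zero, by rw [h.nab_lift_incl hΦ hψ, incl_zero]⟩

lemma nab_lift (ha : A.IsPure H₀ a) (hΦ : 𝓟.AdSection Φ) :
    ∃ Φ', 𝓟.AdSection Φ' ∧ nab a (A.lift Φ) = A.lift Φ' := by
  rcases ha with ⟨χ, hχ, rfl⟩ | ⟨Φ', hΦ', rfl⟩
  · exact ⟨_, adSection_act hχ hΦ, h.nab_incl_lift hχ hΦ⟩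
  · exact ⟨_, (hΦ'.adj hΦ).const_smul _, h.nab_lift_lift hΦ' hΦ⟩

lemma pairing_nab_incl_lift_of_isPure (ha : A.IsPure H₀ a) (hψ : (A.reduced H₀).Smooth ψ) (p : P) :
    (A.total H₀).pairing (nab a (A.incl ψ)) (A.lift Φ) p = 0 := by
  obtain ⟨ψ', -, h1⟩ := h.nab_incl ha hψ
  rw [h1, pairing_incl_lift]

lemma pairing_nab_lift_incl_of_isPure (ha : A.IsPure H₀ a) (hΦ : 𝓟.AdSection Φ) (p : P) :
    (A.total H₀).pairing (nab a (A.lift Φ)) (A.incl ψ) p = 0 := by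
  obtain ⟨Φ', -, h1⟩ := h.nab_lift ha hΦ
  rw [h1, pairing_lift_incl]

/-- The connection preserves the two summands, also in directions which are not invariant. -/
lemma pairing_nab_incl_lift (hs : (A.total H₀).Smooth s) (hψ : (A.reduced H₀).Smooth ψ) (p : P) :
    (A.total H₀).pairing (nab s (A.incl ψ)) (A.lift Φ) p = 0 := by
  obtain ⟨ι, κ, _, _, _, _, e, ε, Ψ, hF⟩ := exists_invariantFrame A H₀ p
  rw [(h.total.isConnection.tensorial_left (total_calculus A H₀) (φ' := A.lift Φ)
    (smooth_incl hψ) p).expand (total_calculus A H₀) hF.total hs, Fintype.sum_sum_type]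
  simp only [Sum.elim_inl, Sum.elim_inr,
    h.pairing_nab_incl_lift_of_isPure (isPure_incl (hF.smooth_left _)) hψ,
    h.pairing_nab_incl_lift_of_isPure (isPure_lift (hF.adSection _)) hψ]
  simp

lemma pairing_nab_lift_incl (hs : (A.total H₀).Smooth s) (hΦ : 𝓟.AdSection Φ) (p : P) :
    (A.total H₀).pairing (nab s (A.lift Φ)) (A.incl ψ) p = 0 := by
  obtain ⟨ι, κ, _, _, _, _, e, ε, Ψ, hF⟩ := exists_invariantFrame A H₀ p
  rw [(h.total.isConnection.tensorial_left (total_calculus A H₀) (φ' := A.incl ψ)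
    (smooth_lift hΦ) p).expand (total_calculus A H₀) hF.total hs, Fintype.sum_sum_type]
  simp only [Sum.elim_inl, Sum.elim_inr,
    h.pairing_nab_lift_incl_of_isPure (isPure_incl (hF.smooth_left _)) hΦ,
    h.pairing_nab_lift_incl_of_isPure (isPure_lift (hF.adSection _)) hΦ]
  simp

lemma naiveCurvature_lift_incl (hψ : (A.reduced H₀).Smooth ψ) (ha : A.IsPure H₀ a)
    (hb : A.IsPure H₀ b) (p : P) :
    naiveCurvature (A.total H₀) nab (A.lift Φ) (A.incl ψ) a b p = 0 := by
  rw [h.total.naiveCurvature_apply (total_calculus A H₀)]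
  obtain ⟨ψ₁, h₁, e₁⟩ := h.nab_incl ha hψ
  obtain ⟨ψ₂, h₂, e₂⟩ := h.nab_incl hb hψ
  rw [e₁, e₂, h.pairing_nab_incl_lift ha.smooth h₂, h.pairing_nab_incl_lift hb.smooth h₁,
    h.pairing_nab_incl_lift (h.total.bracket_smooth (total_calculus A H₀) ha.smooth hb.smooth) hψ]
  simp

lemma naiveCurvature_incl_lift (hΦ : 𝓟.AdSection Φ) (ha : A.IsPure H₀ a)
    (hb : A.IsPure H₀ b) (p : P) :
    naiveCurvature (A.total H₀) nab (A.incl ψ) (A.lift Φ) a b p = 0 := by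
  rw [h.total.naiveCurvature_apply (total_calculus A H₀)]
  obtain ⟨ψ₁, h₁, e₁⟩ := h.nab_lift ha hΦ
  obtain ⟨ψ₂, h₂, e₂⟩ := h.nab_lift hb hΦ
  rw [e₁, e₂, h.pairing_nab_lift_incl ha.smooth h₂, h.pairing_nab_lift_incl hb.smooth h₁,
    h.pairing_nab_lift_incl (h.total.bracket_smooth (total_calculus A H₀) ha.smooth hb.smooth) hΦ]
  simp

lemma naiveCurvature_incl (hψ : (A.reduced H₀).Smooth ψ) (hψ' : (A.reduced H₀).Smooth ψ')
    (hχ : (A.reduced H₀).Smooth χ) (hχ' : (A.reduced H₀).Smooth χ') (p : P) :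
    naiveCurvature (A.total H₀) nab (A.incl ψ') (A.incl ψ) (A.incl χ) (A.incl χ') p =
      naiveCurvature (A.reduced H₀) nab' ψ' ψ χ χ' (𝓟.proj p) := by
  have hc := h.reduced.isConnection.smooth
  have hb := h.reduced.bracket_smooth (reduced_calculus A H₀) hχ hχ'
  rw [h.total.naiveCurvature_apply (total_calculus A H₀),
    h.reduced.naiveCurvature_apply (reduced_calculus A H₀), h.bracket_incl_incl hχ hχ',
    h.nab_incl_incl hχ hψ, h.nab_incl_incl hχ' hψ, h.nab_incl_incl hχ (hc _ _ hχ' hψ),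
    h.nab_incl_incl hχ' (hc _ _ hχ hψ), h.nab_incl_incl hb hψ,
    pairing_incl_incl p (hc _ _ hχ (hc _ _ hχ' hψ)).2.1 hψ'.2.1,
    pairing_incl_incl p (hc _ _ hχ' (hc _ _ hχ hψ)).2.1 hψ'.2.1,
    pairing_incl_incl p (hc _ _ hb hψ).2.1 hψ'.2.1]

lemma nab_zero_right (hs : (A.total H₀).Smooth s) : nab s 0 = 0 :=
  h.total.isConnection.zero_right (total_calculus A H₀) hs

lemma nab_neg_left (ha : (A.total H₀).Smooth a) (hs : (A.total H₀).Smooth s) :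
    nab (-a) s = -nab a s :=
  h.total.isConnection.neg_left (total_calculus A H₀) ha hs

lemma naiveCurvature_incl_mixed (hψ : (A.reduced H₀).Smooth ψ) (hχ : (A.reduced H₀).Smooth χ)
    (hΦ : 𝓟.AdSection Φ) (s : GenSec EP P) (p : P) :
    naiveCurvature (A.total H₀) nab s (A.incl ψ) (A.incl χ) (A.lift Φ) p = 0 := by
  have ct := total_calculus A H₀
  have hc := h.reduced.isConnection.smooth
  rw [h.total.naiveCurvature_apply ct, h.bracket_incl_lift hχ hΦ, h.nab_lift_incl hΦ hψ,
    h.nab_incl_incl hχ hψ, h.nab_zero_right (smooth_incl hχ),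
    h.nab_lift_incl hΦ (hc _ _ hχ hψ), h.nab_lift_incl (adSection_act hχ hΦ) hψ, ct.pairing_zero]
  simp

lemma naiveCurvature_incl_mixed' (hψ : (A.reduced H₀).Smooth ψ) (hχ : (A.reduced H₀).Smooth χ)
    (hΦ : 𝓟.AdSection Φ) (s : GenSec EP P) (p : P) :
    naiveCurvature (A.total H₀) nab s (A.incl ψ) (A.lift Φ) (A.incl χ) p = 0 := by
  have ct := total_calculus A H₀
  have hc := h.reduced.isConnection.smooth
  rw [h.total.naiveCurvature_apply ct, h.bracket_lift_incl hχ hΦ, h.nab_lift_incl hΦ hψ,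
    h.nab_incl_incl hχ hψ, h.nab_zero_right (smooth_incl hχ),
    h.nab_neg_left (smooth_lift (adSection_act hχ hΦ)) (smooth_incl hψ),
    h.nab_lift_incl hΦ (hc _ _ hχ hψ), h.nab_lift_incl (adSection_act hχ hΦ) hψ, neg_zero,
    ct.pairing_zero]
  simp

/-- The mixed components of the curvature vanish on the adjoint summand since the representation is
by derivations. -/
lemma naiveCurvature_lift_mixed (hΦ : 𝓟.AdSection Φ) (hχ : (A.reduced H₀).Smooth χ)
    (hΦ₁ : 𝓟.AdSection Φ₁) (p : P) :
    naiveCurvature (A.total H₀) nab (A.lift Φ') (A.lift Φ) (A.incl χ) (A.lift Φ₁) p = 0 := by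
  have ct := total_calculus A H₀
  have e : A.act χ (fun q => (-(2 / 3) : ℝ) • adj G (Φ₁ q) (Φ q)) p =
      (-(2 / 3) : ℝ) • (adj G (A.act χ Φ₁ p) (Φ p) + adj G (Φ₁ p) (A.act χ Φ p)) := by
    have h1 := act_adj (A := A) (ψ := χ) (hΦ₁.const_smul (-(2 / 3))) hΦ p
    have h2 : A.act χ (fun q => (-(2 / 3) : ℝ) • Φ₁ q) p = (-(2 / 3) : ℝ) • A.act χ Φ₁ p := by
      have h3 := diff_clm_comp ((-(2 / 3) : ℝ) • ContinuousLinearMap.id ℝ EG) (hΦ₁.1 p)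
        (A.hlift p (χ.1 (𝓟.proj p)))
      rw [act, act, smul_sub, map_smul]
      exact congrArg (· - _) h3
    simp only [adj_smul_left, h2] at h1
    rw [h1, smul_add]
  rw [h.total.naiveCurvature_apply ct, h.bracket_incl_lift hχ hΦ₁, h.nab_lift_lift hΦ₁ hΦ,
    h.nab_incl_lift hχ hΦ, h.nab_incl_lift hχ ((hΦ₁.adj hΦ).const_smul _),
    h.nab_lift_lift hΦ₁ (adSection_act hχ hΦ), h.nab_lift_lift (adSection_act hχ hΦ₁) hΦ,
    pairing_lift_lift, pairing_lift_lift, pairing_lift_lift, e, killing_smul, killing_smul,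
    killing_smul, killing_add]
  ring

/-- The naive curvature is antisymmetric in two sections if their bracket is, which fails in
general. -/
lemma naiveCurvature_swap (ha : (A.total H₀).Smooth a) (hab : (A.total H₀).bracket b a =
    -(A.total H₀).bracket a b) (hb : (A.total H₀).Smooth b) (hs : (A.total H₀).Smooth s)
    (t : GenSec EP P) (p : P) :
    naiveCurvature (A.total H₀) nab t s b a p = -naiveCurvature (A.total H₀) nab t s a b p := by
  have ct := total_calculus A H₀
  rw [h.total.naiveCurvature_apply ct, h.total.naiveCurvature_apply ct, hab,
    h.nab_neg_left (h.total.bracket_smooth ct ha hb) hs, ct.pairing_neg, Pi.neg_apply]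
  ring

end IsReduction

end PrincipalConnection

end Curvature

/-! ### The Ricci tensor -/

section Ricci

variable {EM EG EP : Type*}
  [NormedAddCommGroup EM] [NormedSpace ℝ EM] [FiniteDimensional ℝ EM]
  [NormedAddCommGroup EG] [NormedSpace ℝ EG] [FiniteDimensional ℝ EG] [CompleteSpace EG]
  [NormedAddCommGroup EP] [NormedSpace ℝ EP] [FiniteDimensional ℝ EP]
  {M G P : Type*}
  [TopologicalSpace M] [ChartedSpace EM M] [IsManifold 𝓘(ℝ, EM) ∞ M] [T2Space M]
  [TopologicalSpace G] [ChartedSpace EG G] [Group G] [LieGroup 𝓘(ℝ, EG) ∞ G] [T2Space G]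
  [CompactSpace G] [LieAlgebra.IsSemisimple ℝ (GroupLieAlgebra 𝓘(ℝ, EG) G)]
  [TopologicalSpace P] [ChartedSpace EP P] [IsManifold 𝓘(ℝ, EP) ∞ P] [T2Space P]
  {𝓟 : PrincipalBundle EM EG EP M G P} {A : PrincipalConnection 𝓟} {H₀ : ThreeForm EM M}

namespace PrincipalConnection

variable {ψ ψ' : RedSec EM EG M P} {Φ Φ' Φ₁ Φ₂ : P → EG} {p : P}

/-- The section of the reduced bundle which is the bracket of two sections of the adjoint bundle acts
on the adjoint bundle through the bracket of its component. -/
lemma act_reduced_bracket (Φ₁ Φ₂ Φ : P → EG) :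
    A.act ((A.reduced H₀).bracket (0, Φ₁, 0) (0, Φ₂, 0)) Φ =
      fun p => adj G (adj G (Φ₁ p) (Φ₂ p)) (Φ p) := by
  ext p
  rw [act, reduced_bracket_fst, reduced_bracket_adjoint]
  have h1 : A.covD Φ p ((0 : Π m : M, TangentSpace 𝓘(ℝ, EM) m) (𝓟.proj p)) = 0 :=
    map_zero (A.covD Φ p)
  beta_reduce
  rw [h1, zero_sub, ← neg_one_smul ℝ (adj G (Φ₁ p) (Φ₂ p)), adj_smul_left, neg_one_smul, neg_neg]

/-- Parseval's identity for the Killing form. -/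
lemma InvariantFrame.sum_killing {ι κ : Type*} [Fintype ι] [Fintype κ] [DecidableEq ι]
    [DecidableEq κ] {e ε : ι → RedSec EM EG M P} {Ψ : κ → P → EG}
    (hF : A.InvariantFrame H₀ p e ε Ψ) (hΦ : 𝓟.AdSection Φ) (hΦ' : 𝓟.AdSection Φ') :
    ∑ b, killing G (Ψ b p) (Φ p) * killing G (Ψ b p) (Φ' p) = -killing G (Φ p) (Φ' p) := by
  have h1 := hF.total.complete.self_of_nhds _ _ (smooth_lift hΦ) (smooth_lift hΦ')
  rw [Fintype.sum_sum_type, pairing_lift_lift] at h1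
  simp only [Sum.elim_inl, Sum.elim_inr, pairing_lift_incl, pairing_lift_lift, zero_mul,
    Finset.sum_const_zero, zero_add, neg_mul_neg] at h1
  rw [h1]
  exact Finset.sum_congr rfl fun b _ => by rw [killing_comm G (Φ p)]

/-- The Killing form is the trace form of the adjoint representation. -/
lemma InvariantFrame.sum_killing_adj {ι κ : Type*} [Fintype ι] [Fintype κ] [DecidableEq ι]
    [DecidableEq κ] {e ε : ι → RedSec EM EG M P} {Ψ : κ → P → EG}
    (hF : A.InvariantFrame H₀ p e ε Ψ) (x y : EG) :
    ∑ b, killing G (adj G (Ψ b p) x) (adj G y (Ψ b p)) = -killing G x y := by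
  let B : EG →ₗ[ℝ] EG →ₗ[ℝ] ℝ := LinearMap.mk₂ ℝ (fun x y => killing G x y)
    (fun x y z => killing_add G x y z) (fun a x y => killing_smul G a x y)
    (fun x y z => map_add _ y z) (fun a x y => map_smul _ a y)
  rw [killing_eq_trace, trace_eq_sum_of_biorthogonal B (e := fun b => Ψ b p)
    (ε := fun b => -Ψ b p) hF.card (fun i j => ?_), ← Finset.sum_neg_distrib]
  · refine Finset.sum_congr rfl fun b _ => ?_
    change _ = -killing G (Ψ b p) (adj G x (adj G y (-Ψ b p)))
    rw [killing_adj, map_neg, map_neg, map_neg, neg_neg]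
  · change killing G (Ψ i p) (-Ψ j p) = _
    rw [map_neg, hF.killing_eq]
    split_ifs <;> simp

namespace IsReduction

variable {nab : GenSec EP P → GenSec EP P → GenSec EP P}
  {nab' : RedSec EM EG M P → RedSec EM EG M P → RedSec EM EG M P}
  (h : A.IsReduction H₀ nab nab')
include h

/-- The iterated derivatives contribute `4/9` by the Jacobi identity, the derivative along the bracket
`-1/3`; the pairing on `Γ_G(K)` is the negative of the Killing form. -/
lemma naiveCurvature_lift (hΦ : 𝓟.AdSection Φ) (hΦ₁ : 𝓟.AdSection Φ₁)
    (hΦ₂ : 𝓟.AdSection Φ₂) (p : P) :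
    naiveCurvature (A.total H₀) nab (A.lift Φ') (A.lift Φ) (A.lift Φ₁) (A.lift Φ₂) p =
      -(1 / 9) * killing G (adj G (adj G (Φ₁ p) (Φ₂ p)) (Φ p)) (Φ' p) := by
  have ct := total_calculus A H₀
  have hb := h.reduced.bracket_smooth (reduced_calculus A H₀) (smooth_adjoint (A := A) (H₀ := H₀)
    hΦ₁) (smooth_adjoint hΦ₂)
  have hs : 𝓟.AdSection (fun p => (-2 : ℝ) • adj G (Φ₁ p) (Φ₂ p)) := (hΦ₁.adj hΦ₂).const_smul _
  rw [h.total.naiveCurvature_apply ct, h.bracket_lift_lift hΦ₁ hΦ₂, h.nab_lift_lift hΦ₁ hΦ,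
    h.nab_lift_lift hΦ₂ hΦ, h.nab_lift_lift hΦ₁ ((hΦ₂.adj hΦ).const_smul _),
    h.nab_lift_lift hΦ₂ ((hΦ₁.adj hΦ).const_smul _),
    h.total.isConnection.add_left _ _ _ (ct.smooth_neg _ (smooth_incl hb)) (smooth_lift hs)
      (smooth_lift hΦ), h.nab_neg_left (smooth_incl hb) (smooth_lift hΦ),
    h.nab_incl_lift hb hΦ, h.nab_lift_lift hs hΦ, act_reduced_bracket, ct.pairing_add,
    ct.pairing_neg, Pi.add_apply, Pi.neg_apply, pairing_lift_lift, pairing_lift_lift,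
    pairing_lift_lift, pairing_lift_lift]
  simp only [map_smul, adj_smul_left, killing_smul]
  rw [adj_adj (G := G) (Φ₁ p) (Φ₂ p), killing_add]
  ring

/-- The part of the quadratic term of the curvature in which the reduced bundle is contracted. -/
lemma sum_nab_incl_lift {ι κ : Type*} [Fintype ι] [Fintype κ] [DecidableEq ι]
    [DecidableEq κ] {e ε : ι → RedSec EM EG M P} {Ψ : κ → P → EG}
    (hF : A.InvariantFrame H₀ p e ε Ψ) (hΦ : 𝓟.AdSection Φ) (hΦ' : 𝓟.AdSection Φ')
    (hΦ₁ : 𝓟.AdSection Φ₁) (hΦ₂ : 𝓟.AdSection Φ₂) :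
    ∑ j, (A.total H₀).pairing (nab (A.incl (e j)) (A.lift Φ₁)) (A.lift Φ) p *
      (A.total H₀).pairing (nab (A.incl (ε j)) (A.lift Φ')) (A.lift Φ₂) p =
      killing G (adj G (Φ₁ p) (Φ p)) (adj G (Φ' p) (Φ₂ p)) := by
  have cr := reduced_calculus A H₀
  have hb := h.reduced.bracket_smooth cr (smooth_adjoint (A := A) (H₀ := H₀) hΦ₁)
    (smooth_adjoint hΦ)
  have hb' := h.reduced.bracket_smooth cr (smooth_adjoint (A := A) (H₀ := H₀) hΦ')
    (smooth_adjoint hΦ₂)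
  have h1 := hF.reduced.complete.self_of_nhds _ _ hb' hb
  rw [reduced_pairing_proj hb'.2.1 hb.2.1, reduced_bracket_fst, reduced_bracket_fst,
    reduced_bracket_adjoint, reduced_bracket_adjoint, map_neg, killing_comm G (-_),
    map_neg, neg_neg] at h1
  have e1 : ∀ (Ψ : RedSec EM EG M P), Ψ.2.2 (𝓟.proj p)
      ((0 : Π m : M, TangentSpace 𝓘(ℝ, EM) m) (𝓟.proj p)) = 0 := fun Ψ => map_zero _
  rw [e1, e1, zero_add, zero_add] at h1
  rw [h1]
  refine Finset.sum_congr rfl fun j _ => ?_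
  rw [h.nab_incl_lift (hF.smooth_left j) hΦ₁, h.nab_incl_lift (hF.smooth_right j) hΦ',
    pairing_lift_lift, pairing_lift_lift, cr.pairing_comm (e j),
    reduced_bracket_pairing hΦ₁ hΦ (hF.smooth_left j),
    reduced_bracket_pairing hΦ' hΦ₂ (hF.smooth_right j)]
  ring

/-- The part of the quadratic term of the curvature in which the adjoint bundle is contracted. -/
lemma sum_nab_lift_lift {ι κ : Type*} [Fintype ι] [Fintype κ] [DecidableEq ι]
    [DecidableEq κ] {e ε : ι → RedSec EM EG M P} {Ψ : κ → P → EG}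
    (hF : A.InvariantFrame H₀ p e ε Ψ) (hΦ : 𝓟.AdSection Φ) (hΦ' : 𝓟.AdSection Φ')
    (hΦ₁ : 𝓟.AdSection Φ₁) (hΦ₂ : 𝓟.AdSection Φ₂) :
    ∑ b, (A.total H₀).pairing (nab (A.lift (Ψ b)) (A.lift Φ₁)) (A.lift Φ) p *
      (A.total H₀).pairing (nab (A.lift (Ψ b)) (A.lift Φ')) (A.lift Φ₂) p =
      -(4 / 9) * killing G (adj G (Φ₁ p) (Φ p)) (adj G (Φ' p) (Φ₂ p)) := by
  have h1 := hF.sum_killing (hΦ₁.adj hΦ) (hΦ'.adj hΦ₂)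
  rw [← neg_inj, neg_neg] at h1
  rw [← h1, mul_neg, neg_mul, neg_neg, Finset.mul_sum]
  refine Finset.sum_congr rfl fun b _ => ?_
  rw [h.nab_lift_lift (hF.adSection b) hΦ₁, h.nab_lift_lift (hF.adSection b) hΦ',
    pairing_lift_lift, pairing_lift_lift, killing_smul, killing_smul, killing_adj, killing_adj]
  ring

lemma ricci_incl (hψ : (A.reduced H₀).Smooth ψ) (hψ' : (A.reduced H₀).Smooth ψ') (p : P) :
    ricci (A.total H₀) nab (A.incl ψ) (A.incl ψ') p =
      ricci (A.reduced H₀) nab' ψ ψ' (𝓟.proj p) := by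
  have ct := total_calculus A H₀
  have hc := h.reduced.isConnection.smooth
  obtain ⟨ι, κ, _, _, _, _, e, ε, Ψ, hF⟩ := exists_invariantFrame A H₀ p
  have he := fun i => smooth_incl (hF.smooth_left i)
  have hΨ := fun i => smooth_lift (A := A) (H₀ := H₀) (hF.adSection i)
  rw [h.total.ricci_eq ct (total_localFrame A H₀ p) hF.total (smooth_incl hψ) (smooth_incl hψ'),
    h.reduced.ricci_eq (reduced_calculus A H₀) (reduced_localFrame A H₀ _) hF.reduced hψ hψ',
    Fintype.sum_sum_type]
  simp only [riemannIn, Fintype.sum_sum_type, Sum.elim_inl, Sum.elim_inr]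
  have e1 : ∀ i, naiveCurvature (A.total H₀) nab (A.lift (Ψ i)) (A.incl ψ') (A.lift (Ψ i))
      (A.incl ψ) p = 0 := fun i =>
    h.naiveCurvature_lift_incl hψ' (isPure_lift (hF.adSection i)) (isPure_incl hψ) p
  have e2 : ∀ i, naiveCurvature (A.total H₀) nab (A.incl ψ) (A.lift (Ψ i)) (A.incl ψ')
      (A.lift (Ψ i)) p = 0 := fun i => h.naiveCurvature_incl_lift (hF.adSection i)
    (isPure_incl hψ') (isPure_lift (hF.adSection i)) p
  simp only [e1, e2, h.pairing_nab_lift_incl (he _) (hF.adSection _),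
    h.pairing_nab_lift_incl (hΨ _) (hF.adSection _), h.nab_lift_incl (hF.adSection _) hψ',
    ct.pairing_zero, Pi.zero_apply, mul_zero, zero_mul, Finset.sum_const_zero, add_zero]
  refine Finset.sum_congr rfl fun i _ => ?_
  rw [h.naiveCurvature_incl hψ' (hF.smooth_right i) (hF.smooth_left i) hψ,
    h.naiveCurvature_incl (hF.smooth_left i) hψ hψ' (hF.smooth_right i)]
  refine congrArg (fun z => 1 / 2 * (_ + z)) (Finset.sum_congr rfl fun j _ => ?_)
  rw [h.nab_incl_incl (hF.smooth_left j) (hF.smooth_left i),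
    h.nab_incl_incl (hF.smooth_right j) hψ',
    pairing_incl_incl p (hc _ _ (hF.smooth_left j) (hF.smooth_left i)).2.1 hψ.2.1,
    pairing_incl_incl p (hc _ _ (hF.smooth_right j) hψ').2.1 (hF.smooth_right i).2.1]

lemma ricci_lift (hΦ : 𝓟.AdSection Φ) (hΦ' : 𝓟.AdSection Φ') (p : P) :
    ricci (A.total H₀) nab (A.lift Φ) (A.lift Φ') p = -(1 / 6) * killing G (Φ p) (Φ' p) := by
  have ct := total_calculus A H₀
  obtain ⟨ι, κ, _, _, _, _, e, ε, Ψ, hF⟩ := exists_invariantFrame A H₀ p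
  have he := fun i => smooth_incl (hF.smooth_left i)
  have hΨ := fun i => smooth_lift (A := A) (H₀ := H₀) (hF.adSection i)
  rw [h.total.ricci_eq ct (total_localFrame A H₀ p) hF.total (smooth_lift hΦ) (smooth_lift hΦ'),
    Fintype.sum_sum_type]
  simp only [riemannIn, Fintype.sum_sum_type, Sum.elim_inl, Sum.elim_inr]
  have e1 : ∀ i, naiveCurvature (A.total H₀) nab (A.incl (ε i)) (A.lift Φ') (A.incl (e i))
      (A.lift Φ) p = 0 := fun i => h.naiveCurvature_incl_lift hΦ' (isPure_incl (hF.smooth_left i))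
    (isPure_lift hΦ) p
  have e2 : ∀ i, naiveCurvature (A.total H₀) nab (A.lift Φ) (A.incl (e i)) (A.lift Φ')
      (A.incl (ε i)) p = 0 := fun i => h.naiveCurvature_lift_incl (hF.smooth_left i)
    (isPure_lift hΦ') (isPure_incl (hF.smooth_right i)) p
  simp only [e1, e2, h.pairing_nab_incl_lift (he _) (hF.smooth_left _),
    h.pairing_nab_incl_lift (hΨ _) (hF.smooth_left _), zero_mul, mul_zero,
    Finset.sum_const_zero, add_zero, zero_add]
  rw [neg_mul, ← mul_neg, ← hF.sum_killing_adj, Finset.mul_sum]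
  refine Finset.sum_congr rfl fun a _ => ?_
  rw [h.naiveCurvature_lift hΦ' (hF.adSection a) hΦ, h.naiveCurvature_lift (hF.adSection a) hΦ'
    (hF.adSection a), h.sum_nab_incl_lift hF hΦ hΦ' (hF.adSection a) (hF.adSection a),
    h.sum_nab_lift_lift hF hΦ hΦ' (hF.adSection a) (hF.adSection a), killing_adj,
    killing_adj G (adj G (Φ' p) (Ψ a p)), killing_comm G (adj G (Φ' p) (Ψ a p))]
  ring

lemma ricci_incl_lift (hψ : (A.reduced H₀).Smooth ψ) (hΦ : 𝓟.AdSection Φ) (p : P) :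
    ricci (A.total H₀) nab (A.incl ψ) (A.lift Φ) p = 0 := by
  have ct := total_calculus A H₀
  obtain ⟨ι, κ, _, _, _, _, e, ε, Ψ, hF⟩ := exists_invariantFrame A H₀ p
  have he := fun i => smooth_incl (hF.smooth_left i)
  have hε := fun i => smooth_incl (hF.smooth_right i)
  have hΨ := fun i => smooth_lift (A := A) (H₀ := H₀) (hF.adSection i)
  rw [h.total.ricci_eq ct (total_localFrame A H₀ p) hF.total (smooth_incl hψ) (smooth_lift hΦ),
    Fintype.sum_sum_type]
  simp only [riemannIn, Fintype.sum_sum_type, Sum.elim_inl, Sum.elim_inr]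
  have e1 : ∀ i, naiveCurvature (A.total H₀) nab (A.incl (ε i)) (A.lift Φ) (A.incl (e i))
      (A.incl ψ) p = 0 := fun i => h.naiveCurvature_incl_lift hΦ (isPure_incl (hF.smooth_left i))
    (isPure_incl hψ) p
  have e2 : ∀ i, naiveCurvature (A.total H₀) nab (A.incl ψ) (A.incl (e i)) (A.lift Φ)
      (A.incl (ε i)) p = 0 := fun i => h.naiveCurvature_incl_mixed' (hF.smooth_left i)
    (hF.smooth_right i) hΦ _ p
  have e3 : ∀ i, naiveCurvature (A.total H₀) nab (A.lift (Ψ i)) (A.lift Φ) (A.lift (Ψ i))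
      (A.incl ψ) p = 0 := fun i => by
    rw [h.naiveCurvature_swap (smooth_incl hψ) _ (hΨ i) (smooth_lift hΦ),
      h.naiveCurvature_lift_mixed hΦ hψ (hF.adSection i), neg_zero]
    rw [h.bracket_lift_incl hψ (hF.adSection i), h.bracket_incl_lift hψ (hF.adSection i)]
  have e4 : ∀ i, naiveCurvature (A.total H₀) nab (A.incl ψ) (A.lift (Ψ i)) (A.lift Φ)
      (A.lift (Ψ i)) p = 0 := fun i => h.naiveCurvature_incl_lift (hF.adSection i)
    (isPure_lift hΦ) (isPure_lift (hF.adSection i)) p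
  simp only [e1, e2, e3, e4, h.pairing_nab_lift_incl (he _) (hF.adSection _),
    h.pairing_nab_lift_incl (hε _) hΦ, h.pairing_nab_lift_incl (hΨ _) hΦ,
    h.pairing_nab_lift_incl (hΨ _) (hF.adSection _), zero_mul, mul_zero,
    Finset.sum_const_zero, add_zero]

lemma ricci_lift_incl (hψ : (A.reduced H₀).Smooth ψ) (hΦ : 𝓟.AdSection Φ) (p : P) :
    ricci (A.total H₀) nab (A.lift Φ) (A.incl ψ) p = 0 := by
  have ct := total_calculus A H₀
  obtain ⟨ι, κ, _, _, _, _, e, ε, Ψ, hF⟩ := exists_invariantFrame A H₀ p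
  have he := fun i => smooth_incl (hF.smooth_left i)
  have hε := fun i => smooth_incl (hF.smooth_right i)
  have hΨ := fun i => smooth_lift (A := A) (H₀ := H₀) (hF.adSection i)
  rw [h.total.ricci_eq ct (total_localFrame A H₀ p) hF.total (smooth_lift hΦ) (smooth_incl hψ),
    Fintype.sum_sum_type]
  simp only [riemannIn, Fintype.sum_sum_type, Sum.elim_inl, Sum.elim_inr]
  have e1 : ∀ i, naiveCurvature (A.total H₀) nab (A.incl (ε i)) (A.incl ψ) (A.incl (e i))
      (A.lift Φ) p = 0 := fun i => h.naiveCurvature_incl_mixed hψ (hF.smooth_left i) hΦ _ p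
  have e2 : ∀ i, naiveCurvature (A.total H₀) nab (A.lift Φ) (A.incl (e i)) (A.incl ψ)
      (A.incl (ε i)) p = 0 := fun i => h.naiveCurvature_lift_incl (hF.smooth_left i)
    (isPure_incl hψ) (isPure_incl (hF.smooth_right i)) p
  have e3 : ∀ i, naiveCurvature (A.total H₀) nab (A.lift (Ψ i)) (A.incl ψ) (A.lift (Ψ i))
      (A.lift Φ) p = 0 := fun i => h.naiveCurvature_lift_incl hψ (isPure_lift (hF.adSection i))
    (isPure_lift hΦ) p
  have e4 : ∀ i, naiveCurvature (A.total H₀) nab (A.lift Φ) (A.lift (Ψ i)) (A.incl ψ)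
      (A.lift (Ψ i)) p = 0 := fun i => h.naiveCurvature_lift_mixed (hF.adSection i) hψ
    (hF.adSection i) p
  simp only [e1, e2, e3, e4, h.pairing_nab_incl_lift (he _) (hF.smooth_left _),
    h.pairing_nab_incl_lift (hε _) hψ, h.pairing_nab_incl_lift (hΨ _) hψ,
    h.pairing_nab_incl_lift (hΨ _) (hF.smooth_left _), zero_mul, mul_zero,
    Finset.sum_const_zero, add_zero]

end IsReduction

end PrincipalConnection

end Ricci

/-! ### Generalized metrics under reduction -/

namespace IsGeneralizedMetric

variable {X S : Type*} [AddCommGroup S] [TopologicalSpace X] {𝒞 : BracketData X S} {τ : S → S}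
  (hτ : IsGeneralizedMetric 𝒞 τ) (c : SectionCalculus 𝒞)
include hτ c

lemma map_neg {s : S} (hs : 𝒞.Smooth s) : τ (-s) = -τ s := by
  rw [← c.fsmul_const_neg, hτ.fsmul _ _ (c.fun_const _) hs, c.fsmul_const_neg]

lemma pairing_map_left {s t : S} (hs : 𝒞.Smooth s) (ht : 𝒞.Smooth t) :
    𝒞.pairing (τ s) t = 𝒞.pairing s (τ t) := by
  rw [c.pairing_comm]
  exact hτ.symm _ _ ht hs

end IsGeneralizedMetric

section Metric

variable {EM EG EP : Type*}
  [NormedAddCommGroup EM] [NormedSpace ℝ EM] [FiniteDimensional ℝ EM]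
  [NormedAddCommGroup EG] [NormedSpace ℝ EG] [FiniteDimensional ℝ EG] [CompleteSpace EG]
  [NormedAddCommGroup EP] [NormedSpace ℝ EP] [FiniteDimensional ℝ EP]
  {M G P : Type*}
  [TopologicalSpace M] [ChartedSpace EM M] [IsManifold 𝓘(ℝ, EM) ∞ M] [T2Space M]
  [TopologicalSpace G] [ChartedSpace EG G] [Group G] [LieGroup 𝓘(ℝ, EG) ∞ G] [T2Space G]
  [CompactSpace G] [LieAlgebra.IsSemisimple ℝ (GroupLieAlgebra 𝓘(ℝ, EG) G)]
  [TopologicalSpace P] [ChartedSpace EP P] [IsManifold 𝓘(ℝ, EP) ∞ P] [T2Space P]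
  {𝓟 : PrincipalBundle EM EG EP M G P} {A : PrincipalConnection 𝓟} {H₀ : ThreeForm EM M}

namespace PrincipalConnection

variable {τ : GenSec EP P → GenSec EP P} {τ' : RedSec EM EG M P → RedSec EM EG M P}

/-- A reducible generalized metric is the identity on `Γ_G(K)`, because the pairing is positive
definite there. -/
lemma MetricReduces.map_lift (hτ : IsGeneralizedMetric (A.total H₀) τ)
    (hred : A.MetricReduces H₀ τ τ') {Φ : P → EG}
    (hΦ : 𝓟.AdSection Φ) : τ (A.lift Φ) = A.lift Φ := by
  have ct := total_calculus A H₀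
  have hl := smooth_lift (A := A) (H₀ := H₀) hΦ
  have hs := hτ.smooth _ hl
  -- On `u` the involution is `-1`, so that `⟨u, u⟩ ≤ 0`; but `u` lies in `K`.
  set u := A.lift Φ + -τ (A.lift Φ) with hu
  have hus : (A.total H₀).Smooth u := ct.smooth_add _ _ hl (ct.smooth_neg _ hs)
  have hτu : τ u = -u := by
    rw [hu, hτ.add _ _ hl (ct.smooth_neg _ hs), hτ.map_neg ct hs, hτ.involutive _ hl]
    abel
  have hperp : ∀ χ p, (A.reduced H₀).Smooth χ → (A.total H₀).pairing u (A.incl χ) p = 0 := by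
    intro χ p hχ
    rw [hu, ct.pairing_add, ct.pairing_neg, hτ.pairing_map_left ct hl (smooth_incl hχ),
      hred.induces _ hχ, Pi.add_apply, Pi.neg_apply, pairing_lift_incl, pairing_lift_incl]
    ring
  have hnonneg : ∀ p, 0 ≤ (A.total H₀).pairing u u p := by
    intro p
    obtain ⟨ι, κ, _, _, _, _, e, ε, Ψ, hF⟩ := exists_invariantFrame A H₀ p
    rw [hF.total.complete.self_of_nhds u u hus hus, Fintype.sum_sum_type]
    simp only [Sum.elim_inl, Sum.elim_inr, hperp _ _ (hF.smooth_right _), zero_mul,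
      Finset.sum_const_zero, zero_add, ct.pairing_comm (A.lift _) u]
    exact Finset.sum_nonneg fun b _ => mul_self_nonneg _
  have hzero : ∀ χ, (A.total H₀).Smooth χ → (A.total H₀).pairing u χ = 0 := by
    refine fun χ hχ => funext fun p => ?_
    by_contra hne
    have h1 := hτ.pos u p hus ⟨χ, hχ, hne⟩
    rw [genMetric, hτu, ct.pairing_neg_right, Pi.neg_apply] at h1
    linarith [hnonneg p]
  have h0 : u = 0 := ct.ext _ _ hus ct.smooth_zero fun χ hχ => by
    rw [hzero χ hχ, ct.pairing_zero]
  exact (add_neg_eq_zero.1 h0).symm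

namespace IsReduction

variable {nab : GenSec EP P → GenSec EP P → GenSec EP P}
  {nab' : RedSec EM EG M P → RedSec EM EG M P → RedSec EM EG M P}
  (h : A.IsReduction H₀ nab nab') (hτ : IsGeneralizedMetric (A.total H₀) τ)
  (hτ' : IsGeneralizedMetric (A.reduced H₀) τ') (hred : A.MetricReduces H₀ τ τ')
include h hτ hτ' hred

lemma ricciScalar_eq (p : P) : ricciScalar (A.total H₀) τ nab p =
    ricciScalar (A.reduced H₀) τ' nab' (𝓟.proj p) + (1 / 6) * Module.finrank ℝ EG := by
  obtain ⟨ι, κ, _, _, _, _, e, ε, Ψ, hF⟩ := exists_invariantFrame A H₀ p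
  rw [h.total.ricciScalar_eq (total_calculus A H₀) hτ (total_localFrame A H₀ p) hF.total,
    h.reduced.ricciScalar_eq (reduced_calculus A H₀) hτ' (reduced_localFrame A H₀ _) hF.reduced,
    Fintype.sum_sum_type]
  simp only [Sum.elim_inl, Sum.elim_inr]
  congr 1
  · refine Finset.sum_congr rfl fun i _ => ?_
    rw [hred.induces _ (hF.smooth_right i),
      h.ricci_incl (hτ'.smooth _ (hF.smooth_right i)) (hF.smooth_left i)]
  · have h1 : ∀ a, ricci (A.total H₀) nab (τ (A.lift (Ψ a))) (A.lift (Ψ a)) p = 1 / 6 := by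
      intro a
      rw [hred.map_lift hτ (hF.adSection a), h.ricci_lift (hF.adSection a) (hF.adSection a),
        hF.killing_eq]
      norm_num
    rw [Finset.sum_congr rfl fun a _ => h1 a, Finset.sum_const, Finset.card_univ, hF.card,
      nsmul_eq_mul, mul_comm]

/-- Sections of `V₊` and `V₋` on the total space need not be invariant.  Since the Ricci tensor only
depends on values at `p`, they are compared with invariant sections of the same value, up to the
component in `K`, on which the Ricci tensor with a section of `V₋` vanishes. -/
lemma ricciCompatible_iff :
    RicciCompatible (A.total H₀) τ nab ↔ RicciCompatible (A.reduced H₀) τ' nab' := by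
  have ct := total_calculus A H₀
  have cr := reduced_calculus A H₀
  constructor
  · intro hc ψ ψ' hψ hψ' h1 h2 m
    obtain ⟨p, rfl⟩ := 𝓟.proj_surjective m
    rw [← h.ricci_incl hψ hψ']
    refine hc _ _ (smooth_incl hψ) (smooth_incl hψ') ?_ ?_ p
    · rw [hred.induces _ hψ, h1]
    · rw [hred.induces _ hψ', h2, incl_neg]
  · intro hc φ φ' hφ hφ' h1 h2 p
    obtain ⟨ι, κ, _, _, _, _, e, ε, Ψ, hF⟩ := exists_invariantFrame A H₀ p
    -- The section of the reduced bundle which corresponds to the projection of `v` at `p`.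
    let r : GenSec EP P → RedSec EM EG M P := fun v =>
      ∑ i, (A.reduced H₀).fsmul (fun _ => (A.total H₀).pairing v (A.incl (ε i)) p) (e i)
    have hes : ∀ v i, (A.reduced H₀).Smooth
        ((A.reduced H₀).fsmul (fun _ => (A.total H₀).pairing v (A.incl (ε i)) p) (e i)) :=
      fun v i => cr.smooth_fsmul _ _ (cr.fun_const _) (hF.smooth_left i)
    have hr : ∀ v, (A.reduced H₀).Smooth (r v) := fun v => cr.smooth_sum _ _ (hes v)
    have hpair : ∀ v χ, (A.total H₀).Smooth v → (A.reduced H₀).Smooth χ →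
        (A.reduced H₀).pairing (r v) χ (𝓟.proj p) = (A.total H₀).pairing v (A.incl χ) p := by
      intro v χ hv hχ
      rw [hF.total.complete.self_of_nhds v _ hv (smooth_incl hχ), Fintype.sum_sum_type]
      simp only [Sum.elim_inl, Sum.elim_inr, pairing_lift_incl, mul_zero, Finset.sum_const_zero,
        add_zero]
      rw [cr.pairing_sum, Finset.sum_apply]
      refine Finset.sum_congr rfl fun i _ => ?_
      rw [cr.pairing_fsmul, Pi.mul_apply, pairing_incl_incl p (hF.smooth_left i).2.1 hχ.2.1]
    have hexp : ∀ {T : RedSec EM EG M P → ℝ}, IsTensorialAt (A.reduced H₀) (𝓟.proj p) T → ∀ v,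
        T (r v) = ∑ i, (A.total H₀).pairing v (A.incl (ε i)) p * T (e i) := by
      intro T hT v
      rw [hT.sum cr _ _ (hes v)]
      exact Finset.sum_congr rfl fun i _ => hT.fsmul _ _ (cr.fun_const _) (hF.smooth_left i)
    have hl := total_localFrame A H₀ p
    have hl' := reduced_localFrame A H₀ (𝓟.proj p)
    have hperp : ∀ a, (A.total H₀).pairing φ' (A.lift (Ψ a)) p = 0 := by
      intro a
      have h3 := congrFun (hτ.pairing_map_left ct hφ' (smooth_lift (hF.adSection a))) p
      rw [hred.map_lift hτ (hF.adSection a), h2, ct.pairing_neg, Pi.neg_apply] at h3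
      linarith
    have hlift : ∀ a, ricci (A.total H₀) nab (A.lift (Ψ a)) φ' p = 0 := by
      intro a
      rw [(h.total.ricci_tensorial_right ct hl (smooth_lift (hF.adSection a))).expand ct hF.total
        hφ', Fintype.sum_sum_type]
      simp only [Sum.elim_inl, Sum.elim_inr, hperp, h.ricci_lift_incl (hF.smooth_left _)
        (hF.adSection a), mul_zero, zero_mul, Finset.sum_const_zero, add_zero]
    have hincl : ∀ i, ricci (A.total H₀) nab (A.incl (e i)) φ' p =
        ricci (A.reduced H₀) nab' (e i) (r φ') (𝓟.proj p) := by
      intro i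
      rw [(h.total.ricci_tensorial_right ct hl (smooth_incl (hF.smooth_left i))).expand ct hF.total
        hφ', Fintype.sum_sum_type,
        hexp (h.reduced.ricci_tensorial_right cr hl' (hF.smooth_left i)) φ']
      simp only [Sum.elim_inl, Sum.elim_inr, hperp, zero_mul, Finset.sum_const_zero, add_zero]
      exact Finset.sum_congr rfl fun j _ => by
        rw [h.ricci_incl (hF.smooth_left i) (hF.smooth_left j)]
    have hmain : ricci (A.total H₀) nab φ φ' p =
        ricci (A.reduced H₀) nab' (r φ) (r φ') (𝓟.proj p) := by
      rw [(h.total.ricci_tensorial_left ct hl hφ').expand ct hF.total hφ, Fintype.sum_sum_type,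
        hexp (h.reduced.ricci_tensorial_left cr hl' (hr φ')) φ]
      simp only [Sum.elim_inl, Sum.elim_inr, hlift, hincl, mul_zero, Finset.sum_const_zero,
        add_zero]
    have hr1 := hτ'.smooth _ (hr φ)
    have hr2 := hτ'.smooth _ (hr φ')
    -- At the point below `p` the sections `r φ` and `r φ'` are eigenvectors of `τ'`, so that they can
    -- be replaced by their global projections to the eigenbundles.
    have htau : ∀ v χ, (A.total H₀).Smooth v → (A.reduced H₀).Smooth χ →
        (A.reduced H₀).pairing (τ' (r v)) χ (𝓟.proj p) =
          (A.total H₀).pairing (τ v) (A.incl χ) p := by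
      intro v χ hv hχ
      rw [hτ'.pairing_map_left cr (hr v) hχ, hpair v _ hv (hτ'.smooth _ hχ),
        hτ.pairing_map_left ct hv (smooth_incl hχ), hred.induces _ hχ]
    have heig : ∀ t, (A.reduced H₀).Smooth t → ricci (A.reduced H₀) nab' (τ' (r φ)) t (𝓟.proj p) =
        ricci (A.reduced H₀) nab' (r φ) t (𝓟.proj p) := fun t ht =>
      (h.reduced.ricci_tensorial_left cr hl' ht).congr_of_pairing cr hF.reduced hr1 (hr φ)
        fun χ hχ => by rw [htau φ χ hφ hχ, h1, hpair φ χ hφ hχ]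
    have heig' : ∀ t, (A.reduced H₀).Smooth t →
        ricci (A.reduced H₀) nab' t (-τ' (r φ')) (𝓟.proj p) =
        ricci (A.reduced H₀) nab' t (r φ') (𝓟.proj p) := fun t ht =>
      (h.reduced.ricci_tensorial_right cr hl' ht).congr_of_pairing cr hF.reduced
        (cr.smooth_neg _ hr2) (hr φ') fun χ hχ => by
          rw [cr.pairing_neg, Pi.neg_apply, htau φ' χ hφ' hχ, h2, hpair φ' χ hφ' hχ, ct.pairing_neg,
            Pi.neg_apply, neg_neg]
    have hs1 := cr.smooth_add _ _ (hr φ) hr1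
    have hs2 := cr.smooth_add _ _ (hr φ') (cr.smooth_neg _ hr2)
    have h3 := hc _ _ hs1 hs2 (by
      rw [hτ'.add _ _ (hr φ) hr1, hτ'.involutive _ (hr φ), add_comm]) (by
      rw [hτ'.add _ _ (hr φ') (cr.smooth_neg _ hr2), hτ'.map_neg cr hr2,
        hτ'.involutive _ (hr φ')]
      abel) (𝓟.proj p)
    have h4 := (h.reduced.ricci_tensorial_right cr hl' hs1).add _ _ (hr φ') (cr.smooth_neg _ hr2)
    have h5 := (h.reduced.ricci_tensorial_left cr hl' (hr φ')).add _ _ (hr φ) hr1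
    simp only [heig' _ hs1] at h4
    simp only [heig _ (hr φ')] at h5
    rw [hmain]
    linarith

end IsReduction

end PrincipalConnection

end Metric

end CourantReduction

end

open CourantReduction in
theorem proposition6p2 {EM EG EP : Type*}
    [NormedAddCommGroup EM] [NormedSpace ℝ EM] [FiniteDimensional ℝ EM]
    [NormedAddCommGroup EG] [NormedSpace ℝ EG] [FiniteDimensional ℝ EG] [CompleteSpace EG]
    [NormedAddCommGroup EP] [NormedSpace ℝ EP] [FiniteDimensional ℝ EP]
    {M G P : Type*}
    [TopologicalSpace M] [ChartedSpace EM M] [IsManifold 𝓘(ℝ, EM) ∞ M]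
    [T2Space M] [SecondCountableTopology M]
    [TopologicalSpace G] [ChartedSpace EG G] [Group G] [LieGroup 𝓘(ℝ, EG) ∞ G]
    [T2Space G] [CompactSpace G] [LieAlgebra.IsSemisimple ℝ (GroupLieAlgebra 𝓘(ℝ, EG) G)]
    [TopologicalSpace P] [ChartedSpace EP P] [IsManifold 𝓘(ℝ, EP) ∞ P]
    [T2Space P] [SecondCountableTopology P]
    (𝓟 : PrincipalBundle EM EG EP M G P) (A : PrincipalConnection 𝓟) (H₀ : ThreeForm EM M)
    (τ : GenSec EP P → GenSec EP P) (τ' : RedSec EM EG M P → RedSec EM EG M P)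
    (hτ : IsGeneralizedMetric (A.total H₀) τ) (hτ' : IsGeneralizedMetric (A.reduced H₀) τ')
    (hred : A.MetricReduces H₀ τ τ')
    (nab : GenSec EP P → GenSec EP P → GenSec EP P)
    (nab' : RedSec EM EG M P → RedSec EM EG M P → RedSec EM EG M P)
    (hnab : IsLeviCivita (A.total H₀) τ nab) (hnab' : IsLeviCivita (A.reduced H₀) τ' nab')
    (hrel : A.RelevantForReduction H₀ nab nab') :
    (RicciCompatible (A.total H₀) τ nab ↔ RicciCompatible (A.reduced H₀) τ' nab') ∧
    (∀ ψ ψ', (A.reduced H₀).Smooth ψ → (A.reduced H₀).Smooth ψ' → ∀ p,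
      ricci (A.total H₀) nab (A.incl ψ) (A.incl ψ') p =
        ricci (A.reduced H₀) nab' ψ ψ' (𝓟.proj p)) ∧
    (∀ Φ Φ', 𝓟.AdSection Φ → 𝓟.AdSection Φ' → ∀ p,
      ricci (A.total H₀) nab (A.lift Φ) (A.lift Φ') p = -(1 / 6) * killing G (Φ p) (Φ' p)) ∧
    (∀ ψ Φ, (A.reduced H₀).Smooth ψ → 𝓟.AdSection Φ → ∀ p,
      ricci (A.total H₀) nab (A.incl ψ) (A.lift Φ) p = 0 ∧
      ricci (A.total H₀) nab (A.lift Φ) (A.incl ψ) p = 0) ∧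
    (∀ p, ricciScalar (A.total H₀) τ nab p =
      ricciScalar (A.reduced H₀) τ' nab' (𝓟.proj p) + (1 / 6) * Module.finrank ℝ EG) := by
  have h : A.IsReduction H₀ nab nab' := ⟨hnab.isTorsionFree, hnab'.isTorsionFree, hrel⟩
  exact ⟨h.ricciCompatible_iff hτ hτ' hred, fun ψ ψ' hψ hψ' p => h.ricci_incl hψ hψ' p,
    fun Φ Φ' hΦ hΦ' p => h.ricci_lift hΦ hΦ' p,
    fun ψ Φ hψ hΦ p => ⟨h.ricci_incl_lift hψ hΦ p, h.ricci_lift_incl hψ hΦ p⟩,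
    fun p => h.ricciScalar_eq hτ hτ' hred p⟩
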